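/- **Theorem.** Let $m\ge 1$ be an integer and let $\tau\in\mathbb C$ with $\operatorname{Im}\tau>0$. Let $$\theta(z)=-\sum_{j\in\mathbb Z}e^{\pi i(j+\frac12)^2\tau+2\pi i(j+\frac12)(z+\frac12)},$$ and for $\eta\in\mathbb C\setminus\{0\}$ let $L$ be the $q$-Lamé difference operator $$L\psi(\lambda)=\frac{\theta(\lambda+2\eta m)}{\theta(\lambda)}\psi(\lambda-2\eta)+\frac{\theta(\lambda-2\eta m)}{\theta(\lambda)}\psi(\lambda+2\eta).$$ A pair $(t,c)=(t_1,\dots,t_m,c)\in\mathbb C^m\times\mathbb C$ is called a *solution of the Bethe ansatz equations* if $t_i\not\equiv t_j \pmod{\mathbb Z+\tau\mathbb Z}$ for $i\neq j$ and $$\frac{\theta(t_i-\eta(1+2m))}{\theta(t_i-\eta(1-2m))}\prod_{j\ne i}\frac{\theta(t_j-t_i-2\eta)}{\theta(t_j-t_i+2\eta)}=e^{4\eta c},\qquad i=1,\dots,m,$$ all theta factors being nonzero. Its *eigenvalue* and its *Bethe function* are $$\epsilon(t,c)=e^{-2\eta c}\,\frac{\theta(4\eta m)}{\theta(2\eta m)}\prod_{j=1}^m\frac{\theta(t_j+(2m-3)\eta)}{\theta(t_j+(2m-1)\eta)},\qquad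 \psi_{(t,c)}(\lambda)=e^{c\lambda}\prod_{j=1}^m\theta(\lambda+t_j-\eta).$$ Pairs $(t,c)$ are identified if they differ by a composition of permutations of the $t_i$, translations $t_i\mapsto t_i+ 1$, translations $(t_i,c)\mapsto(t_i+\tau,\,c+2\pi i)$, $c\mapsto c+\pi i/\eta$, and their inverses; these operations preserve the Bethe ansatz equations and the eigenvalue, and multiply $\psi_{(t,c)}$ by a nonvanishing $2\eta$-periodic entire function. Let $K$ be the field of $2\eta$-periodic meromorphic functions on $\mathbb C$. Then there is a countable set $N\subset\mathbb C$ (depending on $m,\tau$) such that for every $\eta\in\mathbb C\setminus N$, $\eta\neq0$, there is a finite set $F\subset\mathbb C$ such that for every $\epsilon\in\mathbb C\setminus F$ the following holds. Up to the above identification there are exactly two distinct solutions of the Bethe ansatz equations with eigenvalue $\epsilon$, and they are of the form $(t_1,\dots,t_m,c)$ and $(2\eta-t_1,\dots,2\eta-t_m,-c)$. The corresponding Bethe functions $\psi_+,\psi_-$ satisfy $L\psi_\pm=\epsilon\psi_\pm$ and are linearly independent over $K$, and every meromorphic function $\psi$ on $\mathbb C$ with $L\psi=\epsilon\psi$ is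 a linear combination of $\psi_+$ and $\psi_-$ with coefficients in $K$. -/

import Mathlib

open Complex Filter

noncomputable section

namespace LameBethe

/-- Jacobi's (odd) theta function
`θ(z) = -∑_{j ∈ ℤ} exp(π i (j + 1/2)² τ + 2 π i (j + 1/2)(z + 1/2))`. -/
def theta (τ z : ℂ) : ℂ :=
  -∑' j : ℤ, cexp (Real.pi * I * ((j : ℂ) + 1 / 2) ^ 2 * τ
    + 2 * Real.pi * I * ((j : ℂ) + 1 / 2) * (z + 1 / 2))

/-- The `q`-deformed Lamé operator
`(L ψ)(x) = θ(x + 2ηm)/θ(x) · ψ(x - 2η) + θ(x - 2ηm)/θ(x) · ψ(x + 2η)`. -/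
def lameOp (τ η : ℂ) (m : ℕ) (ψ : ℂ → ℂ) (x : ℂ) : ℂ :=
  theta τ (x + 2 * η * m) / theta τ x * ψ (x - 2 * η)
    + theta τ (x - 2 * η * m) / theta τ x * ψ (x + 2 * η)

/-- `ψ` is a meromorphic function on `ℂ` that solves `L ψ = ε ψ`, as an identity of meromorphic
functions, i.e. off a closed discrete set. -/
def IsLameSolution (τ η : ℂ) (m : ℕ) (ε : ℂ) (ψ : ℂ → ℂ) : Prop :=
  Meromorphic ψ ∧ ∀ᶠ x in codiscrete ℂ, lameOp τ η m ψ x = ε * ψ x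

/-- `A` represents an element of the field `K` of `2η`-periodic meromorphic functions on `ℂ`
(two functions represent the same element if they agree off a closed discrete set). -/
def IsPeriodicMeromorphic (η : ℂ) (A : ℂ → ℂ) : Prop :=
  Meromorphic A ∧ ∀ᶠ x in codiscrete ℂ, A (x + 2 * η) = A x

/-- `f` and `g` are linearly independent over `K`. -/
def LinIndepOverPeriodic (η : ℂ) (f g : ℂ → ℂ) : Prop :=
  ∀ A B : ℂ → ℂ, IsPeriodicMeromorphic η A → IsPeriodicMeromorphic η B →
    (∀ᶠ x in codiscrete ℂ, A x * f x + B x * g x = 0) →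
    (∀ᶠ x in codiscrete ℂ, A x = 0) ∧ (∀ᶠ x in codiscrete ℂ, B x = 0)

/-- `F` is a linear combination of `f` and `g` with coefficients in `K`. -/
def IsCombOverPeriodic (η : ℂ) (f g F : ℂ → ℂ) : Prop :=
  ∃ A B : ℂ → ℂ, IsPeriodicMeromorphic η A ∧ IsPeriodicMeromorphic η B ∧
    ∀ᶠ x in codiscrete ℂ, F x = A x * f x + B x * g x

/-- Representatives `(t₁, …, t_m, c)`. -/
abbrev Param (m : ℕ) : Type := (Fin m → ℂ) × ℂ

/-- `(t, c)` solves the Bethe ansatz equations, with the `t_i` pairwise distinct modulo `ℤ + τℤ`.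
Since the right-hand side of the equations is nonzero, and division by zero gives zero,
the equations force every theta factor on the left-hand side to be nonzero. -/
def IsBetheSolution (τ η : ℂ) (m : ℕ) (p : Param m) : Prop :=
  (∀ i j : Fin m, i ≠ j → ¬ ∃ k l : ℤ, p.1 i - p.1 j = k + l * τ) ∧
  ∀ i : Fin m,
    theta τ (p.1 i - η * (1 + 2 * m)) / theta τ (p.1 i - η * (1 - 2 * m))
      * ∏ j ∈ Finset.univ.erase i,
          (theta τ (p.1 j - p.1 i - 2 * η) / theta τ (p.1 j - p.1 i + 2 * η))
    = cexp (4 * η * p.2)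

/-- The eigenvalue attached to `(t, c)`:
`e^{-2ηc} θ(4ηm)/θ(2ηm) ∏_j θ(t_j + (2m-3)η)/θ(t_j + (2m-1)η)`. -/
def betheEigenvalue (τ η : ℂ) (m : ℕ) (p : Param m) : ℂ :=
  cexp (-2 * η * p.2) * (theta τ (4 * η * m) / theta τ (2 * η * m))
    * ∏ j : Fin m,
        (theta τ (p.1 j + (2 * m - 3) * η) / theta τ (p.1 j + (2 * m - 1) * η))

/-- The Bethe function `ψ(x) = e^{cx} ∏_j θ(x + t_j - η)` attached to `(t, c)`. -/
def betheFunction (τ η : ℂ) (m : ℕ) (p : Param m) (x : ℂ) : ℂ :=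
  cexp (p.2 * x) * ∏ j : Fin m, theta τ (x + p.1 j - η)

/-- The reflection `(t, c) ↦ (2η - t, -c)`. -/
def reflect (η : ℂ) {m : ℕ} (p : Param m) : Param m :=
  (fun i => 2 * η - p.1 i, -p.2)

/-- The identification of representatives: permutations of the `t_i`, the translations
`t_i ↦ t_i + 1` and `(t_i, c) ↦ (t_i + τ, c + 2πi)`, and `c ↦ c + πi/η`.
The translation by `τ` has to move `c`, because `θ(x + τ) = -e^{-πi(τ + 2x)} θ(x)`: this is what
preserves the Bethe equations and the eigenvalue, and changes the Bethe function only by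
a constant factor. -/
def Related (τ η : ℂ) {m : ℕ} (p q : Param m) : Prop :=
  ∃ (σ : Equiv.Perm (Fin m)) (k l : Fin m → ℤ) (n : ℤ),
    (∀ i, q.1 i = p.1 (σ i) + k i + l i * τ) ∧
    q.2 = p.2 + 2 * Real.pi * I * ((∑ i, l i : ℤ) : ℂ) + Real.pi * I / η * n

theorem Related.refl (τ η : ℂ) {m : ℕ} (p : Param m) : Related τ η p p :=
  ⟨1, 0, 0, 0, by simp, by simp⟩

theorem Related.symm {τ η : ℂ} {m : ℕ} {p q : Param m} (h : Related τ η p q) :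
    Related τ η q p := by
  obtain ⟨σ, k, l, n, h1, h2⟩ := h
  refine ⟨σ⁻¹, fun i => -k (σ⁻¹ i), fun i => -l (σ⁻¹ i), -n, fun i => ?_, ?_⟩
  · rw [h1 (σ⁻¹ i)]
    simp
    ring
  · rw [h2, Finset.sum_neg_distrib, Equiv.sum_comp σ⁻¹ l]
    push_cast
    ring

theorem Related.trans {τ η : ℂ} {m : ℕ} {p q r : Param m} (h : Related τ η p q)
    (h' : Related τ η q r) : Related τ η p r := by
  obtain ⟨σ, k, l, n, h1, h2⟩ := h
  obtain ⟨σ', k', l', n', h1', h2'⟩ := h'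
  refine ⟨σ * σ', fun i => k (σ' i) + k' i, fun i => l (σ' i) + l' i, n + n', fun i => ?_, ?_⟩
  · rw [h1', h1]
    simp only [Equiv.Perm.mul_apply]
    push_cast
    ring
  · rw [h2', h2, Finset.sum_add_distrib, Equiv.sum_comp σ' l]
    push_cast
    ring

/-- The identification as a setoid. -/
def paramSetoid (τ η : ℂ) (m : ℕ) : Setoid (Param m) where
  r := Related τ η
  iseqv := ⟨Related.refl τ η, Related.symm, Related.trans⟩

/-- The space in which solutions of the Bethe equations are counted: a twisted form of
`S^m E_τ × ℂ/πiη⁻¹ℤ`. -/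
abbrev ParamSpace (τ η : ℂ) (m : ℕ) : Type := Quotient (paramSetoid τ η m)

/-- The class of a representative. -/
def toClass (τ η : ℂ) {m : ℕ} (p : Param m) : ParamSpace τ η m :=
  Quotient.mk (paramSetoid τ η m) p

/-- The classes of solutions of the Bethe equations with eigenvalue `ε`. -/
def solutionClasses (τ η : ℂ) (m : ℕ) (ε : ℂ) : Set (ParamSpace τ η m) :=
  toClass τ η '' {p : Param m | IsBetheSolution τ η m p ∧ betheEigenvalue τ η m p = ε}

end LameBethe

end

/-! Put w = 2η and exclude those η for which some nonzero multiple of w is a lattice point. Cleared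
of denominators, Lψ = εψ reads θ(z+mw)ψ(z-w) + θ(z-mw)ψ(z+w) = εθ(z)ψ(z) (`LameEq`). The argument is
a chain of identities between theta functions, proved by counting zeros: a theta function of degree
n with more than n incongruent zeros vanishes (`IsTheta.eq_zero_of_card_lt`), and n common zeros
force proportionality (`IsTheta.eq_const_mul_of_zeros`).

At the points z = kw, |k| ≤ m, the equation closes up, because θ(0) = 0 cuts it off at k = ±m. Hence
the values there of an entire solution not vanishing at mw are proportional to one even sequence y
that depends only on ε (`IsLameSeq`). Instead of ψ one first constructs its symmetric invariants
from y: Φ(z) = ψ(z)ψ(-z), the even theta function of degree 2m with values y_k² (`evenProd`), and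
s(z) = ψ(z)ψ(-z-w) + ψ(z+w)ψ(-z) (`IsTrace`). Two difference relations link s and Φ. Multiplied
together they show that s² - 4Φ(z)Φ(z+w), divided by the square of D(z) = ∏ θ(z+kw), -m < k ≤ m, is
w-periodic, hence a constant C² since w has infinite order modulo the lattice (`IsTrace.exists_sq`).
So (s ± CD)/2 have product Φ(z)Φ(z+w). If Φ has simple zeros, then C ≠ 0, the signs select one zero
from each pair ±a_i, and the two factors split into ψ₀(z), ψ₀(z+w) and their reflections with ψ₀ = ∏
θ(z-a_i). An exponential factor turns ψ₀ into a solution (`exists_expProd_solution`).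

For all but finitely many ε the zeros of Φ are simple. With d = 1/ε and a suitable scaling, y_k is
d^k times a polynomial in d; at d = 0 only y_0 survives and Φ is a multiple of ∏ θ(z-jw)θ(z+jw), 1 ≤
j ≤ m. Since Φ/θ^{2m} is a polynomial in an elliptic function of degree two with coefficients
polynomial in d, a resultant confines the failures to finitely many d (`interp_factorization`).

The Bethe equations are the Lamé equation at the zeros of ψ, and a degree count extends it to all z
(`isBetheSolution_iff`). Any two solutions of product form have the same Φ and s up to a common
factor, so the two terms of their Wronskians solve the same quadratic equation. This identifies a
second solution with the first or with its reflection (`IsLameRoots.cross_eq_or`,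
`IsLameRoots.exists_of_cross_eq`). Finally, the Wronskian of ψ₊ and ψ₋ is a nonzero multiple of D,
and Cramer's rule gives the statements over K. -/

noncomputable section

namespace LameBethe

/-! ### Quasi-periodicity of the theta function -/

/-- The constant in `θ(z + τ) = kap · e^{-2πiz} θ(z)`. -/
def kap (τ : ℂ) : ℂ := -cexp (-(Real.pi * I * τ))

theorem kap_ne_zero (τ : ℂ) : kap τ ≠ 0 := neg_ne_zero.mpr (exp_ne_zero _)

theorem theta_eq_jacobi (τ z : ℂ) :
    theta τ z = -(cexp (Real.pi * I * τ / 4 + Real.pi * I * (z + 1 / 2))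
      * jacobiTheta₂ (z + 1 / 2 + τ / 2) τ) := by
  rw [theta, jacobiTheta₂, ← tsum_mul_left]
  congr 2
  ext j
  rw [jacobiTheta₂_term, ← Complex.exp_add]
  congr 1
  ring

theorem theta_differentiable {τ : ℂ} (hτ : 0 < τ.im) : Differentiable ℂ (theta τ) := by
  intro z
  have h : theta τ = fun z => -(cexp (Real.pi * I * τ / 4 + Real.pi * I * (z + 1 / 2))
      * jacobiTheta₂ (z + 1 / 2 + τ / 2) τ) := funext (theta_eq_jacobi τ)
  rw [h]
  have h2 : DifferentiableAt ℂ (fun z => jacobiTheta₂ (z + 1 / 2 + τ / 2) τ) z :=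
    (differentiableAt_jacobiTheta₂_fst (z + 1 / 2 + τ / 2) hτ).comp
      (f := fun z : ℂ => z + 1 / 2 + τ / 2) z (by fun_prop)
  exact ((by fun_prop : DifferentiableAt ℂ (fun z : ℂ =>
    cexp (Real.pi * I * τ / 4 + Real.pi * I * (z + 1 / 2))) z).mul h2).neg

theorem theta_add_one (τ z : ℂ) : theta τ (z + 1) = -theta τ z := by
  rw [theta_eq_jacobi, theta_eq_jacobi,
    show z + 1 + 1 / 2 + τ / 2 = (z + 1 / 2 + τ / 2) + 1 by ring, jacobiTheta₂_add_left,
    show (Real.pi * I * τ / 4 + Real.pi * I * (z + 1 + 1 / 2) : ℂ)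
      = (Real.pi * I * τ / 4 + Real.pi * I * (z + 1 / 2)) + Real.pi * I by ring, Complex.exp_add _
      (Real.pi * I), exp_pi_mul_I]
  ring

theorem theta_add_tau (τ z : ℂ) :
    theta τ (z + τ) = kap τ * cexp (-(2 * Real.pi * I * z)) * theta τ z := by
  rw [theta_eq_jacobi, theta_eq_jacobi, kap,
    show z + τ + 1 / 2 + τ / 2 = (z + 1 / 2 + τ / 2) + τ by ring, jacobiTheta₂_add_left']
  have h : cexp (Real.pi * I * τ / 4 + Real.pi * I * (z + τ + 1 / 2))
      * cexp (-Real.pi * I * (τ + 2 * (z + 1 / 2 + τ / 2)))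
      = -(cexp (-(Real.pi * I * τ)) * cexp (-(2 * Real.pi * I * z))
        * cexp (Real.pi * I * τ / 4 + Real.pi * I * (z + 1 / 2))) := by
    rw [← Complex.exp_add, ← Complex.exp_add, ← Complex.exp_add,
      show (Real.pi * I * τ / 4 + Real.pi * I * (z + τ + 1 / 2)
        + -Real.pi * I * (τ + 2 * (z + 1 / 2 + τ / 2)) : ℂ)
        = (-(Real.pi * I * τ) + -(2 * Real.pi * I * z)
          + (Real.pi * I * τ / 4 + Real.pi * I * (z + 1 / 2))) - Real.pi * I by ring,
      Complex.exp_sub, exp_pi_mul_I]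
    ring
  linear_combination (-jacobiTheta₂ (z + 1 / 2 + τ / 2) τ) * h

theorem theta_neg (τ z : ℂ) : theta τ (-z) = -theta τ z := by
  rw [theta_eq_jacobi, theta_eq_jacobi, ← jacobiTheta₂_neg_left (-z + 1 / 2 + τ / 2),
    ← jacobiTheta₂_add_left, show -(-z + 1 / 2 + τ / 2) + 1 = z + 1 / 2 - τ / 2 by ring,
    show z + 1 / 2 + τ / 2 = (z + 1 / 2 - τ / 2) + τ by ring, jacobiTheta₂_add_left']
  have h : cexp (Real.pi * I * τ / 4 + Real.pi * I * (-z + 1 / 2))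
      = -(cexp (Real.pi * I * τ / 4 + Real.pi * I * (z + 1 / 2))
      * cexp (-Real.pi * I * (τ + 2 * (z + 1 / 2 - τ / 2)))) := by
    rw [← Complex.exp_add,
      show (Real.pi * I * τ / 4 + Real.pi * I * (z + 1 / 2)
        + -Real.pi * I * (τ + 2 * (z + 1 / 2 - τ / 2)) : ℂ)
        = (Real.pi * I * τ / 4 + Real.pi * I * (-z + 1 / 2)) - Real.pi * I by ring,
      Complex.exp_sub, exp_pi_mul_I]
    ring
  rw [h]
  ring

theorem theta_zero (τ : ℂ) : theta τ 0 = 0 := by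
  have := theta_neg τ 0
  rw [neg_zero] at this
  linear_combination this / 2

theorem theta_sub_comm (τ a b : ℂ) : theta τ (a - b) = -theta τ (b - a) := by
  rw [← theta_neg, neg_sub]

/-- Only the constant Fourier mode survives integration. This serves to show that θ is not
identically zero. -/
theorem integral_jacobiTheta₂ {τ : ℂ} (hτ : 0 < τ.im) :
    ∫ x in (0 : ℝ)..1, jacobiTheta₂ x τ = 1 := by
  have hb : Summable fun n : ℤ => ‖jacobiTheta₂_term n 0 τ‖ :=
    ((summable_jacobiTheta₂_term_iff 0 τ).mpr hτ).norm
  have hn : ∀ (n : ℤ) (x : ℝ), ‖jacobiTheta₂_term n x τ‖ = ‖jacobiTheta₂_term n 0 τ‖ := by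
    intro n x
    simp [norm_jacobiTheta₂_term]
  have key := intervalIntegral.hasSum_integral_of_dominated_convergence
    (μ := MeasureTheory.volume) (a := (0 : ℝ)) (b := 1)
    (F := fun (n : ℤ) (x : ℝ) => jacobiTheta₂_term n x τ)
    (f := fun x : ℝ => jacobiTheta₂ x τ) (fun n _ => ‖jacobiTheta₂_term n 0 τ‖)
    (fun n => by
      apply Continuous.aestronglyMeasurable
      unfold jacobiTheta₂_term
      fun_prop)
    (fun n => Eventually.of_forall fun x _ => (hn n x).le)
    (Eventually.of_forall fun x _ => hb)
    (by simp)
    (Eventually.of_forall fun x _ => hasSum_jacobiTheta₂_term x hτ)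
  have h0 : ∀ n : ℤ, ∫ x in (0 : ℝ)..1, jacobiTheta₂_term n x τ = if n = 0 then 1 else 0 := by
    intro n
    split_ifs with h
    · subst h
      simp [jacobiTheta₂_term]
    · have : ∀ x : ℝ, jacobiTheta₂_term n x τ
          = cexp (Real.pi * I * n ^ 2 * τ) * cexp ((2 * Real.pi * I * n) * x) := by
        intro x
        rw [jacobiTheta₂_term, ← Complex.exp_add]
        ring_nf
      simp_rw [this]
      have hc : (2 * Real.pi * I * n : ℂ) ≠ 0 := by
        simp [Real.pi_ne_zero, I_ne_zero, h]
      rw [intervalIntegral.integral_const_mul, integral_exp_mul_complex hc]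
      have : cexp (2 * Real.pi * I * n * (1 : ℝ)) = 1 := by
        rw [Complex.exp_eq_one_iff]
        exact ⟨n, by push_cast; ring⟩
      rw [this]
      simp
  simp_rw [h0] at key
  have := key.unique (hasSum_ite_eq (0 : ℤ) (1 : ℂ))
  exact this

theorem exists_theta_ne_zero {τ : ℂ} (hτ : 0 < τ.im) : ∃ z, theta τ z ≠ 0 := by
  by_contra! h
  have h0 : ∀ z, jacobiTheta₂ z τ = 0 := by
    intro z
    have := h (z - 1 / 2 - τ / 2)
    rw [theta_eq_jacobi, neg_eq_zero, mul_eq_zero] at this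
    rcases this with h | h
    · exact absurd h (exp_ne_zero _)
    · rwa [show z - 1 / 2 - τ / 2 + 1 / 2 + τ / 2 = z by ring] at h
  have := integral_jacobiTheta₂ hτ
  simp [h0] at this

/-! ### The product `∏ (1 - qⁿ w)` -/

/-- The infinite product `∏_{n ≥ 0} (1 - qⁿ w)`. -/
def qProd (q w : ℂ) : ℂ := ∏' n : ℕ, (1 + -(q ^ n * w))

theorem summable_qProd {q : ℂ} (hq : ‖q‖ < 1) (w : ℂ) :
    Summable fun n : ℕ => ‖-(q ^ n * w)‖ := by
  simp only [norm_neg, norm_mul, norm_pow]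
  exact (summable_geometric_of_lt_one (norm_nonneg _) hq).mul_right _

theorem qProd_shift {q : ℂ} (hq : ‖q‖ < 1) (w : ℂ) :
    qProd q w = (1 - w) * qProd q (q * w) := by
  have e : (fun n : ℕ => 1 + -(q ^ (n + 1) * w)) = fun n : ℕ => 1 + -(q ^ n * (q * w)) := by
    funext n
    ring
  have hm : Multipliable fun n : ℕ => 1 + -(q ^ n * (q * w)) :=
    multipliable_one_add_of_summable (f := fun n : ℕ => -(q ^ n * (q * w))) (summable_qProd hq _)
  rw [← e] at hm
  have h := tprod_eq_zero_mul' (f := fun n : ℕ => 1 + -(q ^ n * w)) hm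
  rw [e] at h
  unfold qProd
  rw [h, pow_zero, one_mul, sub_eq_add_neg]

theorem qProd_ne_zero {q : ℂ} (hq : ‖q‖ < 1) {w : ℂ} (h : ∀ n : ℕ, q ^ n * w ≠ 1) :
    qProd q w ≠ 0 := by
  have h1 : ∀ n : ℕ, 1 + -(q ^ n * w) ≠ 0 := fun n h0 => h n (by linear_combination -h0)
  exact tprod_one_add_ne_zero_of_summable (f := fun n : ℕ => -(q ^ n * w)) h1
    (summable_qProd hq w)

theorem differentiable_qProd {q : ℂ} (hq : ‖q‖ < 1) : Differentiable ℂ (qProd q) := by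
  intro w
  have hL := Summable.hasProdLocallyUniformlyOn_nat_one_add (K := Metric.ball (0 : ℂ) (‖w‖ + 1))
    (f := fun (n : ℕ) (w : ℂ) => -(q ^ n * w)) Metric.isOpen_ball
    (u := fun n => ‖q‖ ^ n * (‖w‖ + 1))
    ((summable_geometric_of_lt_one (norm_nonneg _) hq).mul_right _)
    (Eventually.of_forall fun n x hx => by
      rw [norm_neg, norm_mul, norm_pow]
      have : ‖x‖ < ‖w‖ + 1 := by simpa using hx
      gcongr)
    (fun n => by fun_prop)
  have hd : DifferentiableOn ℂ (fun x => ∏' i : ℕ, (1 + -(q ^ i * x)))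
      (Metric.ball (0 : ℂ) (‖w‖ + 1)) := by
    refine TendstoLocallyUniformlyOn.differentiableOn hL ?_ Metric.isOpen_ball
    refine .of_forall fun s => ?_
    exact DifferentiableOn.fun_finsetProd (fun _ _ => by fun_prop)
  exact hd.differentiableAt (Metric.isOpen_ball.mem_nhds (by simp))

/-! ### Entire functions -/

theorem eq_zero_of_mul_eq_zero_entire {f g : ℂ → ℂ} (hf : Differentiable ℂ f)
    (hg : Differentiable ℂ g) {z₀ : ℂ} (h0 : f z₀ ≠ 0) (h : ∀ z, f z * g z = 0) (z : ℂ) :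
    g z = 0 := by
  have hf' : AnalyticOnNhd ℂ f Set.univ := fun x _ => hf.analyticAt x
  have hg' : AnalyticOnNhd ℂ g Set.univ := fun x _ => hg.analyticAt x
  rcases AnalyticOnNhd.eq_zero_or_eq_zero_of_mul_eq_zero hf' hg' (fun z _ => h z)
    isPreconnected_univ with h1 | h1
  · exact absurd (h1 z₀ trivial) h0
  · exact h1 z trivial

/-- Entire functions form an integral domain. This is how identities are divided by factors that
have zeros. -/
theorem mul_left_cancel_entire {f g h : ℂ → ℂ} (hf : Differentiable ℂ f)
    (hg : Differentiable ℂ g) (hh : Differentiable ℂ h) {z₀ : ℂ} (h0 : f z₀ ≠ 0)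
    (H : ∀ z, f z * g z = f z * h z) (z : ℂ) : g z = h z := by
  have := eq_zero_of_mul_eq_zero_entire hf (hg.sub hh) h0
    (fun z => by simp only [Pi.sub_apply]; rw [mul_sub, H, sub_self]) z
  exact sub_eq_zero.mp this

theorem exists_prod_ne_zero_entire {ι : Type*} (s : Finset ι) {f : ι → ℂ → ℂ}
    (hf : ∀ i ∈ s, Differentiable ℂ (f i)) (h0 : ∀ i ∈ s, ∃ z, f i z ≠ 0) :
    ∃ z, ∏ i ∈ s, f i z ≠ 0 := by
  classical
  induction s using Finset.induction_on with
  | empty => exact ⟨0, by simp⟩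
  | insert i s his ih =>
    obtain ⟨z₁, h1⟩ := ih (fun j hj => hf j (Finset.mem_insert_of_mem hj))
      (fun j hj => h0 j (Finset.mem_insert_of_mem hj))
    obtain ⟨z₂, h2⟩ := h0 i (Finset.mem_insert_self _ _)
    by_contra! h
    have hd : Differentiable ℂ fun z => ∏ j ∈ s, f j z :=
      Differentiable.fun_finsetProd fun j hj => hf j (Finset.mem_insert_of_mem hj)
    refine h1 (eq_zero_of_mul_eq_zero_entire (hf i (Finset.mem_insert_self _ _)) hd h2
      (fun z => ?_) z₁)
    rw [← Finset.prod_insert (f := fun j => f j z) his]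
    exact h z

/-- Division of entire functions when the divisor has simple zeros. -/
theorem exists_entire_quotient {f g : ℂ → ℂ} (hf : Differentiable ℂ f) (hg : Differentiable ℂ g)
    (h : ∀ z, f z = 0 → g z = 0 ∧ deriv f z ≠ 0) :
    ∃ q : ℂ → ℂ, Differentiable ℂ q ∧ ∀ z, g z = f z * q z := by
  classical
  -- At a zero of f the value is given by l'Hôpital's rule; near it the quotient equals that of the
  -- slopes `dslope g z₀` and `dslope f z₀`, the second being nonzero at z₀.
  refine ⟨fun z => if f z = 0 then deriv g z / deriv f z else g z / f z, fun z₀ => ?_,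
    fun z => ?_⟩
  · by_cases h0 : f z₀ = 0
    · obtain ⟨hg0, hd⟩ := h z₀ h0
      have hds : ∀ {k : ℂ → ℂ}, Differentiable ℂ k → DifferentiableAt ℂ (dslope k z₀) z₀ :=
        fun hk => ((Complex.differentiableOn_dslope (s := Set.univ) univ_mem).mpr
          hk.differentiableOn).differentiableAt univ_mem
      have hne : dslope f z₀ z₀ ≠ 0 := by rwa [dslope_same]
      refine ((hds hg).div (hds hf) hne).congr_of_eventuallyEq ?_
      have hev := (hds hf).continuousAt.eventually_ne hne
      filter_upwards [hev] with z hz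
      by_cases hzz : z = z₀
      · subst hzz
        simp [h0]
      · have e1 : f z = (z - z₀) * dslope f z₀ z := by
          have := sub_smul_dslope f z₀ z
          rw [h0, sub_zero, smul_eq_mul] at this
          exact this.symm
        have e2 : g z = (z - z₀) * dslope g z₀ z := by
          have := sub_smul_dslope g z₀ z
          rw [hg0, sub_zero, smul_eq_mul] at this
          exact this.symm
        have hs : z - z₀ ≠ 0 := sub_ne_zero.mpr hzz
        have : f z ≠ 0 := by rw [e1]; exact mul_ne_zero hs hz
        rw [if_neg this, e1, e2, mul_div_mul_left _ _ hs, Pi.div_apply]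
    · refine ((hg z₀).div (hf z₀) h0).congr_of_eventuallyEq ?_
      filter_upwards [(hf z₀).continuousAt.eventually_ne h0] with z hz
      rw [if_neg hz, Pi.div_apply]
  · dsimp only
    split_ifs with h0
    · rw [h0, (h z h0).1, zero_mul]
    · rw [mul_div_cancel₀ _ h0]

/-! ### Theta functions of degree `n` -/

/-- `g` is an entire function with `g(z + 1) = α g(z)` and `g(z + τ) = β e^{-2πinz} g(z)`. -/
structure IsTheta (τ : ℂ) (n : ℕ) (α β : ℂ) (g : ℂ → ℂ) : Prop where
  diff : Differentiable ℂ g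
  add_one : ∀ z, g (z + 1) = α * g z
  add_tau : ∀ z, g (z + τ) = β * cexp (-(2 * Real.pi * I * n * z)) * g z

namespace IsTheta

variable {τ : ℂ} {n n' : ℕ} {α α' β β' : ℂ} {f g : ℂ → ℂ}

theorem of_theta (hτ : 0 < τ.im) : IsTheta τ 1 (-1) (kap τ) (theta τ) :=
  ⟨theta_differentiable hτ, fun z => by rw [theta_add_one]; ring,
    fun z => by rw [theta_add_tau]; simp⟩

theorem congr (hf : IsTheta τ n α β f) (h1 : α = α') (h2 : β = β') : IsTheta τ n α' β' f :=
  h1 ▸ h2 ▸ hf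

theorem zero : IsTheta τ n α β fun _ => 0 :=
  ⟨differentiable_const _, by simp, by simp⟩

theorem add (hf : IsTheta τ n α β f) (hg : IsTheta τ n α β g) :
    IsTheta τ n α β fun z => f z + g z :=
  ⟨hf.diff.add hg.diff, fun z => by rw [hf.add_one, hg.add_one]; ring,
    fun z => by rw [hf.add_tau, hg.add_tau]; ring⟩

theorem sub (hf : IsTheta τ n α β f) (hg : IsTheta τ n α β g) :
    IsTheta τ n α β fun z => f z - g z :=
  ⟨hf.diff.sub hg.diff, fun z => by rw [hf.add_one, hg.add_one]; ring,
    fun z => by rw [hf.add_tau, hg.add_tau]; ring⟩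

theorem const_mul (hf : IsTheta τ n α β f) (c : ℂ) : IsTheta τ n α β fun z => c * f z :=
  ⟨hf.diff.const_mul c, fun z => by rw [hf.add_one]; ring, fun z => by rw [hf.add_tau]; ring⟩

theorem sum {ι : Type*} {s : Finset ι} {f : ι → ℂ → ℂ}
    (h : ∀ i ∈ s, IsTheta τ n α β (f i)) : IsTheta τ n α β fun z => ∑ i ∈ s, f i z := by
  classical
  induction s using Finset.induction_on with
  | empty => simpa using zero
  | insert i s his ih =>
    simp only [Finset.sum_insert his]
    exact (h i (Finset.mem_insert_self _ _)).add
      (ih fun j hj => h j (Finset.mem_insert_of_mem hj))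

theorem mul (hf : IsTheta τ n α β f) (hg : IsTheta τ n' α' β' g) :
    IsTheta τ (n + n') (α * α') (β * β') fun z => f z * g z :=
  ⟨hf.diff.mul hg.diff, fun z => by rw [hf.add_one, hg.add_one]; ring,
    fun z => by
      rw [hf.add_tau, hg.add_tau,
        show -(2 * Real.pi * I * ((n + n' : ℕ) : ℂ) * z)
          = -(2 * Real.pi * I * n * z) + -(2 * Real.pi * I * n' * z) by push_cast; ring,
        Complex.exp_add]
      ring⟩

theorem shift (hf : IsTheta τ n α β f) (b : ℂ) :
    IsTheta τ n α (β * cexp (-(2 * Real.pi * I * n * b))) fun z => f (z + b) :=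
  ⟨hf.diff.comp (differentiable_id.add_const b),
    fun z => by rw [add_right_comm, hf.add_one],
    fun z => by
      rw [add_right_comm, hf.add_tau, mul_assoc β (cexp _) (cexp _), ← Complex.exp_add]
      ring_nf⟩

theorem exp (γ : ℂ) : IsTheta τ 0 (cexp γ) (cexp (γ * τ)) fun z => cexp (γ * z) :=
  ⟨by fun_prop, fun z => by rw [← Complex.exp_add]; ring_nf,
    fun z => by simp [← Complex.exp_add]; ring_nf⟩

theorem one : IsTheta τ 0 1 1 fun _ => 1 := ⟨differentiable_const _, by simp, by simp⟩

/-- The quotient of two theta functions, once known to be entire, is a theta function whose degree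
is the difference and whose multipliers are the quotients. -/
theorem of_mul (hf : IsTheta τ n α β f) (hα : α ≠ 0) (hβ : β ≠ 0) {z₀ : ℂ} (h0 : f z₀ ≠ 0)
    (hg : Differentiable ℂ g) (hfg : IsTheta τ (n + n') (α * α') (β * β') fun z => f z * g z) :
    IsTheta τ n' α' β' g := by
  refine ⟨hg, fun z => ?_, fun z => ?_⟩
  · refine mul_left_cancel_entire hf.diff (g := fun z => g (z + 1)) (h := fun z => α' * g z)
      (hg.comp (differentiable_id.add_const 1)) (hg.const_mul α') h0 (fun z => ?_) z
    have := hfg.add_one z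
    rw [hf.add_one] at this
    exact mul_left_cancel₀ hα (by linear_combination this)
  · refine mul_left_cancel_entire hf.diff (g := fun z => g (z + τ))
      (h := fun z => β' * cexp (-(2 * Real.pi * I * n' * z)) * g z)
      (hg.comp (differentiable_id.add_const τ)) (by fun_prop) h0 (fun z => ?_) z
    have := hfg.add_tau z
    rw [hf.add_tau,
      show -(2 * Real.pi * I * ((n + n' : ℕ) : ℂ) * z)
          = -(2 * Real.pi * I * n * z) + -(2 * Real.pi * I * n' * z) by push_cast; ring,
        Complex.exp_add] at this
    exact mul_left_cancel₀ (mul_ne_zero hβ (exp_ne_zero (-(2 * Real.pi * I * n * z))))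
      (by linear_combination this)

theorem add_int (hf : IsTheta τ n α β f) (hα : α ≠ 0) (k : ℤ) (z : ℂ) :
    f (z + k) = α ^ k * f z := by
  induction k using Int.induction_on with
  | zero => simp
  | succ k ih =>
    rw [zpow_add₀ hα, zpow_one]
    push_cast at ih ⊢
    rw [← add_assoc, hf.add_one, ih]
    ring
  | pred k ih =>
    rw [zpow_sub₀ hα, zpow_one]
    push_cast at ih ⊢
    have := hf.add_one (z + (-k - 1))
    rw [show z + (-(k : ℂ) - 1) + 1 = z + -k by ring, ih] at this
    field_simp
    linear_combination -this

theorem add_int_tau (hf : IsTheta τ n α β f) (hβ : β ≠ 0) (l : ℤ) :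
    ∃ C : ℂ, C ≠ 0 ∧ ∀ z, f (z + l * τ) = C * cexp (-(2 * Real.pi * I * n * l * z)) * f z := by
  induction l using Int.induction_on with
  | zero => exact ⟨1, one_ne_zero, by simp⟩
  | succ k ih =>
    obtain ⟨C, hC, h⟩ := ih
    refine ⟨C * β * cexp (-(2 * Real.pi * I * n * (k * τ))),
      mul_ne_zero (mul_ne_zero hC hβ) (exp_ne_zero _), fun z => ?_⟩
    have e : z + (((k : ℤ) + 1 : ℤ) : ℂ) * τ = (z + ((k : ℤ) : ℂ) * τ) + τ := by push_cast; ring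
    rw [e, hf.add_tau, h]
    have e2 : cexp (-(2 * Real.pi * I * n * (z + ((k : ℤ) : ℂ) * τ)))
        * cexp (-(2 * Real.pi * I * n * ((k : ℤ) : ℂ) * z))
        = cexp (-(2 * Real.pi * I * n * (k * τ)))
          * cexp (-(2 * Real.pi * I * n * (((k : ℤ) + 1 : ℤ) : ℂ) * z)) := by
      rw [← Complex.exp_add, ← Complex.exp_add]
      push_cast
      ring_nf
    linear_combination β * C * f z * e2
  | pred k ih =>
    obtain ⟨C, hC, h⟩ := ih
    refine ⟨C * β⁻¹ * cexp (-(2 * Real.pi * I * n * ((k + 1) * τ))),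
      mul_ne_zero (mul_ne_zero hC (inv_ne_zero hβ)) (exp_ne_zero _), fun z => ?_⟩
    have := hf.add_tau (z + ((-(k : ℤ) - 1 : ℤ) : ℂ) * τ)
    rw [show z + ((-(k : ℤ) - 1 : ℤ) : ℂ) * τ + τ = z + ((-(k : ℤ) : ℤ) : ℂ) * τ by
      push_cast; ring, h] at this
    have e2 : cexp (-(2 * Real.pi * I * n * (z + ((-(k : ℤ) - 1 : ℤ) : ℂ) * τ)))
        * (cexp (-(2 * Real.pi * I * n * ((k + 1) * τ)))
          * cexp (-(2 * Real.pi * I * n * ((-(k : ℤ) - 1 : ℤ) : ℂ) * z)))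
        = cexp (-(2 * Real.pi * I * n * ((-(k : ℤ) : ℤ) : ℂ) * z)) := by
      rw [← Complex.exp_add, ← Complex.exp_add]
      push_cast
      ring_nf
    refine mul_left_cancel₀ (mul_ne_zero hβ (exp_ne_zero
      (-(2 * Real.pi * I * n * (z + ((-(k : ℤ) - 1 : ℤ) : ℂ) * τ))))) ?_
    rw [← this]
    linear_combination (-(C * f z)) * e2 - C * f z
      * cexp (-(2 * Real.pi * I * n * (z + ((-(k : ℤ) - 1 : ℤ) : ℂ) * τ)))
      * cexp (-(2 * Real.pi * I * n * ((k + 1) * τ)))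
      * cexp (-(2 * Real.pi * I * n * ((-(k : ℤ) - 1 : ℤ) : ℂ) * z)) * mul_inv_cancel₀ hβ

theorem add_lattice (hf : IsTheta τ n α β f) (hα : α ≠ 0) (hβ : β ≠ 0) (k l : ℤ) :
    ∃ C : ℂ, C ≠ 0 ∧ ∀ z, f (z + k + l * τ) = C * cexp (-(2 * Real.pi * I * n * l * z)) * f z := by
  obtain ⟨C, hC, h⟩ := hf.add_int_tau hβ l
  refine ⟨C * α ^ k, mul_ne_zero hC (zpow_ne_zero _ hα), fun z => ?_⟩
  rw [add_right_comm, hf.add_int hα, h]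
  ring

theorem add_lattice_eq_zero_iff (hf : IsTheta τ n α β f) (hα : α ≠ 0) (hβ : β ≠ 0) (k l : ℤ)
    (z : ℂ) : f (z + k + l * τ) = 0 ↔ f z = 0 := by
  obtain ⟨C, hC, h⟩ := hf.add_lattice hα hβ k l
  rw [h]
  simp [hC, Complex.exp_ne_zero]

end IsTheta

/-- A continuous doubly periodic function is bounded. -/
theorem exists_bound_of_periodic {τ : ℂ} (hτ : 0 < τ.im) {G : ℂ → ℝ} (hG : Continuous G)
    (h1 : ∀ z, G (z + 1) = G z) (h2 : ∀ z, G (z + τ) = G z) : ∃ M, ∀ z, G z ≤ M := by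
  have hK : IsCompact ((fun p : ℝ × ℝ => (p.1 : ℂ) + p.2 * τ) ''
      (Set.Icc 0 1 ×ˢ Set.Icc 0 1)) :=
    (isCompact_Icc.prod isCompact_Icc).image (by fun_prop)
  obtain ⟨M, hM⟩ := (hK.image hG).bddAbove
  refine ⟨M, fun z => ?_⟩
  set y : ℝ := z.im / τ.im with hy
  set x : ℝ := (z - y * τ).re with hx
  have hz : z = x + y * τ := by
    apply Complex.ext
    · simp [hx]
    · simp [hy]
      field_simp
  have hp1 : Function.Periodic G 1 := h1
  have hp2 : Function.Periodic G τ := h2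
  have e : G z = G ((Int.fract x : ℝ) + (Int.fract y : ℝ) * τ) := by
    have a1 := hp1.sub_zsmul_eq (x := z) ⌊x⌋
    have a2 := hp2.sub_zsmul_eq (x := z - ⌊x⌋ • (1 : ℂ)) ⌊y⌋
    rw [← a1, ← a2]
    congr 1
    rw [Int.fract, Int.fract, hz]
    simp only [zsmul_eq_mul]
    push_cast
    ring
  rw [e]
  apply hM
  refine ⟨_, ⟨(Int.fract x, Int.fract y), ⟨⟨Int.fract_nonneg _, (Int.fract_lt_one _).le⟩,
    ⟨Int.fract_nonneg _, (Int.fract_lt_one _).le⟩⟩, rfl⟩, rfl⟩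

/-- Theta functions of degree zero are exponentials. -/
theorem IsTheta.eq_exp_of_degree_zero {τ : ℂ} (hτ : 0 < τ.im) {α β : ℂ} {g : ℂ → ℂ}
    (hg : IsTheta τ 0 α β g) : ∃ C γ : ℂ, ∀ z, g z = C * cexp (γ * z) := by
  by_cases hα : α = 0
  · refine ⟨0, 0, fun z => ?_⟩
    have := hg.add_one (z - 1)
    rw [sub_add_cancel, hα] at this
    simpa using this
  by_cases hβ : β = 0
  · refine ⟨0, 0, fun z => ?_⟩
    have := hg.add_tau (z - τ)
    rw [sub_add_cancel, hβ] at this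
    simpa using this
  -- The conditions |e^γ| = |α| and |e^{γτ}| = |β| are two real linear equations for γ, solvable
  -- since Im τ ≠ 0. Then |g e^{-γz}| is doubly periodic and Liouville's theorem applies.
  set a : ℝ := Real.log ‖α‖
  set b : ℝ := (a * τ.re - Real.log ‖β‖) / τ.im with hb
  set γ : ℂ := ⟨a, b⟩ with hγ
  have e1 : ‖cexp γ‖ = ‖α‖ := by
    rw [Complex.norm_exp]
    exact Real.exp_log (norm_pos_iff.mpr hα)
  have e2 : ‖cexp (γ * τ)‖ = ‖β‖ := by
    rw [Complex.norm_exp, Complex.mul_re]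
    have : γ.re * τ.re - γ.im * τ.im = Real.log ‖β‖ := by
      simp only [hγ, hb]
      field_simp
      ring
    rw [this, Real.exp_log (norm_pos_iff.mpr hβ)]
  have hd : Differentiable ℂ fun z => g z * cexp (-γ * z) := by
    have := hg.diff
    fun_prop
  obtain ⟨M, hM⟩ := exists_bound_of_periodic hτ (G := fun z => ‖g z * cexp (-γ * z)‖)
    hd.continuous.norm
    (fun z => by
      have : cexp (-γ * (z + 1)) = (cexp γ)⁻¹ * cexp (-γ * z) := by
        rw [← Complex.exp_neg, ← Complex.exp_add]; ring_nf
      rw [hg.add_one, this, norm_mul, norm_mul, norm_mul, norm_mul, norm_inv, e1]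
      have : ‖α‖ ≠ 0 := norm_ne_zero_iff.mpr hα
      field_simp)
    (fun z => by
      have : cexp (-γ * (z + τ)) = (cexp (γ * τ))⁻¹ * cexp (-γ * z) := by
        rw [← Complex.exp_neg, ← Complex.exp_add]; ring_nf
      rw [hg.add_tau, this]
      simp only [norm_mul, norm_inv, e2]
      have : ‖β‖ ≠ 0 := norm_ne_zero_iff.mpr hβ
      field_simp
      simp)
  obtain ⟨C, hC⟩ := hd.exists_const_forall_eq_of_bounded
    (isBounded_iff_forall_norm_le.mpr ⟨M, by rintro _ ⟨z, rfl⟩; exact hM z⟩)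
  refine ⟨C, γ, fun z => ?_⟩
  rw [← hC z, mul_assoc, ← Complex.exp_add]
  simp

theorem IsTheta.eq_const_of_degree_zero {τ : ℂ} (hτ : 0 < τ.im) {g : ℂ → ℂ}
    (hg : IsTheta τ 0 1 1 g) : ∃ C : ℂ, ∀ z, g z = C := by
  obtain ⟨M, hM⟩ := exists_bound_of_periodic hτ (G := fun z => ‖g z‖) hg.diff.continuous.norm
    (fun z => by rw [hg.add_one, one_mul]) (fun z => by rw [hg.add_tau]; simp)
  exact hg.diff.exists_const_forall_eq_of_bounded
    (isBounded_iff_forall_norm_le.mpr ⟨M, by rintro _ ⟨z, rfl⟩; exact hM z⟩)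

/-- A function with the quasi-periods of `θ` whose only zeros are the lattice points, all of
them simple. -/
structure IsSigma (τ : ℂ) (T : ℂ → ℂ) : Prop where
  isTheta : IsTheta τ 1 (-1) (kap τ) T
  lattice_of_eq_zero : ∀ z, T z = 0 → ∃ k l : ℤ, z = k + l * τ
  map_zero : T 0 = 0
  deriv_ne_zero : deriv T 0 ≠ 0

namespace IsSigma

variable {τ : ℂ} {T : ℂ → ℂ}

theorem lattice_eq_zero (hT : IsSigma τ T) (k l : ℤ) : T (k + l * τ) = 0 := by
  have := (hT.isTheta.add_lattice_eq_zero_iff (by norm_num) (kap_ne_zero τ) k l 0).mpr hT.map_zero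
  simpa using this

theorem deriv_lattice_ne_zero (hT : IsSigma τ T) {z : ℂ} (hz : T z = 0) : deriv T z ≠ 0 := by
  obtain ⟨k, l, rfl⟩ := hT.lattice_of_eq_zero z hz
  obtain ⟨C, hC, h⟩ := hT.isTheta.add_lattice (by norm_num) (kap_ne_zero τ) k l
  have e : deriv (fun z => T (z + (k + l * τ))) 0 = deriv T (k + l * τ) := by
    rw [deriv_comp_add_const, zero_add]
  have e2 : (fun z => T (z + (k + l * τ)))
      = fun z => C * cexp (-(2 * Real.pi * I * (1 : ℕ) * l * z)) * T z := by
    ext z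
    rw [← add_assoc, h]
  rw [← e, e2]
  have hd : HasDerivAt (fun z : ℂ => C * cexp (-(2 * Real.pi * I * (1 : ℕ) * l * z)))
      (deriv (fun z : ℂ => C * cexp (-(2 * Real.pi * I * (1 : ℕ) * l * z))) 0) 0 :=
    DifferentiableAt.hasDerivAt (by fun_prop)
  rw [(hd.fun_mul (hT.isTheta.diff 0).hasDerivAt).deriv, hT.map_zero]
  simp [hC, hT.deriv_ne_zero]

theorem exists_ne_zero (hT : IsSigma τ T) : ∃ z, T z ≠ 0 := by
  by_contra! h
  have : T = fun _ => 0 := funext h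
  have h2 := hT.deriv_ne_zero
  simp [this] at h2

/-- A theta function vanishing at `a` is divisible by `T(z - a)`. -/
theorem exists_quotient (hT : IsSigma τ T) {n : ℕ} {α β : ℂ} (hα : α ≠ 0) (hβ : β ≠ 0)
    {g : ℂ → ℂ} (hg : IsTheta τ (n + 1) α β g) {a : ℂ} (ha : g a = 0) :
    ∃ h : ℂ → ℂ, IsTheta τ n (-α) (β * (kap τ)⁻¹ * cexp (-(2 * Real.pi * I * a))) h ∧
      ∀ z, g z = T (z - a) * h z := by
  have hTa : IsTheta τ 1 (-1) (kap τ * cexp (2 * Real.pi * I * a)) fun z => T (z - a) := by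
    have := hT.isTheta.shift (-a)
    simpa [← sub_eq_add_neg] using this
  obtain ⟨h, hd, hh⟩ := exists_entire_quotient hTa.diff hg.diff (fun z hz => by
    constructor
    · obtain ⟨k, l, hkl⟩ := hT.lattice_of_eq_zero _ hz
      rw [show z = a + k + l * τ by linear_combination hkl]
      exact (hg.add_lattice_eq_zero_iff hα hβ k l a).mpr ha
    · rw [deriv_comp_sub_const]
      exact hT.deriv_lattice_ne_zero hz)
  refine ⟨h, ?_, hh⟩
  obtain ⟨z₀, hz₀⟩ := hT.exists_ne_zero
  refine hTa.of_mul (by norm_num) (mul_ne_zero (kap_ne_zero τ) (exp_ne_zero _))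
    (z₀ := z₀ + a) (by simpa using hz₀) hd ?_
  have e : (fun z => T (z - a) * h z) = g := funext fun z => (hh z).symm
  rw [e, add_comm 1 n]
  refine hg.congr (by ring) ?_
  rw [Complex.exp_neg]
  have := kap_ne_zero τ
  have := exp_ne_zero (2 * Real.pi * I * a)
  field_simp

/-- Theta functions of degree one with the multipliers of `T` are multiples of `T`. -/
theorem eq_const_mul (hτ : 0 < τ.im) (hT : IsSigma τ T) {g : ℂ → ℂ}
    (hg : IsTheta τ 1 (-1) (kap τ) g) : ∃ C : ℂ, ∀ z, g z = C * T z := by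
  obtain ⟨a, ha⟩ := hT.exists_ne_zero
  refine ⟨g a / T a, fun z => ?_⟩
  have hd : IsTheta τ (0 + 1) (-1) (kap τ) fun z => g z - g a / T a * T z :=
    hg.sub (hT.isTheta.const_mul _)
  obtain ⟨h, hh, hgh⟩ := hT.exists_quotient (by norm_num) (kap_ne_zero τ) hd (a := a)
    (by field_simp; ring)
  obtain ⟨C, γ, hC⟩ := hh.eq_exp_of_degree_zero hτ
  -- The multipliers of the quotient h give e^γ = 1 and e^{γτ} = e^{-2πia} unless C = 0, and these
  -- put a into the lattice, where T vanishes.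
  suffices C = 0 by
    have h3 := hgh z
    rw [hC, ‹C = 0›] at h3
    linear_combination h3
  by_contra hC0
  have h1 := hh.add_one 0
  have h2 := hh.add_tau 0
  rw [hC, hC] at h1 h2
  have k1 : cexp γ = 1 := by
    have : C * cexp γ = C * 1 := by simpa using h1
    exact mul_left_cancel₀ hC0 this
  have k2 : cexp (γ * τ) = cexp (-(2 * Real.pi * I * a)) := by
    have : C * cexp (γ * τ) = C * cexp (-(2 * Real.pi * I * a)) := by
      have := kap_ne_zero τ
      simp at h2
      rw [h2]
      field_simp
    exact mul_left_cancel₀ hC0 this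
  obtain ⟨k, hk⟩ := Complex.exp_eq_one_iff.mp k1
  obtain ⟨l, hl⟩ := Complex.exp_eq_exp_iff_exists_int.mp k2
  apply ha
  have hp : (2 * Real.pi * I : ℂ) ≠ 0 := by simp [Real.pi_ne_zero, I_ne_zero]
  have : a = (l : ℤ) + (-k : ℤ) * τ := by
    apply mul_left_cancel₀ hp
    rw [hk] at hl
    push_cast
    linear_combination hl
  rw [this]
  exact hT.lattice_eq_zero _ _

end IsSigma

/-! ### The zeros of the theta function -/

/-- The product `e^{-πiz} ∏_{n ≥ 0} (1 - qⁿ w) ∏_{n ≥ 1} (1 - qⁿ / w)`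
with `q = e^{2πiτ}`, `w = e^{2πiz}`. -/
def thetaProd (τ z : ℂ) : ℂ :=
  cexp (-(Real.pi * I * z)) * qProd (cexp (2 * Real.pi * I * τ)) (cexp (2 * Real.pi * I * z))
    * qProd (cexp (2 * Real.pi * I * τ))
      (cexp (2 * Real.pi * I * τ) * cexp (-(2 * Real.pi * I * z)))

theorem norm_nome_lt_one {τ : ℂ} (hτ : 0 < τ.im) : ‖cexp (2 * Real.pi * I * τ)‖ < 1 := by
  rw [Complex.norm_exp, Real.exp_lt_one_iff]
  have : (2 * Real.pi * I * τ).re = -(2 * Real.pi * τ.im) := by simp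
  rw [this]
  have := Real.pi_pos
  simp only [neg_lt_zero]
  positivity

theorem isTheta_thetaProd {τ : ℂ} (hτ : 0 < τ.im) :
    IsTheta τ 1 (-1) (kap τ) (thetaProd τ) := by
  have hq := norm_nome_lt_one hτ
  refine ⟨?_, fun z => ?_, fun z => ?_⟩
  · have := differentiable_qProd hq
    unfold thetaProd
    fun_prop
  · have e1 : cexp (-(Real.pi * I * (z + 1))) = -cexp (-(Real.pi * I * z)) := by
      rw [show (-(Real.pi * I * (z + 1)) : ℂ) = -(Real.pi * I * z) - Real.pi * I by ring,
        Complex.exp_sub, exp_pi_mul_I]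
      ring
    have e2 : cexp (2 * Real.pi * I * (z + 1)) = cexp (2 * Real.pi * I * z) := by
      rw [mul_add, mul_one, Complex.exp_add, exp_two_pi_mul_I, mul_one]
    rw [thetaProd, Complex.exp_neg (2 * Real.pi * I * (z + 1)), e1, e2, thetaProd, Complex.exp_neg (2 * Real.pi * I * z)]
    ring
  · set q := cexp (2 * Real.pi * I * τ) with hqdef
    set w := cexp (2 * Real.pi * I * z) with hw
    have hw0 : w ≠ 0 := exp_ne_zero _
    have hq0 : q ≠ 0 := exp_ne_zero _
    have e1 : cexp (-(Real.pi * I * (z + τ)))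
        = cexp (-(Real.pi * I * τ)) * cexp (-(Real.pi * I * z)) := by
      rw [← Complex.exp_add]; ring_nf
    have e2 : cexp (2 * Real.pi * I * (z + τ)) = q * w := by
      rw [hqdef, hw, ← Complex.exp_add]; ring_nf
    have e3 : q * (q * w)⁻¹ = w⁻¹ := by field_simp
    have s1 := qProd_shift hq w
    have s2 := qProd_shift hq w⁻¹
    rw [thetaProd, thetaProd, e1, Complex.exp_neg (2 * Real.pi * I * (z + τ)), e2, e3,
      ← hqdef, ← hw, Complex.exp_neg (2 * Real.pi * I * z), ← hw, s2, s1, kap]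
    have e4 : cexp (-(2 * Real.pi * I * (1 : ℕ) * z)) = w⁻¹ := by
      rw [hw, ← Complex.exp_neg]; simp
    rw [e4]
    field_simp
    ring

theorem isSigma_thetaProd {τ : ℂ} (hτ : 0 < τ.im) : IsSigma τ (thetaProd τ) := by
  have hq := norm_nome_lt_one hτ
  refine ⟨isTheta_thetaProd hτ, fun z hz => ?_, ?_, ?_⟩
  · by_contra hcon
    have hp : (2 * Real.pi * I : ℂ) ≠ 0 := by simp [Real.pi_ne_zero, I_ne_zero]
    refine mul_ne_zero (mul_ne_zero (exp_ne_zero _) (qProd_ne_zero hq fun n hn => hcon ?_))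
      (qProd_ne_zero hq fun n hn => hcon ?_) hz
    · rw [← Complex.exp_nat_mul, ← Complex.exp_add, Complex.exp_eq_one_iff] at hn
      obtain ⟨k, hk⟩ := hn
      refine ⟨k, -n, mul_left_cancel₀ hp ?_⟩
      push_cast
      linear_combination hk
    · rw [← Complex.exp_nat_mul, ← Complex.exp_add, ← Complex.exp_add,
        Complex.exp_eq_one_iff] at hn
      obtain ⟨k, hk⟩ := hn
      refine ⟨-k, n + 1, mul_left_cancel₀ hp ?_⟩
      push_cast
      linear_combination -hk
  · simp [thetaProd, qProd_shift hq 1]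
  · set q := cexp (2 * Real.pi * I * τ) with hqdef
    set R : ℂ → ℂ := fun z => qProd q (q * cexp (2 * Real.pi * I * z))
      * qProd q (q * cexp (-(2 * Real.pi * I * z))) with hR
    have hRd : Differentiable ℂ R := by
      have := differentiable_qProd hq
      fun_prop
    -- Splitting off the factor 1 - w exhibits the zero at the origin as that of e^{-πiz} - e^{πiz},
    -- times R with R(0) ≠ 0.
    have e : thetaProd τ = fun z =>
        (cexp (-(Real.pi * I * z)) - cexp (Real.pi * I * z)) * R z := by
      funext z
      have : cexp (Real.pi * I * z)
          = cexp (-(Real.pi * I * z)) * cexp (2 * Real.pi * I * z) := by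
        rw [← Complex.exp_add]
        congr 1
        ring
      rw [thetaProd, ← hqdef, qProd_shift hq, this]
      ring
    have hd : HasDerivAt (fun z : ℂ => cexp (-(Real.pi * I * z)) - cexp (Real.pi * I * z))
        (-(2 * Real.pi * I)) 0 := by
      have h1 : HasDerivAt (fun z : ℂ => (Real.pi * I : ℂ) * z) (Real.pi * I) 0 := by
        simpa using (hasDerivAt_id (0 : ℂ)).const_mul (Real.pi * I : ℂ)
      refine (h1.fun_neg.cexp.fun_sub h1.cexp).congr_deriv ?_
      rw [mul_zero, neg_zero, Complex.exp_zero]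
      ring
    have hR0 : R 0 ≠ 0 := by
      have : qProd q q ≠ 0 := by
        refine qProd_ne_zero hq fun n hn => ?_
        have h1 : ‖q ^ n * q‖ = 1 := by rw [hn, norm_one]
        rw [← pow_succ, norm_pow] at h1
        exact absurd h1 (pow_lt_one₀ (norm_nonneg _) hq (by omega)).ne
      simp [hR, this]
    rw [e, (hd.fun_mul (hRd 0).hasDerivAt).deriv]
    simp [hR0, Real.pi_ne_zero]

/-- The series and the infinite product have degree one and the same multipliers, so they are
proportional, and the zeros visible in the product are those of θ. The value of the constant is not
needed, only that it is nonzero. -/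
theorem isSigma_theta {τ : ℂ} (hτ : 0 < τ.im) : IsSigma τ (theta τ) := by
  have hT := isSigma_thetaProd hτ
  obtain ⟨C, hC⟩ := hT.eq_const_mul hτ (IsTheta.of_theta hτ)
  have hC0 : C ≠ 0 := by
    rintro rfl
    obtain ⟨z, hz⟩ := exists_theta_ne_zero hτ
    exact hz (by rw [hC, zero_mul])
  refine ⟨IsTheta.of_theta hτ, fun z hz => hT.lattice_of_eq_zero z ?_, theta_zero τ, ?_⟩
  · rw [hC] at hz
    exact (mul_eq_zero.mp hz).resolve_left hC0
  · have : theta τ = fun z => C * thetaProd τ z := funext hC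
    rw [this, deriv_const_mul_field]
    exact mul_ne_zero hC0 hT.deriv_ne_zero

theorem theta_eq_zero_iff {τ : ℂ} (hτ : 0 < τ.im) {z : ℂ} :
    theta τ z = 0 ↔ ∃ k l : ℤ, z = k + l * τ := by
  refine ⟨(isSigma_theta hτ).lattice_of_eq_zero z, ?_⟩
  rintro ⟨k, l, rfl⟩
  exact (isSigma_theta hτ).lattice_eq_zero k l

theorem theta_add_eq_zero {τ : ℂ} (hτ : 0 < τ.im) {a b : ℂ} (ha : theta τ a = 0)
    (hb : theta τ b = 0) : theta τ (a + b) = 0 := by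
  rw [theta_eq_zero_iff hτ] at *
  obtain ⟨k, l, rfl⟩ := ha
  obtain ⟨k', l', rfl⟩ := hb
  exact ⟨k + k', l + l', by push_cast; ring⟩

theorem theta_neg_eq_zero {τ : ℂ} {a : ℂ} (ha : theta τ a = 0) : theta τ (-a) = 0 := by
  rw [theta_neg, ha, neg_zero]

theorem theta_sub_eq_zero {τ : ℂ} (hτ : 0 < τ.im) {a b : ℂ} (ha : theta τ a = 0)
    (hb : theta τ b = 0) : theta τ (a - b) = 0 := by
  rw [sub_eq_add_neg]
  exact theta_add_eq_zero hτ ha (theta_neg_eq_zero hb)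

theorem theta_half_ne_zero {τ : ℂ} (hτ : 0 < τ.im) : theta τ (1 / 2) ≠ 0 := by
  rw [Ne, theta_eq_zero_iff hτ]
  rintro ⟨k, l, h⟩
  have him := congrArg Complex.im h
  have hl : l = 0 := by
    have h2 : (l : ℝ) * τ.im = 0 := by simpa using him.symm
    exact_mod_cast (mul_eq_zero.mp h2).resolve_right hτ.ne'
  subst hl
  have h3 : (1 : ℂ) = ((2 * k : ℤ) : ℂ) := by
    push_cast
    linear_combination (norm := (push_cast; ring)) 2 * h
  have h4 : (1 : ℤ) = 2 * k := by exact_mod_cast h3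
  omega

namespace IsTheta

variable {τ : ℂ} {n : ℕ} {α β : ℂ} {f g : ℂ → ℂ}

theorem eq_zero_congr (hτ : 0 < τ.im) (hf : IsTheta τ n α β f) (hα : α ≠ 0) (hβ : β ≠ 0)
    {a b : ℂ} (h : theta τ (a - b) = 0) : f a = 0 ↔ f b = 0 := by
  obtain ⟨k, l, hkl⟩ := (theta_eq_zero_iff hτ).mp h
  rw [show a = b + k + l * τ by linear_combination hkl]
  exact hf.add_lattice_eq_zero_iff hα hβ k l b

/-- The product `∏ θ(z + b_i)`. -/
theorem prod_theta (hτ : 0 < τ.im) {ι : Type*} (s : Finset ι) (b : ι → ℂ) :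
    IsTheta τ s.card ((-1) ^ s.card)
      (kap τ ^ s.card * cexp (-(2 * Real.pi * I * ∑ i ∈ s, b i)))
      fun z => ∏ i ∈ s, theta τ (z + b i) := by
  classical
  induction s using Finset.induction_on with
  | empty => simpa using one
  | insert i s his ih =>
    simp only [Finset.prod_insert his, Finset.sum_insert his, Finset.card_insert_of_notMem his]
    have := ((IsTheta.of_theta hτ).shift (b i)).mul ih
    rw [add_comm 1] at this
    refine this.congr (by ring) ?_
    rw [mul_add, neg_add, Complex.exp_add]
    push_cast
    ring_nf

/-- The product `∏ θ(z - b_i)`. -/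
theorem prod_theta_sub (hτ : 0 < τ.im) {ι : Type*} (s : Finset ι) (b : ι → ℂ) :
    IsTheta τ s.card ((-1) ^ s.card)
      (kap τ ^ s.card * cexp (2 * Real.pi * I * ∑ i ∈ s, b i))
      fun z => ∏ i ∈ s, theta τ (z - b i) := by
  have := prod_theta hτ s fun i => -b i
  simp only [← sub_eq_add_neg] at this
  refine this.congr rfl ?_
  rw [Finset.sum_neg_distrib]
  ring_nf

/-- Zeros are divided out one at a time; incongruence keeps the remaining a_j zeros of the quotient.
The multipliers of the final quotient are left unspecified and are recovered where needed by
`IsTheta.of_mul`. -/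
theorem exists_prod_mul (hτ : 0 < τ.im) {ι : Type*} (s : Finset ι) (a : ι → ℂ)
    (ha : ∀ i ∈ s, ∀ j ∈ s, i ≠ j → theta τ (a i - a j) ≠ 0) :
    ∀ {n : ℕ} {α β : ℂ} {g : ℂ → ℂ}, α ≠ 0 → β ≠ 0 → IsTheta τ (n + s.card) α β g →
      (∀ i ∈ s, g (a i) = 0) →
      ∃ (h : ℂ → ℂ) (α' β' : ℂ), α' ≠ 0 ∧ β' ≠ 0 ∧ IsTheta τ n α' β' h ∧
        ∀ z, g z = (∏ i ∈ s, theta τ (z - a i)) * h z := by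
  classical
  induction s using Finset.induction_on with
  | empty =>
    intro n α β g hα hβ hg _
    exact ⟨g, α, β, hα, hβ, by simpa using hg, by simp⟩
  | insert i s his ih =>
    intro n α β g hα hβ hg h0
    rw [Finset.card_insert_of_notMem his, ← add_assoc] at hg
    obtain ⟨h₁, hh₁, e₁⟩ := (isSigma_theta hτ).exists_quotient hα hβ hg
      (h0 i (Finset.mem_insert_self _ _))
    have hk := kap_ne_zero τ
    obtain ⟨h, α', β', hα', hβ', hh, e⟩ := ih
      (fun j hj k hk => ha j (Finset.mem_insert_of_mem hj) k (Finset.mem_insert_of_mem hk))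
      (neg_ne_zero.mpr hα) (mul_ne_zero (mul_ne_zero hβ (inv_ne_zero hk)) (exp_ne_zero _)) hh₁
      (fun j hj => by
        have h1 := e₁ (a j)
        rw [h0 j (Finset.mem_insert_of_mem hj)] at h1
        exact (mul_eq_zero.mp h1.symm).resolve_left
          (ha j (Finset.mem_insert_of_mem hj) i (Finset.mem_insert_self _ _)
            (fun hji => his (hji ▸ hj))))
    refine ⟨h, α', β', hα', hβ', hh, fun z => ?_⟩
    rw [e₁, e, Finset.prod_insert his]
    ring

/-- A theta function of degree `n` with more than `n` zeros modulo the lattice vanishes. -/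
theorem eq_zero_of_card_lt (hτ : 0 < τ.im) {ι : Type*} {s : Finset ι} {a : ι → ℂ}
    (ha : ∀ i ∈ s, ∀ j ∈ s, i ≠ j → theta τ (a i - a j) ≠ 0)
    (hα : α ≠ 0) (hβ : β ≠ 0) (hg : IsTheta τ n α β g) (h0 : ∀ i ∈ s, g (a i) = 0)
    (hn : n < s.card) (z : ℂ) : g z = 0 := by
  classical
  obtain ⟨t, hts, htn⟩ := Finset.exists_subset_card_eq hn.le
  have hlt : ∃ i ∈ s, i ∉ t := by
    by_contra! hcon
    have := Finset.card_le_card (show s ⊆ t from hcon)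
    omega
  obtain ⟨i, his, hit⟩ := hlt
  rw [← zero_add n, ← htn] at hg
  obtain ⟨h, α', β', -, -, hh, e⟩ := exists_prod_mul hτ t a
    (fun j hj k hk => ha j (hts hj) k (hts hk)) hα hβ hg (fun j hj => h0 j (hts hj))
  -- After n zeros have been divided out, an exponential remains; it cannot vanish at the additional
  -- zero unless it is identically zero.
  obtain ⟨C, γ, hC⟩ := hh.eq_exp_of_degree_zero hτ
  have h1 := e (a i)
  rw [h0 i his, hC] at h1
  have h2 : ∏ j ∈ t, theta τ (a i - a j) ≠ 0 :=
    Finset.prod_ne_zero_iff.mpr fun j hj => ha i his j (hts hj) (fun hij => hit (hij ▸ hj))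
  have h3 := (mul_eq_zero.mp h1.symm).resolve_left h2
  have h4 : C = 0 := (mul_eq_zero.mp h3).resolve_right (exp_ne_zero _)
  rw [e, hC, h4]
  ring

/-- Two theta functions of degree `n` with the same multipliers and `n` common zeros are
proportional. -/
theorem eq_const_mul_of_zeros (hτ : 0 < τ.im) {ι : Type*} {s : Finset ι} {a : ι → ℂ}
    (ha : ∀ i ∈ s, ∀ j ∈ s, i ≠ j → theta τ (a i - a j) ≠ 0)
    (hα : α ≠ 0) (hβ : β ≠ 0) (hf : IsTheta τ n α β f) (hg : IsTheta τ n α β g)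
    (hf0 : ∀ i ∈ s, f (a i) = 0) (hg0 : ∀ i ∈ s, g (a i) = 0) (hn : n ≤ s.card)
    {z₀ : ℂ} (hz₀ : g z₀ ≠ 0) : ∃ r : ℂ, ∀ z, f z = r * g z := by
  classical
  refine ⟨f z₀ / g z₀, fun z => ?_⟩
  have hd := hf.sub (hg.const_mul (f z₀ / g z₀))
  have hc : ∀ i ∈ s, theta τ (z₀ - a i) ≠ 0 := fun i hi h =>
    hz₀ ((hg.eq_zero_congr hτ hα hβ h).mpr (hg0 i hi))
  -- The difference f - r g also vanishes at z₀, which is incongruent to the given zeros because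
  -- g(z₀) ≠ 0; `none` indexes this extra zero.
  refine sub_eq_zero.mp (eq_zero_of_card_lt hτ (s := Finset.insertNone s)
    (a := fun o => o.elim z₀ a) ?_ hα hβ hd ?_ (by rw [Finset.card_insertNone]; omega) z)
  · rintro (_ | i) hi (_ | j) hj hij
    · exact absurd rfl hij
    · exact hc j (by simpa using hj)
    · dsimp only [Option.elim]
      rw [theta_sub_comm]
      exact neg_ne_zero.mpr (hc i (by simpa using hi))
    · exact ha i (by simpa using hi) j (by simpa using hj) (fun h => hij (by rw [h]))
  · rintro (_ | i) hi
    · simp only [Option.elim]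
      field_simp
      ring
    · simp [hf0 i (by simpa using hi), hg0 i (by simpa using hi)]

/-- The quotient of two theta functions of the same type which is invariant under a translation
of infinite order modulo the lattice is constant. -/
theorem eq_const_mul_of_translation (hτ : 0 < τ.im) {w : ℂ}
    (hw : ∀ k : ℤ, k ≠ 0 → theta τ (k * w) ≠ 0)
    (hα : α ≠ 0) (hβ : β ≠ 0) (hf : IsTheta τ n α β f) (hg : IsTheta τ n α β g)
    {z₀ : ℂ} (hz₀ : g z₀ ≠ 0) (h : ∀ z, f (z - w) * g z = f z * g (z - w)) :
    ∃ r : ℂ, ∀ z, f z = r * g z := by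
  obtain ⟨x, hx⟩ := exists_prod_ne_zero_entire (Finset.range (n + 1))
    (f := fun k z => g (z - k * w))
    (fun k _ => hg.diff.comp (differentiable_id.sub_const _))
    (fun k _ => ⟨z₀ + k * w, by simpa using hz₀⟩)
  have hx' : ∀ k < n + 1, g (x - k * w) ≠ 0 := fun k hk =>
    Finset.prod_ne_zero_iff.mp hx k (Finset.mem_range.mpr hk)
  have hgx : g x ≠ 0 := by simpa using hx' 0 (by omega)
  refine ⟨f x / g x, fun z => sub_eq_zero.mp ?_⟩
  have hd := hf.sub (hg.const_mul (f x / g x))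
  -- The ratio f/g takes the same value at x, x - w, …, x - nw, which are n + 1 incongruent points
  -- since w has infinite order.
  have key : ∀ k < n + 1, f (x - k * w) = f x / g x * g (x - k * w) := by
    intro k
    induction k with
    | zero => intro _; field_simp; simp
    | succ k ih =>
      intro hk
      have h1 := h (x - k * w)
      rw [ih (by omega), show x - k * w - w = x - ((k + 1 : ℕ) : ℂ) * w by push_cast; ring] at h1
      exact mul_right_cancel₀ (hx' k (by omega)) (by linear_combination h1)
  refine eq_zero_of_card_lt hτ (s := Finset.range (n + 1)) (a := fun k : ℕ => x - k * w) ?_ hα hβ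
    hd ?_ (by simp) z
  · intro i _ j _ hij
    have := hw ((j : ℤ) - i) (sub_ne_zero.mpr (by exact_mod_cast hij.symm))
    convert this using 2
    push_cast
    ring
  · intro k hk
    rw [key k (Finset.mem_range.mp hk), sub_self]

/-- A theta function of positive degree has a zero. -/
theorem exists_zero (hτ : 0 < τ.im) (hn : n ≠ 0) (hg : IsTheta τ n α β g) : ∃ z, g z = 0 := by
  by_contra! hne
  have hgd := hg.diff
  have hα : α ≠ 0 := by
    rintro rfl
    exact hne _ (by simpa using hg.add_one 0)
  have hβ : β ≠ 0 := by
    rintro rfl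
    exact hne _ (by simpa using hg.add_tau 0)
  have hg' : Differentiable ℂ (deriv g) := fun z =>
    (hgd.analyticAt z).deriv.differentiableAt
  -- Without zeros, the logarithmic derivative is entire with u(z+1) = u(z) and u(z+τ) = u(z) -
  -- 2πin. Its derivative is constant, so u is affine, hence constant by 1-periodicity; this
  -- contradicts n ≠ 0.
  set u : ℂ → ℂ := fun z => deriv g z / g z with hu
  have hud : Differentiable ℂ u := hg'.fun_div hgd hne
  have u1 : ∀ z, u (z + 1) = u z := by
    intro z
    have e : (fun z => g (z + 1)) = fun z => α * g z := funext hg.add_one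
    have := congrArg (fun f => deriv f z) e
    simp only [deriv_comp_add_const, deriv_const_mul_field] at this
    simp only [hu]
    rw [this, hg.add_one, mul_div_mul_left _ _ hα]
  have uτ : ∀ z, u (z + τ) = u z - 2 * Real.pi * I * n := by
    intro z
    have e : (fun z => g (z + τ)) = fun z => β * cexp (-(2 * Real.pi * I * n * z)) * g z :=
      funext hg.add_tau
    have := congrArg (fun f => deriv f z) e
    have hE : HasDerivAt (fun z : ℂ => β * cexp (-(2 * Real.pi * I * n * z)))
        (β * (cexp (-(2 * Real.pi * I * n * z)) * (-(2 * Real.pi * I * n)))) z := by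
      refine HasDerivAt.const_mul β (HasDerivAt.cexp ?_)
      simpa using ((hasDerivAt_id z).const_mul (2 * Real.pi * I * n)).fun_neg
    rw [deriv_comp_add_const, (hE.fun_mul (hgd z).hasDerivAt).deriv] at this
    simp only [hu]
    rw [this, hg.add_tau]
    have h1 := hne z
    have h2 := exp_ne_zero (-(2 * Real.pi * I * n * z))
    field_simp
    ring
  have hu' : IsTheta τ 0 1 1 (deriv u) := by
    refine ⟨fun z => (hud.analyticAt z).deriv.differentiableAt, fun z => ?_, fun z => ?_⟩
    · have e : (fun z => u (z + 1)) = u := funext u1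
      rw [← deriv_comp_add_const, e, one_mul]
    · have e : (fun z => u (z + τ)) = fun z => u z - 2 * Real.pi * I * n := funext uτ
      rw [← deriv_comp_add_const, e, deriv_sub_const]
      simp
  obtain ⟨C, hC⟩ := hu'.eq_const_of_degree_zero hτ
  have hlin : ∀ z, u z = C * z + u 0 := by
    have hd : Differentiable ℂ fun z => u z - C * z := by fun_prop
    have h0 : ∀ z, deriv (fun z => u z - C * z) z = 0 := by
      intro z
      have := ((hud z).hasDerivAt.sub ((hasDerivAt_id z).const_mul C)).deriv
      simp only [mul_one, hC, sub_self] at this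
      exact this
    intro z
    have := is_const_of_deriv_eq_zero hd h0 z 0
    simp only [mul_zero, sub_zero] at this
    linear_combination this
  have hC0 : C = 0 := by
    have := u1 0
    rw [hlin (0 + 1)] at this
    linear_combination this
  have h2 := uτ 0
  rw [hlin (0 + τ), hC0] at h2
  have : (2 * Real.pi * I * n : ℂ) = 0 := by linear_combination h2
  simp [Real.pi_ne_zero, hn] at this

end IsTheta

/-! ### Even theta functions -/

/-- The even function `θ(z - b) θ(z + b)`. -/
def pairTheta (τ b z : ℂ) : ℂ := theta τ (z - b) * theta τ (z + b)

theorem pairTheta_neg (τ b z : ℂ) : pairTheta τ b (-z) = pairTheta τ b z := by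
  rw [pairTheta, pairTheta, show -z - b = -(z + b) by ring, show -z + b = -(z - b) by ring,
    theta_neg, theta_neg]
  ring

theorem pairTheta_zero (τ z : ℂ) : pairTheta τ 0 z = theta τ z ^ 2 := by
  simp [pairTheta, sq]

theorem pairTheta_symm (τ b z : ℂ) : pairTheta τ b z = -pairTheta τ z b := by
  rw [pairTheta, pairTheta, theta_sub_comm, add_comm]
  ring

theorem isTheta_pairTheta {τ : ℂ} (hτ : 0 < τ.im) (b : ℂ) :
    IsTheta τ 2 1 (kap τ ^ 2) (pairTheta τ b) := by
  have h := ((IsTheta.of_theta hτ).shift (-b)).mul ((IsTheta.of_theta hτ).shift b)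
  simp only [← sub_eq_add_neg] at h
  refine h.congr (by norm_num) ?_
  have : cexp (-(2 * Real.pi * I * (1 : ℕ) * -b)) * cexp (-(2 * Real.pi * I * (1 : ℕ) * b)) = 1 := by
    rw [← Complex.exp_add]; simp
  linear_combination kap τ ^ 2 * this

theorem IsTheta.prod_even {τ : ℂ} {ι : Type*} (s : Finset ι) {f : ι → ℂ → ℂ}
    (hf : ∀ i ∈ s, IsTheta τ 2 1 (kap τ ^ 2) (f i)) :
    IsTheta τ (2 * s.card) 1 (kap τ ^ (2 * s.card)) fun z => ∏ i ∈ s, f i z := by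
  classical
  induction s using Finset.induction_on with
  | empty => simpa using IsTheta.one
  | insert i s his ih =>
    simp only [Finset.prod_insert his, Finset.card_insert_of_notMem his]
    have := (hf i (Finset.mem_insert_self _ _)).mul
      (ih fun j hj => hf j (Finset.mem_insert_of_mem hj))
    rw [show 2 * (s.card + 1) = 2 + 2 * s.card by ring]
    exact this.congr (by ring) (by ring)

/-- The even theta function of degree `2n` with the value `y i` at `b i`, `i ≤ n`. -/
def interp (τ : ℂ) (n : ℕ) (b y : ℕ → ℂ) (z : ℂ) : ℂ :=
  ∑ i ∈ Finset.range (n + 1), y i *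
    ∏ j ∈ (Finset.range (n + 1)).erase i, ((pairTheta τ (b j) (b i))⁻¹ * pairTheta τ (b j) z)

theorem isTheta_interp {τ : ℂ} (hτ : 0 < τ.im) (n : ℕ) (b y : ℕ → ℂ) :
    IsTheta τ (2 * n) 1 (kap τ ^ (2 * n)) (interp τ n b y) := by
  refine IsTheta.sum fun i hi => IsTheta.const_mul ?_ _
  have := IsTheta.prod_even ((Finset.range (n + 1)).erase i)
    (f := fun j z => (pairTheta τ (b j) (b i))⁻¹ * pairTheta τ (b j) z)
    fun j _ => (isTheta_pairTheta hτ (b j)).const_mul _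
  rwa [Finset.card_erase_of_mem hi, Finset.card_range, Nat.add_sub_cancel] at this

theorem interp_neg (τ : ℂ) (n : ℕ) (b y : ℕ → ℂ) (z : ℂ) :
    interp τ n b y (-z) = interp τ n b y z := by
  simp only [interp, pairTheta_neg]

theorem interp_node {τ : ℂ} {n : ℕ} {b : ℕ → ℂ} (y : ℕ → ℂ)
    (hb : ∀ i ≤ n, ∀ j ≤ n, i ≠ j → pairTheta τ (b j) (b i) ≠ 0) {i : ℕ} (hi : i ≤ n) :
    interp τ n b y (b i) = y i := by
  have hmem : i ∈ Finset.range (n + 1) := Finset.mem_range.mpr (by omega)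
  rw [interp, Finset.sum_eq_single_of_mem i hmem]
  · rw [Finset.prod_eq_one, mul_one]
    intro j hj
    rw [Finset.mem_erase, Finset.mem_range] at hj
    exact inv_mul_cancel₀ (hb i hi j (by omega) hj.1.symm)
  · intro k hk hki
    rw [Finset.prod_eq_zero (Finset.mem_erase.mpr ⟨hki.symm, hmem⟩), mul_zero]
    simp [pairTheta, theta_zero]

/-- The addition formula. -/
theorem pairTheta_addition {τ : ℂ} (hτ : 0 < τ.im) (b z : ℂ) :
    -theta τ (1 / 2) ^ 2 * pairTheta τ b z
      = pairTheta τ (1 / 2) b * theta τ z ^ 2 - theta τ b ^ 2 * pairTheta τ (1 / 2) z := by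
  have hk := kap_ne_zero τ
  have hθ := theta_differentiable hτ
  -- In z, both sides have degree two and vanish at ±b, which are incongruent if θ(2b) ≠ 0; the
  -- factor is read off at z = 0. The other b follow by cancelling θ(2b) as an entire function of b.
  have main : ∀ b, theta τ (2 * b) ≠ 0 → ∀ z, -theta τ (1 / 2) ^ 2 * pairTheta τ b z
      = pairTheta τ (1 / 2) b * theta τ z ^ 2 - theta τ b ^ 2 * pairTheta τ (1 / 2) z := by
    intro b hb z
    have hb1 : theta τ b ≠ 0 := fun h => hb (by rw [two_mul]; exact theta_add_eq_zero hτ h h)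
    have hsq : IsTheta τ 2 1 (kap τ ^ 2) fun z => theta τ z ^ 2 := by
      have := isTheta_pairTheta hτ 0
      rwa [show pairTheta τ 0 = fun z => theta τ z ^ 2 from funext (pairTheta_zero τ)] at this
    have hF : IsTheta τ 2 1 (kap τ ^ 2) fun z =>
        pairTheta τ (1 / 2) b * theta τ z ^ 2 - theta τ b ^ 2 * pairTheta τ (1 / 2) z :=
      (hsq.const_mul _).sub ((isTheta_pairTheta hτ _).const_mul _)
    have h0 : pairTheta τ b 0 ≠ 0 := by
      rw [pairTheta, zero_sub, zero_add, theta_neg]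
      exact mul_ne_zero (neg_ne_zero.mpr hb1) hb1
    obtain ⟨r, hr⟩ := hF.eq_const_mul_of_zeros hτ (g := pairTheta τ b) (s := Finset.univ)
      (a := fun i : Bool => if i then b else -b)
      (by
        rintro (_ | _) - (_ | _) - hij
        · exact absurd rfl hij
        · simp only [Bool.false_eq_true, if_false, if_true]
          rw [show -b - b = -(2 * b) by ring, theta_neg]
          exact neg_ne_zero.mpr hb
        · simp only [Bool.false_eq_true, if_false, if_true]
          rw [show b - -b = 2 * b by ring]
          exact hb
        · exact absurd rfl hij)
      one_ne_zero (pow_ne_zero 2 hk) (isTheta_pairTheta hτ b)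
      (by
        rintro (_ | _) -
        · simp only [Bool.false_eq_true, if_false, pairTheta_neg, theta_neg]
          ring
        · simp only [if_true]
          ring)
      (by rintro (_ | _) - <;> simp [pairTheta, theta_zero])
      (by simp) h0
    have hr0 := hr 0
    have e1 : pairTheta τ b 0 = -theta τ b ^ 2 := by
      rw [pairTheta, zero_sub, zero_add, theta_neg]; ring
    have e2 : pairTheta τ (1 / 2) 0 = -theta τ (1 / 2) ^ 2 := by
      rw [pairTheta, zero_sub, zero_add, theta_neg]; ring
    rw [theta_zero, e1, e2] at hr0
    have : r = -theta τ (1 / 2) ^ 2 := by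
      apply mul_right_cancel₀ (pow_ne_zero 2 hb1)
      linear_combination hr0
    rw [hr z, this]
  obtain ⟨z₁, hz₁⟩ := (isSigma_theta hτ).exists_ne_zero
  refine mul_left_cancel_entire (f := fun b => theta τ (2 * b))
    (g := fun b => -theta τ (1 / 2) ^ 2 * pairTheta τ b z)
    (h := fun b => pairTheta τ (1 / 2) b * theta τ z ^ 2 - theta τ b ^ 2 * pairTheta τ (1 / 2) z)
    (by fun_prop) (by unfold pairTheta; fun_prop) (by unfold pairTheta; fun_prop) (z₀ := z₁ / 2)
    (by rwa [mul_div_cancel₀ _ two_ne_zero]) (fun b => ?_) b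
  by_cases hb : theta τ (2 * b) = 0
  · simp only [hb, zero_mul]
  · rw [main b hb z]

/-- The even elliptic function of degree two `θ(z - 1/2) θ(z + 1/2) / θ(z)²`. -/
def ellX (τ z : ℂ) : ℂ := pairTheta τ (1 / 2) z / theta τ z ^ 2

/-- By the addition formula, a pair of opposite zeros ±b becomes a single root `ellX τ b`. Questions
about zeros of even theta functions thereby turn into questions about polynomials. -/
theorem pairTheta_eq_ellX {τ : ℂ} (hτ : 0 < τ.im) {b z : ℂ} (hb : theta τ b ≠ 0)
    (hz : theta τ z ≠ 0) : pairTheta τ b z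
      = (theta τ b ^ 2 / theta τ (1 / 2) ^ 2) * theta τ z ^ 2 * (ellX τ z - ellX τ b) := by
  have h := pairTheta_addition hτ b z
  have h2 := theta_half_ne_zero hτ
  rw [ellX, ellX]
  field_simp
  linear_combination -h

theorem ellX_eq_iff {τ : ℂ} (hτ : 0 < τ.im) {b z : ℂ} (hb : theta τ b ≠ 0)
    (hz : theta τ z ≠ 0) : ellX τ z = ellX τ b ↔ pairTheta τ b z = 0 := by
  rw [pairTheta_eq_ellX hτ hb hz]
  simp [hb, hz, theta_half_ne_zero hτ, -one_div, sub_eq_zero]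

/-- The numerator of `ellX τ z - x` is a theta function of degree two, so it has a zero; that zero
is no lattice point, since there θ² vanishes while θ(z - 1/2)θ(z + 1/2) does not. -/
theorem exists_ellX_eq {τ : ℂ} (hτ : 0 < τ.im) (x : ℂ) :
    ∃ a, theta τ a ≠ 0 ∧ ellX τ a = x := by
  have h1 : IsTheta τ 2 1 (kap τ ^ 2) fun z => pairTheta τ (1 / 2) z - x * pairTheta τ 0 z :=
    (isTheta_pairTheta hτ _).sub ((isTheta_pairTheta hτ _).const_mul x)
  obtain ⟨a, ha⟩ := h1.exists_zero hτ two_ne_zero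
  rw [pairTheta_zero] at ha
  have ha0 : theta τ a ≠ 0 := by
    intro h0
    rw [h0, pairTheta] at ha
    simp only [ne_eq, OfNat.ofNat_ne_zero, not_false_eq_true, zero_pow, mul_zero, sub_zero,
      mul_eq_zero] at ha
    rcases ha with ha | ha
    · have := theta_sub_eq_zero hτ h0 ha
      rw [sub_sub_cancel] at this
      exact theta_half_ne_zero hτ this
    · have := theta_sub_eq_zero hτ ha h0
      rw [add_sub_cancel_left] at this
      exact theta_half_ne_zero hτ this
  refine ⟨a, ha0, ?_⟩
  rw [ellX, div_eq_iff (pow_ne_zero 2 ha0)]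
  linear_combination ha

/-- The finitely many values of `ellX` at the points of order two. -/
theorem ellX_half_period {τ : ℂ} (hτ : 0 < τ.im) {a : ℂ} (ha : theta τ a ≠ 0)
    (h2 : theta τ (2 * a) = 0) :
    ∃ w ∈ ({1 / 2, τ / 2, 1 / 2 + τ / 2} : Finset ℂ), theta τ (a - w) = 0 := by
  obtain ⟨k, l, hkl⟩ := (theta_eq_zero_iff hτ).mp h2
  have key : ∀ (w : ℂ) (k' l' : ℤ), a - w = k' + l' * τ → theta τ (a - w) = 0 := fun w k' l' h =>
    (theta_eq_zero_iff hτ).mpr ⟨k', l', h⟩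
  have ea : a = k / 2 + l * τ / 2 := by linear_combination hkl / 2
  rcases Int.even_or_odd' k with ⟨k', rfl | rfl⟩ <;> rcases Int.even_or_odd' l with ⟨l', rfl | rfl⟩
  · refine absurd ((theta_eq_zero_iff hτ).mpr ⟨k', l', ?_⟩) ha
    rw [ea]; push_cast; ring
  · refine ⟨τ / 2, by simp, key _ k' l' ?_⟩
    rw [ea]; push_cast; ring
  · refine ⟨1 / 2, by simp, key _ k' l' ?_⟩
    rw [ea]; push_cast; ring
  · refine ⟨1 / 2 + τ / 2, by simp, key _ k' l' ?_⟩
    rw [ea]; push_cast; ring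

theorem half_period {τ : ℂ} (hτ : 0 < τ.im) {w : ℂ}
    (hw : w ∈ ({1 / 2, τ / 2, 1 / 2 + τ / 2} : Finset ℂ)) :
    theta τ w ≠ 0 ∧ theta τ (2 * w) = 0 := by
  have hne : ∀ (w : ℂ) (k l : ℤ), (2 * w = k + l * τ) → (k % 2 = 1 ∨ l % 2 = 1) →
      theta τ w ≠ 0 := by
    intro w k l h hkl h0
    obtain ⟨k', l', h'⟩ := (theta_eq_zero_iff hτ).mp h0
    have e : ((k - 2 * k' : ℤ) : ℂ) + ((l - 2 * l' : ℤ) : ℂ) * τ = 0 := by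
      push_cast
      linear_combination 2 * h' - h
    have him := congrArg Complex.im e
    have hl : l - 2 * l' = 0 := by
      have h2 : ((l - 2 * l' : ℤ) : ℝ) * τ.im = 0 := by
        simpa using him
      exact_mod_cast (mul_eq_zero.mp h2).resolve_right hτ.ne'
    rw [hl] at e
    have hk : k - 2 * k' = 0 := by
      have : ((k - 2 * k' : ℤ) : ℂ) = 0 := by simpa using e
      exact_mod_cast this
    omega
  simp only [Finset.mem_insert, Finset.mem_singleton] at hw
  rcases hw with rfl | rfl | rfl
  · exact ⟨hne _ 1 0 (by norm_num) (by simp), (theta_eq_zero_iff hτ).mpr ⟨1, 0, by norm_num⟩⟩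
  · exact ⟨hne _ 0 1 (by push_cast; ring) (by simp),
      (theta_eq_zero_iff hτ).mpr ⟨0, 1, by push_cast; ring⟩⟩
  · exact ⟨hne _ 1 1 (by push_cast; ring) (by simp),
      (theta_eq_zero_iff hτ).mpr ⟨1, 1, by push_cast; ring⟩⟩

/-! ### Specialization of separable polynomials -/

section Specialization

open Polynomial

theorem finite_eval_eq_zero {p : ℂ[X]} (h : p.eval 0 ≠ 0) : {d : ℂ | p.eval d = 0}.Finite := by
  have hp : p ≠ 0 := by
    rintro rfl
    simp at h
  exact (p.roots.toFinset.finite_toSet).subset fun d hd => by simpa [hp] using hd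

/-- The leading coefficient and the resultant with the derivative are polynomials in the parameter,
nonzero at 0. The resultant is taken with formal degrees m and m - 1 so that it commutes with
specialization, and its Bézout identity specializes to separability. -/
theorem finite_not_separable {P : ℂ[X][X]} {m : ℕ} (hm : 1 ≤ m) (hP : P.natDegree ≤ m)
    (h0 : (P.map (evalRingHom 0)).natDegree = m) (hs : (P.map (evalRingHom 0)).Separable) :
    {d : ℂ | ¬ ((P.map (evalRingHom d)).natDegree = m ∧
      (P.map (evalRingHom d)).Separable)}.Finite := by
  have hd : P.derivative.natDegree ≤ m - 1 := (natDegree_derivative_le P).trans (by omega)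
  obtain ⟨U, V, -, -, hUV⟩ := exists_mul_add_mul_eq_C_resultant P P.derivative hP hd
    (Or.inl (by omega))
  set ρ := P.resultant P.derivative m (m - 1) with hρ
  have hc : (P.coeff m).eval 0 ≠ 0 := by
    have : (P.map (evalRingHom 0)).coeff m ≠ 0 := by
      rw [← h0, coeff_natDegree, Ne, leadingCoeff_eq_zero]
      intro h
      rw [h, natDegree_zero] at h0
      omega
    simpa using this
  have hr : ρ.eval 0 ≠ 0 := by
    have h1 := resultant_ne_zero _ _ hs
    have h2 : (P.map (evalRingHom 0)).derivative.natDegree = m - 1 := by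
      rw [natDegree_derivative, h0]
    rw [h0, h2, derivative_map, resultant_map_map] at h1
    exact h1
  refine ((finite_eval_eq_zero hc).union (finite_eval_eq_zero hr)).subset fun d hd' => ?_
  by_contra hcon
  simp only [Set.mem_union, Set.mem_ofPred_eq, not_or] at hcon
  refine hd' ⟨le_antisymm (natDegree_map_le.trans hP) (le_natDegree_of_ne_zero ?_), ?_⟩
  · simpa using hcon.1
  · have h1 := congrArg (Polynomial.map (evalRingHom d)) hUV
    rw [Polynomial.map_add, Polynomial.map_mul, Polynomial.map_mul, map_C] at h1
    refine ⟨C (ρ.eval d)⁻¹ * U.map (evalRingHom d), C (ρ.eval d)⁻¹ * V.map (evalRingHom d), ?_⟩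
    rw [derivative_map]
    have h2 : C (ρ.eval d)⁻¹ * C (ρ.eval d) = (1 : ℂ[X]) := by
      rw [← C_mul, inv_mul_cancel₀ hcon.2, C_1]
    rw [coe_evalRingHom] at h1
    linear_combination C (ρ.eval d)⁻¹ * h1 + h2

theorem finite_eval_map_eq_zero {P : ℂ[X][X]} {x : ℂ}
    (h : (P.map (evalRingHom 0)).eval x ≠ 0) :
    {d : ℂ | (P.map (evalRingHom d)).eval x = 0}.Finite := by
  have e : ∀ d : ℂ, (P.map (evalRingHom d)).eval x = (P.eval (C x)).eval d := by
    intro d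
    have := Polynomial.hom_eval₂ P (RingHom.id _) (evalRingHom d) (C x)
    rw [eval_map]
    simpa [eval₂_id] using this.symm
  simp only [e] at h ⊢
  exact finite_eval_eq_zero h

theorem exists_injective_roots {p : ℂ[X]} {m : ℕ} (h : p.natDegree = m) (hs : p.Separable) :
    ∃ x : Fin m → ℂ, Function.Injective x ∧
      ∀ t, p.eval t = p.leadingCoeff * ∏ i, (t - x i) := by
  classical
  have hc : p.roots.toFinset.card = m := by
    rw [Multiset.toFinset_card_of_nodup (nodup_roots hs), ← h]
    exact IsAlgClosed.card_roots_eq_natDegree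
  let e := p.roots.toFinset.equivFinOfCardEq hc
  refine ⟨fun i => (e.symm i : ℂ), fun i j hij => e.symm.injective (Subtype.ext hij), fun t => ?_⟩
  have h1 := (IsAlgClosed.splits p).eq_prod_roots
  conv_lhs => rw [h1]
  rw [eval_mul, eval_C, eval_multiset_prod, Multiset.map_map]
  congr 1
  have h2 : ∏ i : Fin m, (t - (e.symm i : ℂ)) = ∏ r : p.roots.toFinset, (t - (r : ℂ)) :=
    Equiv.prod_comp e.symm fun r : p.roots.toFinset => t - (r : ℂ)
  rw [h2, Finset.prod_coe_sort p.roots.toFinset fun r => t - r, Finset.prod,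
    Multiset.toFinset_val, (nodup_roots hs).dedup]
  simp

end Specialization

/-! ### Factorization of families of even theta functions -/

section Factorization

open Polynomial

/-- The polynomial in `ellX` representing `θ(z - b_j) θ(z + b_j) / θ(z)²`, where `b_0 = 0`. -/
def nodePoly (τ : ℂ) (b : ℕ → ℂ) (j : ℕ) : ℂ[X] :=
  if j = 0 then 1 else C (theta τ (b j) ^ 2 / theta τ (1 / 2) ^ 2) * (X - C (ellX τ (b j)))

/-- The polynomial in `ellX` representing the interpolating functions. -/
def lagrangePoly (τ : ℂ) (n : ℕ) (b : ℕ → ℂ) (i : ℕ) : ℂ[X] :=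
  ∏ j ∈ (Finset.range (n + 1)).erase i, (C (pairTheta τ (b j) (b i))⁻¹ * nodePoly τ b j)

/-- The polynomial in `ellX`, depending polynomially on a parameter, which represents a family of
interpolating functions. -/
def familyPoly (τ : ℂ) (n : ℕ) (b : ℕ → ℂ) (Y : ℕ → ℂ[X]) : ℂ[X][X] :=
  ∑ i ∈ Finset.range (n + 1), C (Y i) * (lagrangePoly τ n b i).map C

theorem natDegree_nodePoly_le (τ : ℂ) (b : ℕ → ℂ) (j : ℕ) : (nodePoly τ b j).natDegree ≤ 1 := by
  rw [nodePoly]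
  split_ifs
  · simp
  · exact (natDegree_C_mul_le _ _).trans (natDegree_X_sub_C_le _)

theorem natDegree_lagrangePoly_le (τ : ℂ) {n : ℕ} (b : ℕ → ℂ) {i : ℕ} (hi : i ≤ n) :
    (lagrangePoly τ n b i).natDegree ≤ n := by
  refine (natDegree_prod_le _ _).trans ?_
  refine (Finset.sum_le_sum fun j _ =>
    (natDegree_C_mul_le _ _).trans (natDegree_nodePoly_le τ b j)).trans ?_
  rw [Finset.sum_const, Finset.card_erase_of_mem (Finset.mem_range.mpr (by omega))]
  simp

theorem natDegree_familyPoly_le (τ : ℂ) (n : ℕ) (b : ℕ → ℂ) (Y : ℕ → ℂ[X]) :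
    (familyPoly τ n b Y).natDegree ≤ n := by
  refine natDegree_sum_le_of_forall_le _ _ fun i hi => ?_
  refine (natDegree_C_mul_le _ _).trans (natDegree_map_le.trans ?_)
  exact natDegree_lagrangePoly_le τ b (by simpa [Nat.lt_succ_iff] using hi)

theorem map_familyPoly (τ : ℂ) (n : ℕ) (b : ℕ → ℂ) (Y : ℕ → ℂ[X]) (d : ℂ) :
    (familyPoly τ n b Y).map (evalRingHom d)
      = ∑ i ∈ Finset.range (n + 1), C ((Y i).eval d) * lagrangePoly τ n b i := by
  rw [familyPoly, Polynomial.map_sum]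
  refine Finset.sum_congr rfl fun i _ => ?_
  rw [Polynomial.map_mul, map_C, Polynomial.map_map,
    show (evalRingHom d).comp C = RingHom.id ℂ by ext; simp, Polynomial.map_id]
  rfl

theorem pairTheta_eq_nodePoly {τ : ℂ} (hτ : 0 < τ.im) {b : ℕ → ℂ} (hb0 : b 0 = 0) {j : ℕ}
    (hb : j ≠ 0 → theta τ (b j) ≠ 0) {z : ℂ} (hz : theta τ z ≠ 0) :
    pairTheta τ (b j) z = theta τ z ^ 2 * (nodePoly τ b j).eval (ellX τ z) := by
  rw [nodePoly]
  split_ifs with hj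
  · rw [hj, hb0, pairTheta_zero, eval_one, mul_one]
  · rw [pairTheta_eq_ellX hτ (hb hj) hz]
    simp only [eval_mul, eval_C, eval_sub, eval_X]
    ring

/-- Each of the n factors in a Lagrange term contributes θ² times a polynomial of degree at most one
in `ellX`; the node b_0 = 0 contributes θ² alone. -/
theorem interp_eq_familyPoly {τ : ℂ} (hτ : 0 < τ.im) {n : ℕ} {b : ℕ → ℂ} (hb0 : b 0 = 0)
    (hb : ∀ j ≤ n, j ≠ 0 → theta τ (b j) ≠ 0) (Y : ℕ → ℂ[X]) (d : ℂ) {z : ℂ}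
    (hz : theta τ z ≠ 0) : interp τ n b (fun i => (Y i).eval d) z
      = theta τ z ^ (2 * n) * ((familyPoly τ n b Y).map (evalRingHom d)).eval (ellX τ z) := by
  rw [map_familyPoly, eval_finsetSum, Finset.mul_sum, interp]
  refine Finset.sum_congr rfl fun i hi => ?_
  rw [eval_mul, eval_C, lagrangePoly, eval_prod]
  have h1 : ∀ j ∈ (Finset.range (n + 1)).erase i,
      (pairTheta τ (b j) (b i))⁻¹ * pairTheta τ (b j) z = theta τ z ^ 2 *
        (C (pairTheta τ (b j) (b i))⁻¹ * nodePoly τ b j).eval (ellX τ z) := by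
    intro j hj
    rw [Finset.mem_erase, Finset.mem_range] at hj
    rw [pairTheta_eq_nodePoly hτ hb0 (hb j (by omega)) hz, eval_mul, eval_C]
    ring
  rw [Finset.prod_congr rfl h1, Finset.prod_mul_distrib, Finset.prod_const,
    Finset.card_erase_of_mem hi, Finset.card_range, Nat.add_sub_cancel, ← pow_mul]
  ring

/-- At parameter 0 only the Lagrange term of the node 0 is left, a multiple of ∏ (X - ellX b_j) with
distinct roots. Degree n, separability and nonvanishing at half-period values then persist off a
finite set, and the roots lift to points a_i through `ellX`. -/
theorem interp_factorization {τ : ℂ} (hτ : 0 < τ.im) {n : ℕ} (hn : 1 ≤ n) {b : ℕ → ℂ}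
    (hb0 : b 0 = 0) (hb : ∀ i ≤ n, ∀ j ≤ n, i ≠ j → pairTheta τ (b j) (b i) ≠ 0)
    (hb4 : ∀ j ≤ n, j ≠ 0 → theta τ (2 * b j) ≠ 0) (Y : ℕ → ℂ[X]) (hY0 : (Y 0).eval 0 ≠ 0)
    (hY : ∀ i ≤ n, i ≠ 0 → (Y i).eval 0 = 0) :
    ∃ B : Set ℂ, B.Finite ∧ ∀ d, d ∉ B → ∃ (K : ℂ) (a : Fin n → ℂ), K ≠ 0 ∧
      (∀ i, theta τ (2 * a i) ≠ 0) ∧ (∀ i j, i ≠ j → pairTheta τ (a i) (a j) ≠ 0) ∧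
      ∀ z, interp τ n b (fun i => (Y i).eval d) z = K * ∏ i, pairTheta τ (a i) z := by
  classical
  have hbθ : ∀ j ≤ n, j ≠ 0 → theta τ (b j) ≠ 0 := by
    intro j hj hj0 h
    have := hb j hj 0 (by omega) hj0
    rw [hb0, pairTheta_zero, h] at this
    exact this (by ring)
  set P := familyPoly τ n b Y with hP
  have hh := theta_half_ne_zero hτ
  -- the specialization at zero
  have hc : ∃ c : ℂ, c ≠ 0 ∧ P.map (evalRingHom 0)
      = C c * ∏ j ∈ (Finset.range (n + 1)).erase 0, (X - C (ellX τ (b j))) := by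
    refine ⟨(Y 0).eval 0 * ∏ j ∈ (Finset.range (n + 1)).erase 0,
      ((pairTheta τ (b j) (b 0))⁻¹ * (theta τ (b j) ^ 2 / theta τ (1 / 2) ^ 2)),
      mul_ne_zero hY0 (Finset.prod_ne_zero_iff.mpr fun j hj => ?_), ?_⟩
    · rw [Finset.mem_erase, Finset.mem_range] at hj
      exact mul_ne_zero (inv_ne_zero (hb 0 (by omega) j (by omega) hj.1.symm))
        (div_ne_zero (pow_ne_zero 2 (hbθ j (by omega) hj.1)) (pow_ne_zero 2 hh))
    · rw [hP, map_familyPoly, Finset.sum_eq_single_of_mem 0 (by simp)]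
      · rw [C_mul, mul_assoc, lagrangePoly]
        congr 1
        rw [map_prod, ← Finset.prod_mul_distrib]
        refine Finset.prod_congr rfl fun j hj => ?_
        rw [nodePoly, if_neg (Finset.mem_erase.mp hj).1, C_mul, mul_assoc]
      · intro i hi hi0
        rw [hY i (by simpa [Nat.lt_succ_iff] using hi) hi0]
        simp
  obtain ⟨c, hc0, hcP⟩ := hc
  have hinj : Set.InjOn (fun j => ellX τ (b j)) ((Finset.range (n + 1)).erase 0) := by
    intro i hi j hj hij
    by_contra hne
    simp only [Finset.coe_erase, Finset.coe_range, Set.mem_sdiff, Set.mem_Iio,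
      Set.mem_singleton_iff] at hi hj
    exact hb i (by omega) j (by omega) hne
      ((ellX_eq_iff hτ (hbθ j (by omega) hj.2) (hbθ i (by omega) hi.2)).mp hij)
  have hsep : (P.map (evalRingHom 0)).Separable := by
    rw [hcP]
    refine Separable.unit_mul (isUnit_C.mpr hc0.isUnit) ?_ 
    exact separable_prod_X_sub_C_iff'.mpr hinj
  have hdeg : (P.map (evalRingHom 0)).natDegree = n := by
    rw [hcP, natDegree_C_mul hc0, natDegree_prod_of_monic _ _ fun _ _ => monic_X_sub_C _]
    simp
  -- Half-periods have to be avoided because there a and -a are congruent, so a simple root in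
  -- `ellX` would give a double zero.
  have hhalf : ∀ w ∈ ({1 / 2, τ / 2, 1 / 2 + τ / 2} : Finset ℂ),
      (P.map (evalRingHom 0)).eval (ellX τ w) ≠ 0 := by
    intro w hw
    obtain ⟨hw1, hw2⟩ := half_period hτ hw
    rw [hcP, eval_mul, eval_C, eval_prod]
    refine mul_ne_zero hc0 (Finset.prod_ne_zero_iff.mpr fun j hj => ?_)
    rw [Finset.mem_erase, Finset.mem_range] at hj
    rw [eval_sub, eval_X, eval_C, sub_ne_zero, Ne,
      ellX_eq_iff hτ (hbθ j (by omega) hj.1) hw1]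
    intro h0
    apply hb4 j (by omega) hj.1
    rcases mul_eq_zero.mp h0 with h | h
    · have := theta_sub_eq_zero hτ hw2 (theta_add_eq_zero hτ h h)
      rwa [show 2 * w - (w - b j + (w - b j)) = 2 * b j by ring] at this
    · have := theta_sub_eq_zero hτ (theta_add_eq_zero hτ h h) hw2
      rwa [show w + b j + (w + b j) - 2 * w = 2 * b j by ring] at this
  refine ⟨_, (finite_not_separable hn (natDegree_familyPoly_le τ n b Y) hdeg hsep).union
    (Set.Finite.biUnion ({1 / 2, τ / 2, 1 / 2 + τ / 2} : Finset ℂ).finite_toSet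
      fun w hw => finite_eval_map_eq_zero (hhalf w hw)), fun d hd => ?_⟩
  rw [Set.mem_union, not_or, Set.mem_ofPred_eq, not_not] at hd
  obtain ⟨⟨hd1, hd2⟩, hd3⟩ := hd
  obtain ⟨x, hx, hpx⟩ := exists_injective_roots hd1 hd2
  choose a ha1 ha2 using fun i => exists_ellX_eq hτ (x i)
  set p := P.map (evalRingHom d) with hp
  have hlc : p.leadingCoeff ≠ 0 := leadingCoeff_ne_zero.mpr hd2.ne_zero
  refine ⟨p.leadingCoeff * ∏ i, (theta τ (1 / 2) ^ 2 / theta τ (a i) ^ 2), a,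
    mul_ne_zero hlc (Finset.prod_ne_zero_iff.mpr fun i _ =>
      div_ne_zero (pow_ne_zero 2 hh) (pow_ne_zero 2 (ha1 i))), fun i h2 => ?_,
    fun i j hij h => ?_, fun z => ?_⟩
  · obtain ⟨w, hw, hwa⟩ := ellX_half_period hτ (ha1 i) h2
    apply hd3
    refine Set.mem_biUnion (x := w) hw ?_
    rw [Set.mem_ofPred_eq, ← hp, hpx, mul_eq_zero]
    right
    refine Finset.prod_eq_zero (Finset.mem_univ i) ?_
    rw [sub_eq_zero, ← ha2 i, eq_comm, ellX_eq_iff hτ (half_period hτ hw).1 (ha1 i), pairTheta, hwa,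
      zero_mul]
  · rw [← ellX_eq_iff hτ (ha1 i) (ha1 j), ha2, ha2] at h
    exact hij (hx h).symm
  · obtain ⟨z₁, hz₁⟩ := (isSigma_theta hτ).exists_ne_zero
    have hd : Differentiable ℂ fun z => ∏ i, pairTheta τ (a i) z :=
      Differentiable.fun_finsetProd fun i _ => (isTheta_pairTheta hτ (a i)).diff
    refine mul_left_cancel_entire (theta_differentiable hτ) (isTheta_interp hτ _ _ _).diff
      (h := fun z => (p.leadingCoeff * ∏ i, (theta τ (1 / 2) ^ 2 / theta τ (a i) ^ 2))
        * ∏ i, pairTheta τ (a i) z) (hd.const_mul _) hz₁ (fun z => ?_) z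
    by_cases hz : theta τ z = 0
    · rw [hz, zero_mul, zero_mul]
    · rw [interp_eq_familyPoly hτ hb0 hbθ Y d hz, ← hP, ← hp, hpx]
      congr 1
      have h1 : ∀ i, theta τ (1 / 2) ^ 2 / theta τ (a i) ^ 2 * pairTheta τ (a i) z
          = theta τ z ^ 2 * (ellX τ z - x i) := by
        intro i
        rw [pairTheta_eq_ellX hτ (ha1 i) hz, ha2]
        have := ha1 i
        field_simp
      rw [mul_assoc, ← Finset.prod_mul_distrib, Finset.prod_congr rfl fun i _ => h1 i,
        Finset.prod_mul_distrib, Finset.prod_const, Finset.card_univ, Fintype.card_fin, ← pow_mul]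
      ring

end Factorization

/-! ### The values of a solution at the multiples of the step -/

/-- `y k` for `0 ≤ k ≤ m` are, up to a factor, the values of a solution of the `q`-Lamé equation at
`± k w`. -/
structure IsLameSeq (τ w : ℂ) (m : ℕ) (ε : ℂ) (y : ℕ → ℂ) : Prop where
  recurrence : ∀ k, 1 ≤ k → k ≤ m → theta τ ((k + m) * w) * y (k - 1)
    + theta τ ((k - m) * w) * y (k + 1) = ε * theta τ (k * w) * y k
  ne_zero : ∀ k ≤ m, y k ≠ 0

/-! ### The recurrence solved downwards as polynomials in d = 1/ε -/

section LamePoly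

open Polynomial

/-- Consecutive terms of the recurrence for the values at the multiples of the step, as
polynomials in the inverse of the eigenvalue. -/
def lamePoly (τ w : ℂ) (m : ℕ) : ℕ → ℂ[X] × ℂ[X]
  | 0 => (1, 0)
  -- This is the recurrence at k = m - j after the substitution y_k = d^k p_{m-k}, ε = 1/d; the
  -- scaling produces the X². The initial second entry 0 is immaterial, since its coefficient at j =
  -- 0 is θ(0) = 0.
  | j + 1 => (C (theta τ ((m - j) * w) / theta τ ((2 * m - j) * w)) * (lamePoly τ w m j).1
      - C (theta τ (-j * w) / theta τ ((2 * m - j) * w)) * X ^ 2 * (lamePoly τ w m j).2,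
      (lamePoly τ w m j).1)

variable {τ w : ℂ} {m : ℕ}

theorem theta_ne_zero_of_eq (hw : ∀ k : ℤ, k ≠ 0 → theta τ (k * w) ≠ 0) {c : ℂ} (k : ℤ)
    (hk : k ≠ 0) (hc : c = k) : theta τ (c * w) ≠ 0 := hc ▸ hw k hk

theorem eval_zero_lamePoly_ne_zero (hw : ∀ k : ℤ, k ≠ 0 → theta τ (k * w) ≠ 0) {j : ℕ}
    (hj : j ≤ m) : (lamePoly τ w m j).1.eval 0 ≠ 0 := by
  induction j with
  | zero => simp [lamePoly]
  | succ j ih =>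
    have h1 : theta τ ((m - j) * w) ≠ 0 :=
      theta_ne_zero_of_eq hw (m - j) (by omega) (by push_cast; ring)
    have h2 : theta τ ((2 * m - j) * w) ≠ 0 :=
      theta_ne_zero_of_eq hw (2 * m - j) (by omega) (by push_cast; ring)
    simp [lamePoly, h1, h2, ih (by omega)]

/-- The polynomials in the inverse of the eigenvalue giving the values of a solution. -/
def valuePoly (τ w : ℂ) (m k : ℕ) : ℂ[X] := X ^ k * (lamePoly τ w m (m - k)).1

theorem valuePoly_recurrence (hw : ∀ k : ℤ, k ≠ 0 → theta τ (k * w) ≠ 0) {k : ℕ} (hk : 1 ≤ k)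
    (hkm : k ≤ m) {d : ℂ} (hd : d ≠ 0) :
    theta τ ((k + m) * w) * (valuePoly τ w m (k - 1)).eval d
      + theta τ ((k - m) * w) * (valuePoly τ w m (k + 1)).eval d
      = d⁻¹ * theta τ (k * w) * (valuePoly τ w m k).eval d := by
  obtain ⟨j, rfl⟩ : ∃ j, m = k + j := ⟨m - k, by omega⟩
  obtain ⟨k, rfl⟩ : ∃ k', k = k' + 1 := ⟨k - 1, by omega⟩
  have h2 : theta τ ((2 * ((k + 1 + j : ℕ) : ℂ) - j) * w) ≠ 0 :=
    theta_ne_zero_of_eq hw (2 * (k + 1 + j) - j) (by omega) (by push_cast; ring)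
  rw [valuePoly, valuePoly, valuePoly, Nat.add_sub_cancel,
    show k + 1 + j - k = j + 1 by omega, show k + 1 + j - (k + 1) = j by omega]
  rw [show (((k + 1 : ℕ) : ℂ) + ((k + 1 + j : ℕ) : ℂ)) * w
    = (2 * ((k + 1 + j : ℕ) : ℂ) - j) * w by push_cast; ring]
  rcases j with _ | j
  · simp only [add_zero, sub_self, zero_mul, theta_zero, lamePoly]
    simp only [CharP.cast_eq_zero, sub_zero, add_zero] at h2
    simp
    push_cast at h2
    field_simp
    ring
  · rw [show k + 1 + (j + 1) - (k + 1 + 1) = j by omega,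
      show ((((k + 1 : ℕ) : ℂ) - ((k + 1 + (j + 1) : ℕ) : ℂ)) * w)
        = -((j + 1 : ℕ) : ℂ) * w by push_cast; ring]
    have e : (lamePoly τ w (k + 1 + (j + 1)) (j + 1)).2 = (lamePoly τ w (k + 1 + (j + 1)) j).1 :=
      rfl
    rw [lamePoly, e, show (((k + 1 + (j + 1) : ℕ) : ℂ) - ((j + 1 : ℕ) : ℂ)) * w
      = ((k + 1 : ℕ) : ℂ) * w by push_cast; ring]
    simp only [eval_mul, eval_pow, eval_X, eval_sub, eval_C]
    field_simp
    ring

theorem eval_zero_valuePoly_zero (hw : ∀ k : ℤ, k ≠ 0 → theta τ (k * w) ≠ 0) :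
    (valuePoly τ w m 0).eval 0 ≠ 0 := by
  simpa [valuePoly] using eval_zero_lamePoly_ne_zero hw le_rfl

theorem eval_zero_valuePoly {k : ℕ} (hk : k ≠ 0) : (valuePoly τ w m k).eval 0 = 0 := by
  simp [valuePoly, hk]

end LamePoly

/-- The even theta function of degree `2m` with the values `y k ^ 2` at `k w`; it is the product
`ψ(z) ψ(-z)` of a solution and its reflection. -/
def evenProd (τ w : ℂ) (m : ℕ) (y : ℕ → ℂ) : ℂ → ℂ :=
  interp τ m (fun k => k * w) fun k => y k ^ 2

theorem pairTheta_node_ne_zero {τ w : ℂ} (hw : ∀ k : ℤ, k ≠ 0 → theta τ (k * w) ≠ 0)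
    {i j : ℕ} (hij : i ≠ j) : pairTheta τ (j * w) (i * w) ≠ 0 := by
  rw [pairTheta, ← sub_mul, ← add_mul]
  refine mul_ne_zero (theta_ne_zero_of_eq hw (i - j) (by omega) (by push_cast; ring))
    (theta_ne_zero_of_eq hw (i + j) (by omega) (by push_cast; ring))

/-- The values of y are polynomial in d = 1/ε and at d = 0 only y_0 is nonzero, so the factorization
theorem applies to the squares y_k² at the nodes kw. The excluded ε are 0 and the inverses of the
bad d, including those at which some y_k vanishes. -/
theorem exists_lameSeq {τ : ℂ} (hτ : 0 < τ.im) {w : ℂ}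
    (hw : ∀ k : ℤ, k ≠ 0 → theta τ (k * w) ≠ 0) {m : ℕ} (hm : 1 ≤ m) :
    ∃ F : Set ℂ, F.Finite ∧ ∀ ε, ε ∉ F → ε ≠ 0 ∧ ∃ y : ℕ → ℂ, IsLameSeq τ w m ε y ∧
      ∃ (K : ℂ) (a : Fin m → ℂ), K ≠ 0 ∧ (∀ i, theta τ (2 * a i) ≠ 0) ∧
        (∀ i j, i ≠ j → pairTheta τ (a i) (a j) ≠ 0) ∧
        ∀ z, evenProd τ w m y z = K * ∏ i, pairTheta τ (a i) z := by
  obtain ⟨B, hB, h⟩ := interp_factorization hτ hm (b := fun k => k * w) (by simp)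
    (fun i _ j _ hij => pairTheta_node_ne_zero hw hij)
    (fun j _ hj => by
      rw [← mul_assoc]
      exact theta_ne_zero_of_eq hw (2 * j) (by omega) (by push_cast; ring))
    (fun k => valuePoly τ w m k ^ 2) (by simpa using eval_zero_valuePoly_zero hw)
    (fun i _ hi => by simp [eval_zero_valuePoly hi])
  refine ⟨{0} ∪ Inv.inv '' (B ∪ ⋃ k ∈ Finset.range (m + 1),
    {d : ℂ | (lamePoly τ w m (m - k)).1.eval d = 0}), ?_, fun ε hε => ?_⟩
  · refine (Set.finite_singleton 0).union (Set.Finite.image _ (hB.union ?_))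
    exact Set.Finite.biUnion (Finset.range (m + 1)).finite_toSet fun k _ =>
      finite_eval_eq_zero (eval_zero_lamePoly_ne_zero hw (Nat.sub_le m k))
  · have hε0 : ε ≠ 0 := fun h => hε (Or.inl h)
    have hd : ε⁻¹ ∉ B ∪ ⋃ k ∈ Finset.range (m + 1),
        {d : ℂ | (lamePoly τ w m (m - k)).1.eval d = 0} :=
      fun h => hε (Or.inr ⟨ε⁻¹, h, inv_inv ε⟩)
    rw [Set.mem_union, not_or] at hd
    obtain ⟨K, a, hK, h1, h2, h3⟩ := h ε⁻¹ hd.1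
    refine ⟨hε0, fun k => (valuePoly τ w m k).eval ε⁻¹, ⟨fun k hk hkm => ?_, fun k hk => ?_⟩,
      K, a, hK, h1, h2, fun z => ?_⟩
    · have := valuePoly_recurrence hw hk hkm (inv_ne_zero hε0)
      rwa [inv_inv] at this
    · have : (lamePoly τ w m (m - k)).1.eval ε⁻¹ ≠ 0 := fun h0 => hd.2
        (Set.mem_biUnion (x := k) (by simpa using Nat.lt_succ_of_le hk) h0)
      simp [valuePoly, this, hε0]
    · rw [← h3 z]
      simp [evenProd]

/-- The even extension to `ℤ` of a sequence. -/
def evenExt (y : ℕ → ℂ) (k : ℤ) : ℂ := y k.natAbs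

theorem evenExt_neg (y : ℕ → ℂ) (k : ℤ) : evenExt y (-k) = evenExt y k := by
  simp [evenExt]

theorem evenExt_natCast (y : ℕ → ℂ) (k : ℕ) : evenExt y k = y k := by simp [evenExt]

section Setup

variable {τ w ε : ℂ} {m : ℕ} {y : ℕ → ℂ}

theorem IsLameSeq.evenExt_ne_zero (h : IsLameSeq τ w m ε y) {k : ℤ} (h1 : -m ≤ k) (h2 : k ≤ m) :
    evenExt y k ≠ 0 := h.ne_zero _ (by omega)

/-- Oddness of θ exchanges the two terms under k ↦ -k, and k = 0 is automatic for an even sequence.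
At k = ±m the value outside the range has coefficient zero. -/
theorem IsLameSeq.recurrence_int (h : IsLameSeq τ w m ε y) {k : ℤ} (h1 : -m ≤ k) (h2 : k ≤ m) :
    theta τ ((k + m) * w) * evenExt y (k - 1) + theta τ ((k - m) * w) * evenExt y (k + 1)
      = ε * theta τ (k * w) * evenExt y k := by
  have key : ∀ k : ℕ, 1 ≤ k → k ≤ m → theta τ (((k : ℤ) + m) * w) * evenExt y (k - 1)
      + theta τ (((k : ℤ) - m) * w) * evenExt y (k + 1)
      = ε * theta τ ((k : ℤ) * w) * evenExt y k := by
    intro k hk hkm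
    have := h.recurrence k hk hkm
    rw [evenExt_natCast, show ((k : ℤ) - 1) = ((k - 1 : ℕ) : ℤ) by omega, evenExt_natCast,
      show ((k : ℤ) + 1) = ((k + 1 : ℕ) : ℤ) by omega, evenExt_natCast]
    exact_mod_cast this
  rcases lt_trichotomy k 0 with hk | hk | hk
  · obtain ⟨j, rfl⟩ : ∃ j : ℕ, k = -(j : ℤ) := ⟨k.natAbs, by omega⟩
    have := key j (by omega) (by omega)
    rw [show (-(j : ℤ) - 1) = -((j : ℤ) + 1) by ring, show (-(j : ℤ) + 1) = -((j : ℤ) - 1) by ring,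
      evenExt_neg, evenExt_neg, evenExt_neg]
    rw [show ((-(j : ℤ) : ℤ) : ℂ) + m = -(((j : ℤ) : ℂ) - m) by push_cast; ring,
      show ((-(j : ℤ) : ℤ) : ℂ) - m = -(((j : ℤ) : ℂ) + m) by push_cast; ring, Int.cast_neg]
    simp only [neg_mul, theta_neg]
    linear_combination -this
  · subst hk
    rw [zero_sub, zero_add, evenExt_neg, Int.cast_zero, zero_add, zero_sub, neg_mul, theta_neg,
      zero_mul, theta_zero]
    ring
  · obtain ⟨j, rfl⟩ : ∃ j : ℕ, k = (j : ℤ) := ⟨k.natAbs, by omega⟩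
    exact key j (by omega) (by omega)

theorem theta_int_sub_ne_zero (hw : ∀ k : ℤ, k ≠ 0 → theta τ (k * w) ≠ 0) {i j : ℤ} (hij : i ≠ j) :
    theta τ (i * w - j * w) ≠ 0 := by
  rw [← sub_mul]
  exact theta_ne_zero_of_eq hw (i - j) (sub_ne_zero.mpr hij) (by push_cast; ring)

/-! ### The function `ψ(z) ψ(-z)` -/

theorem isTheta_evenProd (hτ : 0 < τ.im) :
    IsTheta τ (2 * m) 1 (kap τ ^ (2 * m)) (evenProd τ w m y) := isTheta_interp hτ _ _ _

theorem evenProd_neg (z : ℂ) : evenProd τ w m y (-z) = evenProd τ w m y z := interp_neg _ _ _ _ _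

theorem evenProd_int (hw : ∀ k : ℤ, k ≠ 0 → theta τ (k * w) ≠ 0) {k : ℤ} (h1 : -m ≤ k)
    (h2 : k ≤ m) : evenProd τ w m y (k * w) = evenExt y k ^ 2 := by
  have key : ∀ k : ℕ, k ≤ m → evenProd τ w m y (k * w) = y k ^ 2 := fun k hk =>
    interp_node (b := fun k => k * w) (fun k => y k ^ 2)
      (fun i _ j _ hij => pairTheta_node_ne_zero hw hij) hk
  rcases le_total 0 k with hk | hk
  · obtain ⟨j, rfl⟩ : ∃ j : ℕ, k = (j : ℤ) := ⟨k.natAbs, by omega⟩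
    rw [evenExt_natCast, ← key j (by omega)]
    norm_cast
  · obtain ⟨j, rfl⟩ : ∃ j : ℕ, k = -(j : ℤ) := ⟨k.natAbs, by omega⟩
    rw [evenExt_neg, evenExt_natCast, ← key j (by omega), ← evenProd_neg]
    push_cast
    ring_nf

/-- Agreement at the 2m + 1 points kw exceeds the degree 2m, so evenness of G need not be assumed.
-/
theorem eq_evenProd (hτ : 0 < τ.im) (hw : ∀ k : ℤ, k ≠ 0 → theta τ (k * w) ≠ 0) {G : ℂ → ℂ}
    (hG : IsTheta τ (2 * m) 1 (kap τ ^ (2 * m)) G)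
    (h : ∀ k : ℤ, -m ≤ k → k ≤ m → G (k * w) = evenExt y k ^ 2) (z : ℂ) :
    G z = evenProd τ w m y z := by
  refine sub_eq_zero.mp ((hG.sub (isTheta_evenProd hτ)).eq_zero_of_card_lt hτ
    (s := Finset.Icc (-m : ℤ) m) (a := fun k => k * w)
    (fun i _ j _ hij => theta_int_sub_ne_zero hw hij) one_ne_zero
    (pow_ne_zero _ (kap_ne_zero τ)) ?_ ?_ z)
  · intro k hk
    rw [Finset.mem_Icc] at hk
    rw [h k hk.1 hk.2, evenProd_int hw hk.1 hk.2, sub_self]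
  · rw [Int.card_Icc]
    omega

/-! ### The Wronskian of two solutions -/

/-- The function `∏ θ(z + k w)`, `-m < k ≤ m`, proportional to the Wronskian of two solutions. -/
def wronskD (τ w : ℂ) (m : ℕ) (z : ℂ) : ℂ := ∏ k ∈ Finset.Ioc (-m : ℤ) m, theta τ (z + k * w)

/-- The multiplier of `wronskD`. -/
def wronskMul (τ w : ℂ) (m : ℕ) : ℂ := kap τ ^ (2 * m) * cexp (-(2 * Real.pi * I * (m * w)))

theorem wronskMul_ne_zero : wronskMul τ w m ≠ 0 :=
  mul_ne_zero (pow_ne_zero _ (kap_ne_zero τ)) (exp_ne_zero _)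

theorem sum_Ioc_int (m : ℕ) : ∑ k ∈ Finset.Ioc (-m : ℤ) m, (k : ℂ) = m := by
  have h : ∑ k ∈ Finset.Ioc (-m : ℤ) m, (k : ℂ) = ∑ k ∈ Finset.Ioc (-m : ℤ) m, (1 - (k : ℂ)) := by
    refine Finset.sum_nbij' (fun k => 1 - k) (fun k => 1 - k) ?_ ?_ ?_ ?_ ?_
    · intro k hk; rw [Finset.mem_Ioc] at hk ⊢; omega
    · intro k hk; rw [Finset.mem_Ioc] at hk ⊢; omega
    · intro k _; ring
    · intro k _; ring
    · intro k _; push_cast; ring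
  rw [Finset.sum_sub_distrib, Finset.sum_const, Int.card_Ioc,
    show ((m : ℤ) - -m).toNat = 2 * m by omega] at h
  simp only [nsmul_eq_mul, mul_one] at h
  push_cast at h
  linear_combination h / 2

theorem isTheta_wronskD (hτ : 0 < τ.im) :
    IsTheta τ (2 * m) 1 (wronskMul τ w m) (wronskD τ w m) := by
  have h := IsTheta.prod_theta hτ (Finset.Ioc (-m : ℤ) m) fun k => k * w
  rw [Int.card_Ioc, show ((m : ℤ) - -m).toNat = 2 * m by omega, ← Finset.sum_mul,
    sum_Ioc_int] at h
  exact h.congr (by simp [pow_mul]) rfl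

theorem wronskD_eq_zero {z : ℂ} (h : wronskD τ w m z = 0) :
    ∃ k : ℤ, -m < k ∧ k ≤ m ∧ theta τ (z + k * w) = 0 := by
  obtain ⟨k, hk, h0⟩ := Finset.prod_eq_zero_iff.mp h
  rw [Finset.mem_Ioc] at hk
  exact ⟨k, hk.1, hk.2, h0⟩

theorem wronskD_int {k : ℤ} (h1 : -m ≤ k) (h2 : k < m) : wronskD τ w m (k * w) = 0 := by
  refine Finset.prod_eq_zero (i := -k) (by rw [Finset.mem_Ioc]; omega) ?_
  rw [show (k : ℂ) * w + ((-k : ℤ) : ℂ) * w = 0 by push_cast; ring, theta_zero]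

theorem exists_wronskD_ne_zero (hτ : 0 < τ.im) : ∃ z, wronskD τ w m z ≠ 0 := by
  obtain ⟨z₁, hz₁⟩ := (isSigma_theta hτ).exists_ne_zero
  refine exists_prod_ne_zero_entire _ (f := fun (k : ℤ) z => theta τ (z + k * w))
    (fun k _ => (theta_differentiable hτ).comp (differentiable_id.add_const _))
    fun k _ => ⟨z₁ - k * w, by simpa using hz₁⟩

/-- The product `∏ θ(z + k w)`, `-m ≤ k ≤ m`. -/
def symmProd (τ w : ℂ) (m : ℕ) (z : ℂ) : ℂ := ∏ k ∈ Finset.Icc (-m : ℤ) m, theta τ (z + k * w)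

theorem symmProd_eq (z : ℂ) :
    symmProd τ w m z = theta τ (z - m * w) * wronskD τ w m z := by
  rw [symmProd, ← Finset.Ioc_insert_left (show (-m : ℤ) ≤ m by omega),
    Finset.prod_insert (by simp), wronskD]
  congr 2
  push_cast
  ring

theorem symmProd_eq' (z : ℂ) :
    symmProd τ w m z = theta τ (z + m * w) * wronskD τ w m (z - w) := by
  rw [symmProd, ← Finset.Ico_insert_right (show (-m : ℤ) ≤ m by omega),
    Finset.prod_insert (by simp), wronskD]
  congr 1
  refine Finset.prod_nbij' (fun k => k + 1) (fun k => k - 1) ?_ ?_ ?_ ?_ ?_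
  · intro k hk; rw [Finset.mem_Ico] at hk; rw [Finset.mem_Ioc]; omega
  · intro k hk; rw [Finset.mem_Ioc] at hk; rw [Finset.mem_Ico]; omega
  · intro k _; ring
  · intro k _; ring
  · intro k _; congr 1; push_cast; ring

/-- Both sides are the symmetric product over -m ≤ k ≤ m. It is the first-order equation satisfied
by the Wronskian of two solutions of `LameEq`. -/
theorem wronskD_shift (z : ℂ) : theta τ (z + m * w) * wronskD τ w m (z - w)
    = theta τ (z - m * w) * wronskD τ w m z := by
  rw [← symmProd_eq, symmProd_eq']

theorem wronskD_symm (z : ℂ) : wronskD τ w m (-z - w) = wronskD τ w m z := by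
  have h : wronskD τ w m (-z - w) = ∏ k ∈ Finset.Ioc (-m : ℤ) m, -theta τ (z + k * w) := by
    refine Finset.prod_nbij' (fun k => 1 - k) (fun k => 1 - k) ?_ ?_ ?_ ?_ ?_
    · intro k hk; rw [Finset.mem_Ioc] at hk ⊢; omega
    · intro k hk; rw [Finset.mem_Ioc] at hk ⊢; omega
    · intro k _; ring
    · intro k _; ring
    · intro k _; rw [← theta_neg]; congr 1; push_cast; ring
  rw [h, Finset.prod_neg, Int.card_Ioc, show ((m : ℤ) - -m).toNat = 2 * m by omega, pow_mul,
    neg_one_sq, one_pow, one_mul, wronskD]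

theorem isTheta_symmProd (hτ : 0 < τ.im) :
    IsTheta τ (2 * m + 1) (-1) (kap τ ^ (2 * m + 1)) (symmProd τ w m) := by
  have h := ((IsTheta.of_theta hτ).shift (-(m * w))).mul (isTheta_wronskD (w := w) (m := m) hτ)
  rw [add_comm 1] at h
  have e : symmProd τ w m = fun z => theta τ (z + -(m * w)) * wronskD τ w m z := by
    funext z
    rw [symmProd_eq, sub_eq_add_neg]
  rw [e]
  refine h.congr (by ring) ?_
  have : cexp (-(2 * Real.pi * I * (1 : ℕ) * -(m * w))) * cexp (-(2 * Real.pi * I * (m * w)))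
      = 1 := by
    rw [← Complex.exp_add]; simp
  rw [wronskMul]
  linear_combination kap τ ^ (2 * m + 1) * this

theorem symmProd_int {k : ℤ} (h1 : -m ≤ k) (h2 : k ≤ m) : symmProd τ w m (k * w) = 0 := by
  refine Finset.prod_eq_zero (i := -k) (by rw [Finset.mem_Icc]; omega) ?_
  rw [show (k : ℂ) * w + ((-k : ℤ) : ℂ) * w = 0 by push_cast; ring, theta_zero]

theorem symmProd_neg (z : ℂ) : symmProd τ w m (-z) = -symmProd τ w m z := by
  rw [symmProd_eq, symmProd_eq', show -z - m * w = -(z + m * w) by ring, theta_neg,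
    show -z = -(z - w) - w by ring, wronskD_symm]
  ring

theorem exists_symmProd_ne_zero (hτ : 0 < τ.im) : ∃ z, symmProd τ w m z ≠ 0 := by
  obtain ⟨z₁, hz₁⟩ := (isSigma_theta hτ).exists_ne_zero
  refine exists_prod_ne_zero_entire _ (f := fun (k : ℤ) z => theta τ (z + k * w))
    (fun k _ => (theta_differentiable hτ).comp (differentiable_id.add_const _))
    fun k _ => ⟨z₁ - k * w, by simpa using hz₁⟩

/-! ### The function `ψ(z) ψ(-z - w) + ψ(z + w) ψ(-z)` -/

/-- `s` is the function `ψ(z) ψ(-z - w) + ψ(z + w) ψ(-z)` attached to the solution `ψ` with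
the values `y`. -/
structure IsTrace (τ w : ℂ) (m : ℕ) (ε : ℂ) (y : ℕ → ℂ) (s : ℂ → ℂ) : Prop where
  isTheta : IsTheta τ (2 * m) 1 (wronskMul τ w m) s
  symm : ∀ z, s (-z - w) = s z
  map_int : ∀ k : ℤ, -m ≤ k → k < m → s (k * w) = 2 * evenExt y k * evenExt y (k + 1)
  eqn : ∀ z, theta τ (z + m * w) * s (z - w) + theta τ (z - m * w) * s z
    = 2 * ε * theta τ z * evenProd τ w m y z

theorem theta_exists_two_ne_zero (hτ : 0 < τ.im) :
    ∃ z, theta τ (z - m * w) * wronskD τ w m z ≠ 0 := by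
  obtain ⟨z, hz⟩ := exists_symmProd_ne_zero (w := w) (m := m) hτ
  exact ⟨z, by rwa [← symmProd_eq]⟩

/-- The prescribed values at 2m points determine s up to a multiple of D. The equation fixes that
multiple, because D contributes twice `symmProd` to its left-hand side. -/
theorem IsTrace.unique (hτ : 0 < τ.im) (hw : ∀ k : ℤ, k ≠ 0 → theta τ (k * w) ≠ 0)
    {s s' : ℂ → ℂ} (h : IsTrace τ w m ε y s) (h' : IsTrace τ w m ε y s') (z : ℂ) : s z = s' z := by
  obtain ⟨z₁, hz₁⟩ := exists_wronskD_ne_zero (w := w) (m := m) hτ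
  obtain ⟨r, hr⟩ := (h.isTheta.sub h'.isTheta).eq_const_mul_of_zeros hτ
    (s := Finset.Ico (-m : ℤ) m) (a := fun k => k * w)
    (fun i _ j _ hij => theta_int_sub_ne_zero hw hij) one_ne_zero wronskMul_ne_zero
    (isTheta_wronskD (w := w) hτ)
    (fun k hk => by
      rw [Finset.mem_Ico] at hk
      rw [h.map_int k hk.1 hk.2, h'.map_int k hk.1 hk.2, sub_self])
    (fun k hk => by
      rw [Finset.mem_Ico] at hk
      exact wronskD_int hk.1 hk.2)
    (by rw [Int.card_Ico]; omega) hz₁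
  obtain ⟨x, hx⟩ := theta_exists_two_ne_zero (w := w) (m := m) hτ
  have hr0 : r = 0 := by
    have e1 := h.eqn x
    have e2 := h'.eqn x
    have e3 := wronskD_shift (τ := τ) (w := w) (m := m) x
    have e4 := hr x
    have e5 := hr (x - w)
    have : r * (theta τ (x - m * w) * wronskD τ w m x) = 0 := by
      linear_combination (1 / 2) * (e1 - e2 - theta τ (x + m * w) * e5
        - theta τ (x - m * w) * e4 - r * e3)
    exact (mul_eq_zero.mp this).resolve_right hx
  have := hr z
  rw [hr0, zero_mul] at this
  exact sub_eq_zero.mp this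

end Setup

/-! ### Existence of the trace and its discriminant -/

section Setup

variable {τ w ε : ℂ} {m : ℕ} {y : ℕ → ℂ}

theorem exp_cancel {a b : ℂ} (h : a + b = 0) : cexp a * cexp b = 1 := by
  rw [← Complex.exp_add, h, Complex.exp_zero]

/-- The terms of the equation of a trace are theta functions with the multipliers of
`symmProd`. -/
theorem isTheta_trace_terms (hτ : 0 < τ.im) {s : ℂ → ℂ}
    (hs : IsTheta τ (2 * m) 1 (wronskMul τ w m) s) :
    IsTheta τ (2 * m + 1) (-1) (kap τ ^ (2 * m + 1)) (fun z => theta τ (z + m * w) * s (z - w)) ∧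
    IsTheta τ (2 * m + 1) (-1) (kap τ ^ (2 * m + 1)) (fun z => theta τ (z - m * w) * s z) := by
  have hθ := IsTheta.of_theta hτ
  constructor
  · have h := (hθ.shift (m * w)).mul (hs.shift (-w))
    simp only [← sub_eq_add_neg] at h
    rw [add_comm 1] at h
    refine h.congr (by ring) ?_
    rw [wronskMul]
    have h1 : cexp (-(2 * Real.pi * I * (1 : ℕ) * (m * w))) * (cexp (-(2 * Real.pi * I * (m * w)))
        * cexp (-(2 * Real.pi * I * (2 * m : ℕ) * -w))) = 1 := by
      rw [← Complex.exp_add]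
      exact exp_cancel (by push_cast; ring)
    linear_combination kap τ ^ (2 * m + 1) * h1
  · have h := (hθ.shift (-(m * w))).mul hs
    simp only [← sub_eq_add_neg] at h
    rw [add_comm 1] at h
    refine h.congr (by ring) ?_
    rw [wronskMul]
    have h1 : cexp (-(2 * Real.pi * I * (1 : ℕ) * -(m * w))) * cexp (-(2 * Real.pi * I * (m * w)))
        = 1 := exp_cancel (by push_cast; ring)
    linear_combination kap τ ^ (2 * m + 1) * h1

theorem exists_isTrace (hτ : 0 < τ.im) (hw : ∀ k : ℤ, k ≠ 0 → theta τ (k * w) ≠ 0)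
    (hy : IsLameSeq τ w m ε y) : ∃ s, IsTrace τ w m ε y s := by
  -- The symmetry z ↦ -z - w is evenness in z + w/2, so s₀ is interpolated at half-integral nodes.
  -- The last value 2 y_m y_{m+1} is arbitrary: it is the freedom of adding a multiple of D.
  set b : ℕ → ℂ := fun k => (k + 1 / 2) * w with hb
  set s₀ : ℂ → ℂ := fun z => interp τ m b (fun k => 2 * y k * y (k + 1)) (z + w / 2) with hs₀
  have hbne : ∀ i ≤ m, ∀ j ≤ m, i ≠ j → pairTheta τ (b j) (b i) ≠ 0 := by
    intro i _ j _ hij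
    simp only [hb, pairTheta]
    rw [← sub_mul, ← add_mul]
    exact mul_ne_zero (theta_ne_zero_of_eq hw (i - j) (by omega) (by push_cast; ring))
      (theta_ne_zero_of_eq hw (i + j + 1) (by omega) (by push_cast; ring))
  have hT : IsTheta τ (2 * m) 1 (wronskMul τ w m) s₀ := by
    refine ((isTheta_interp hτ m b _).shift (w / 2)).congr rfl ?_
    rw [wronskMul]
    congr 2
    push_cast
    ring
  have hsymm : ∀ z, s₀ (-z - w) = s₀ z := by
    intro z
    simp only [hs₀]
    rw [show -z - w + w / 2 = -(z + w / 2) by ring, interp_neg]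
  have hnat : ∀ k : ℕ, k ≤ m → s₀ (k * w) = 2 * y k * y (k + 1) := by
    intro k hk
    simp only [hs₀]
    rw [show (k : ℂ) * w + w / 2 = b k by simp only [hb]; ring, interp_node _ hbne hk]
  have hint : ∀ k : ℤ, -m ≤ k → k < m → s₀ (k * w) = 2 * evenExt y k * evenExt y (k + 1) := by
    intro k h1 h2
    rcases le_or_gt 0 k with hk | hk
    · obtain ⟨j, rfl⟩ : ∃ j : ℕ, k = (j : ℤ) := ⟨k.natAbs, by omega⟩
      have := hnat j (by omega)
      rw [evenExt_natCast, show ((j : ℤ) + 1) = ((j + 1 : ℕ) : ℤ) by push_cast; ring,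
        evenExt_natCast, ← this]
      norm_cast
    · obtain ⟨j, rfl⟩ : ∃ j : ℕ, k = -((j + 1 : ℕ) : ℤ) := ⟨(-k - 1).natAbs, by omega⟩
      have := hnat j (by omega)
      rw [evenExt_neg, evenExt_natCast,
        show -((j + 1 : ℕ) : ℤ) + 1 = -(j : ℤ) by push_cast; ring, evenExt_neg, evenExt_natCast,
        ← hsymm, show -(((-((j + 1 : ℕ) : ℤ) : ℤ) : ℂ) * w) - w = j * w by push_cast; ring, this]
      ring
  obtain ⟨hT1, hT2⟩ := isTheta_trace_terms hτ hT
  have hT3 : IsTheta τ (2 * m + 1) (-1) (kap τ ^ (2 * m + 1))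
      fun z => 2 * ε * (theta τ z * evenProd τ w m y z) := by
    have h := (IsTheta.of_theta hτ).mul (isTheta_evenProd (w := w) (m := m) (y := y) hτ)
    rw [add_comm 1] at h
    exact (h.congr (by ring) (by ring)).const_mul _
  obtain ⟨x, hx⟩ := exists_symmProd_ne_zero (w := w) (m := m) hτ
  obtain ⟨r, hr⟩ := ((hT1.add hT2).sub hT3).eq_const_mul_of_zeros hτ
    (s := Finset.Icc (-m : ℤ) m) (a := fun k => k * w)
    (fun i _ j _ hij => theta_int_sub_ne_zero hw hij) (by norm_num)
    (pow_ne_zero _ (kap_ne_zero τ)) (isTheta_symmProd (w := w) hτ)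
    (fun k hk => by
      rw [Finset.mem_Icc] at hk
      have h1 : theta τ (k * w + m * w) * s₀ (k * w - w)
          = theta τ ((k + m) * w) * (2 * evenExt y (k - 1) * evenExt y k) := by
        rw [← add_mul]
        rcases eq_or_lt_of_le hk.1 with h | h
        · rw [← h]
          simp [theta_zero]
        · have := hint (k - 1) (by omega) (by omega)
          rw [sub_add_cancel] at this
          rw [← this]
          push_cast
          ring_nf
      have h2 : theta τ (k * w - m * w) * s₀ (k * w)
          = theta τ ((k - m) * w) * (2 * evenExt y k * evenExt y (k + 1)) := by
        rw [← sub_mul]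
        rcases eq_or_lt_of_le hk.2 with h | h
        · rw [h]
          simp [theta_zero]
        · rw [hint k (by omega) h]
      rw [h1, h2, evenProd_int hw hk.1 hk.2]
      have := hy.recurrence_int hk.1 hk.2
      linear_combination 2 * evenExt y k * this)
    (fun k hk => by
      rw [Finset.mem_Icc] at hk
      exact symmProd_int hk.1 hk.2)
    (by rw [Int.card_Icc]; omega) hx
  -- The defect of the equation for s₀ vanishes at kw for |k| ≤ m, so it equals r times `symmProd`.
  -- Subtracting (r/2) D removes it and preserves the symmetry and the prescribed values.
  refine ⟨fun z => s₀ z - r / 2 * wronskD τ w m z,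
    hT.sub ((isTheta_wronskD hτ).const_mul _), fun z => ?_, fun k h1 h2 => ?_, fun z => ?_⟩
  · rw [hsymm, wronskD_symm]
  · rw [hint k h1 h2, wronskD_int h1 h2]
    ring
  · have e1 := hr z
    have e2 := symmProd_eq (τ := τ) (w := w) (m := m) z
    have e3 := symmProd_eq' (τ := τ) (w := w) (m := m) z
    linear_combination e1 + r / 2 * e2 + r / 2 * e3

/-- The second difference equation relating a trace to the product `ψ(z) ψ(-z)`. -/
theorem IsTrace.eqn_diff (hτ : 0 < τ.im) (hw : ∀ k : ℤ, k ≠ 0 → theta τ (k * w) ≠ 0)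
    (hy : IsLameSeq τ w m ε y) {s : ℂ → ℂ} (hs : IsTrace τ w m ε y s) (z : ℂ) :
    ε * theta τ z * (theta τ (z + m * w) * s (z - w) - theta τ (z - m * w) * s z)
      = 2 * (theta τ (z + m * w) ^ 2 * evenProd τ w m y (z - w)
        - theta τ (z - m * w) ^ 2 * evenProd τ w m y (z + w)) := by
  set E : ℂ → ℂ := fun z => ε * (theta τ z * (theta τ (z + m * w) * s (z - w)
    - theta τ (z - m * w) * s z)) - 2 * (theta τ (z + m * w) ^ 2 * evenProd τ w m y (z - w)
        - theta τ (z - m * w) ^ 2 * evenProd τ w m y (z + w)) with hE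
  have hk := kap_ne_zero τ
  have hθ := IsTheta.of_theta hτ
  have hΦ := isTheta_evenProd (w := w) (m := m) (y := y) hτ
  obtain ⟨hT1, hT2⟩ := isTheta_trace_terms hτ hs.isTheta
  have hT3 : IsTheta τ (2 * m + 1 + 1) 1 (kap τ ^ (2 * m + 2)) fun z =>
      theta τ (z + m * w) ^ 2 * evenProd τ w m y (z - w) := by
    have h := ((hθ.shift (m * w)).mul (hθ.shift (m * w))).mul (hΦ.shift (-w))
    simp only [← sub_eq_add_neg, ← sq] at h
    rw [show 1 + 1 + 2 * m = 2 * m + 1 + 1 by ring] at h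
    refine h.congr (by norm_num) ?_
    have h1 : cexp (-(2 * Real.pi * I * (1 : ℕ) * (m * w))) *
        (cexp (-(2 * Real.pi * I * (1 : ℕ) * (m * w)))
        * cexp (-(2 * Real.pi * I * (2 * m : ℕ) * -w))) = 1 := by
      rw [← Complex.exp_add]
      exact exp_cancel (by push_cast; ring)
    linear_combination kap τ ^ (2 * m + 2) * h1
  have hT4 : IsTheta τ (2 * m + 1 + 1) 1 (kap τ ^ (2 * m + 2)) fun z =>
      theta τ (z - m * w) ^ 2 * evenProd τ w m y (z + w) := by
    have h := ((hθ.shift (-(m * w))).mul (hθ.shift (-(m * w)))).mul (hΦ.shift w)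
    simp only [← sub_eq_add_neg, ← sq] at h
    rw [show 1 + 1 + 2 * m = 2 * m + 1 + 1 by ring] at h
    refine h.congr (by norm_num) ?_
    have h1 : cexp (-(2 * Real.pi * I * (1 : ℕ) * -(m * w))) *
        (cexp (-(2 * Real.pi * I * (1 : ℕ) * -(m * w)))
        * cexp (-(2 * Real.pi * I * (2 * m : ℕ) * w))) = 1 := by
      rw [← Complex.exp_add]
      exact exp_cancel (by push_cast; ring)
    linear_combination kap τ ^ (2 * m + 2) * h1
  have hT5 : IsTheta τ (2 * m + 1 + 1) 1 (kap τ ^ (2 * m + 2)) fun z =>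
      theta τ z * (theta τ (z + m * w) * s (z - w) - theta τ (z - m * w) * s z) := by
    have h := hθ.mul (hT1.sub hT2)
    rw [add_comm 1] at h
    exact h.congr (by norm_num) (by ring)
  have hET : IsTheta τ (2 * m + 1 + 1) 1 (kap τ ^ (2 * m + 2)) E :=
    (hT5.const_mul ε).sub ((hT3.sub hT4).const_mul 2)
  -- At z = kw, write the recurrence as A + B = εθ(kw) y_k. The claim then becomes εθ(kw) y_k (A -
  -- B) = A² - B², up to the factor 2.
  have hE0 : ∀ k : ℤ, -m ≤ k → k ≤ m → E (k * w) = 0 := by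
    intro k hk1 hk2
    have a1 : theta τ (k * w + m * w) * s (k * w - w)
        = theta τ ((k + m) * w) * (2 * evenExt y (k - 1) * evenExt y k) := by
      rw [← add_mul]
      rcases eq_or_lt_of_le hk1 with h | h
      · rw [← h]
        simp [theta_zero]
      · have := hs.map_int (k - 1) (by omega) (by omega)
        rw [sub_add_cancel] at this
        rw [← this]
        push_cast
        ring_nf
    have a2 : theta τ (k * w - m * w) * s (k * w)
        = theta τ ((k - m) * w) * (2 * evenExt y k * evenExt y (k + 1)) := by
      rw [← sub_mul]
      rcases eq_or_lt_of_le hk2 with h | h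
      · rw [h]
        simp [theta_zero]
      · rw [hs.map_int k (by omega) h]
    have a3 : theta τ (k * w + m * w) ^ 2 * evenProd τ w m y (k * w - w)
        = theta τ ((k + m) * w) ^ 2 * evenExt y (k - 1) ^ 2 := by
      rw [← add_mul]
      rcases eq_or_lt_of_le hk1 with h | h
      · rw [← h]
        simp [theta_zero]
      · have := evenProd_int (y := y) (m := m) hw (k := k - 1) (by omega) (by omega)
        rw [← this]
        push_cast
        ring_nf
    have a4 : theta τ (k * w - m * w) ^ 2 * evenProd τ w m y (k * w + w)
        = theta τ ((k - m) * w) ^ 2 * evenExt y (k + 1) ^ 2 := by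
      rw [← sub_mul]
      rcases eq_or_lt_of_le hk2 with h | h
      · rw [h]
        simp [theta_zero]
      · have := evenProd_int (y := y) (m := m) hw (k := k + 1) (by omega) (by omega)
        rw [← this]
        push_cast
        ring_nf
    simp only [hE]
    rw [a1, a2, a3, a4]
    have := hy.recurrence_int hk1 hk2
    linear_combination (-2) * (theta τ ((k + m) * w) * evenExt y (k - 1)
      - theta τ ((k - m) * w) * evenExt y (k + 1)) * this
  have hEodd : ∀ z, E (-z) = -E z := by
    intro z
    have b1 : s (-z - w) = s z := hs.symm z
    have b2 : s (-z) = s (z - w) := by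
      rw [← hs.symm (z - w)]
      congr 1
      ring
    have b3 : evenProd τ w m y (-z - w) = evenProd τ w m y (z + w) := by
      rw [← evenProd_neg]; congr 1; ring
    have b4 : evenProd τ w m y (-z + w) = evenProd τ w m y (z - w) := by
      rw [← evenProd_neg]; congr 1; ring
    simp only [hE]
    rw [b1, b2, b3, b4, show -z + m * w = -(z - m * w) by ring,
      show -z - m * w = -(z + m * w) by ring]
    simp only [theta_neg]
    ring
  have hcard : (Finset.Icc (-m : ℤ) m).card = 2 * m + 1 := by
    rw [Int.card_Icc]; omega
  obtain ⟨h, α', β', hα', hβ', hh, hEh⟩ := IsTheta.exists_prod_mul hτ (Finset.Icc (-m : ℤ) m)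
    (fun k => -(k * w)) (n := 1) (α := 1) (β := kap τ ^ (2 * m + 2)) (g := E)
    (fun i _ j _ hij => by
      rw [show -((i : ℂ) * w) - -(j * w) = j * w - i * w by ring]
      exact theta_int_sub_ne_zero hw hij.symm)
    one_ne_zero (pow_ne_zero _ hk) (by rw [hcard, add_comm 1]; exact hET)
    (fun k hk => by
      rw [Finset.mem_Icc] at hk
      have := hE0 (-k) (by omega) (by omega)
      rwa [Int.cast_neg, neg_mul] at this)
  simp only [sub_neg_eq_add] at hEh
  obtain ⟨x, hx⟩ := exists_symmProd_ne_zero (w := w) (m := m) hτ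
  have hh1 : IsTheta τ 1 (-1) (kap τ) h := by
    refine (isTheta_symmProd (w := w) (m := m) hτ).of_mul (by norm_num) (pow_ne_zero _ hk) hx
      hh.diff ?_
    have e : (fun z => symmProd τ w m z * h z) = E := funext fun z => (hEh z).symm
    rw [e]
    exact hET.congr (by norm_num) (by ring)
  -- Hence E is a multiple of θ times `symmProd`, a product of two odd functions. Being itself odd,
  -- E vanishes.
  obtain ⟨C, hC⟩ := (isSigma_theta hτ).eq_const_mul hτ hh1
  have e1 : E z = symmProd τ w m z * (C * theta τ z) := by rw [hEh, hC, symmProd]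
  have e2 : E (-z) = symmProd τ w m (-z) * (C * theta τ (-z)) := by rw [hEh, hC, symmProd]
  rw [hEodd, symmProd_neg, theta_neg] at e2
  have e3 : E z = 0 := by linear_combination (1 / 2) * e1 - (1 / 2) * e2
  simp only [hE] at e3
  linear_combination e3

/-- The discriminant relation. -/
theorem IsTrace.exists_sq (hτ : 0 < τ.im) (hw : ∀ k : ℤ, k ≠ 0 → theta τ (k * w) ≠ 0)
    (hy : IsLameSeq τ w m ε y) {s : ℂ → ℂ} (hs : IsTrace τ w m ε y s) :
    ∃ C : ℂ, ∀ z, s z ^ 2 - 4 * (evenProd τ w m y z * evenProd τ w m y (z + w))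
      = C ^ 2 * wronskD τ w m z ^ 2 := by
  have hD := isTheta_wronskD (w := w) (m := m) hτ
  have hΦ := isTheta_evenProd (w := w) (m := m) (y := y) hτ
  have hμ := wronskMul_ne_zero (τ := τ) (w := w) (m := m)
  set Q : ℂ → ℂ := fun z => s z ^ 2 - 4 * (evenProd τ w m y z * evenProd τ w m y (z + w)) with hQ
  have hDD : IsTheta τ (2 * m + 2 * m) (1 * 1) (wronskMul τ w m * wronskMul τ w m)
      fun z => wronskD τ w m z ^ 2 := by
    have := hD.mul hD
    simpa only [← sq] using this
  have hQT : IsTheta τ (2 * m + 2 * m) (1 * 1) (wronskMul τ w m * wronskMul τ w m) Q := by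
    have h1 := hs.isTheta.mul hs.isTheta
    simp only [← sq (s _)] at h1
    refine h1.sub (IsTheta.const_mul ((hΦ.mul (hΦ.shift w)).congr rfl ?_) 4)
    rw [wronskMul]
    have : cexp (-(2 * Real.pi * I * (2 * m : ℕ) * w))
        = cexp (-(2 * Real.pi * I * (m * w))) * cexp (-(2 * Real.pi * I * (m * w))) := by
      rw [← Complex.exp_add]; congr 1; push_cast; ring
    rw [this]
    ring
  -- The two relations give the sum and the difference of θ(z+mw)s(z-w) and θ(z-mw)s(z); their
  -- product is a difference of squares. By `wronskD_shift` the function D² satisfies the same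
  -- equation, so Q/D² is w-periodic.
  have hrel : ∀ z, theta τ (z + m * w) ^ 2 * Q (z - w) = theta τ (z - m * w) ^ 2 * Q z := by
    intro z
    have e1 := hs.eqn z
    have e2 := hs.eqn_diff hτ hw hy z
    simp only [hQ, sub_add_cancel]
    linear_combination (theta τ (z + m * w) * s (z - w) - theta τ (z - m * w) * s z) * e1
      + 2 * evenProd τ w m y z * e2
  obtain ⟨x, hx⟩ := exists_wronskD_ne_zero (w := w) (m := m) hτ
  obtain ⟨z₁, hz₁⟩ := (isSigma_theta hτ).exists_ne_zero
  have hθ := theta_differentiable hτ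
  have hQd := hQT.diff
  have hDd := hD.diff
  obtain ⟨c, hc⟩ := hQT.eq_const_mul_of_translation hτ hw (by norm_num) (mul_ne_zero hμ hμ) hDD
    (z₀ := x) (pow_ne_zero 2 hx) (fun z => by
      refine mul_left_cancel_entire (f := fun z => theta τ (z + m * w) ^ 2)
        (g := fun z => Q (z - w) * wronskD τ w m z ^ 2)
        (h := fun z => Q z * wronskD τ w m (z - w) ^ 2)
        (by fun_prop) (by fun_prop) (by fun_prop) (z₀ := z₁ - m * w) (by simpa using hz₁)
        (fun z => ?_) z
      have e1 := hrel z
      have e2 := wronskD_shift (τ := τ) (w := w) (m := m) z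
      linear_combination wronskD τ w m z ^ 2 * e1 - Q z
        * (theta τ (z + m * w) * wronskD τ w m (z - w) + theta τ (z - m * w) * wronskD τ w m z)
        * e2)
  obtain ⟨C, hC⟩ := IsAlgClosed.exists_pow_nat_eq c two_pos
  exact ⟨C, fun z => by rw [hC, ← hc z]⟩

end Setup

/-! ### From the discriminant to a solution of product form -/

section Setup

variable {τ w ε : ℂ} {m : ℕ} {y : ℕ → ℂ}

/-- The value of Φ at kw is y_k² ≠ 0 for |k| ≤ m, so zeros of Φ avoid these points modulo the
lattice, and with them the zeros of D. -/
theorem theta_add_int_ne_zero (hτ : 0 < τ.im) (hw : ∀ k : ℤ, k ≠ 0 → theta τ (k * w) ≠ 0)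
    (hy : IsLameSeq τ w m ε y) {a : ℂ} (ha : evenProd τ w m y a = 0) {k : ℤ} (h1 : -m ≤ k)
    (h2 : k ≤ m) : theta τ (a + k * w) ≠ 0 := by
  intro h
  have h3 : theta τ (a - ((-k : ℤ) : ℂ) * w) = 0 := by
    rw [← h]
    congr 1
    push_cast
    ring
  rw [(isTheta_evenProd (w := w) (m := m) (y := y) hτ).eq_zero_congr hτ one_ne_zero
    (pow_ne_zero _ (kap_ne_zero τ)) h3, evenProd_int hw (by omega) (by omega)] at ha
  exact hy.evenExt_ne_zero (by omega) (by omega) (pow_eq_zero_iff two_ne_zero |>.mp ha)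

theorem wronskD_ne_zero_of_evenProd (hτ : 0 < τ.im) (hw : ∀ k : ℤ, k ≠ 0 → theta τ (k * w) ≠ 0)
    (hy : IsLameSeq τ w m ε y) {a : ℂ} (ha : evenProd τ w m y a = 0) :
    wronskD τ w m a ≠ 0 := by
  intro h
  obtain ⟨k, h1, h2, h3⟩ := wronskD_eq_zero h
  exact theta_add_int_ne_zero hτ hw hy ha (by omega) h2 h3

theorem exists_evenProd_ne_zero (hw : ∀ k : ℤ, k ≠ 0 → theta τ (k * w) ≠ 0)
    (hy : IsLameSeq τ w m ε y) : evenProd τ w m y 0 ≠ 0 := by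
  have := evenProd_int (y := y) (m := m) hw (k := 0) (by omega) (by omega)
  rw [Int.cast_zero, zero_mul] at this
  rw [this]
  exact pow_ne_zero 2 (hy.evenExt_ne_zero (by omega) (by omega))

theorem deriv_pairTheta_ne_zero (hτ : 0 < τ.im) {b a : ℂ} (hb : theta τ (2 * b) ≠ 0)
    (ha : pairTheta τ b a = 0) : deriv (pairTheta τ b) a ≠ 0 := by
  have hθ := theta_differentiable hτ
  have hσ := isSigma_theta hτ
  have hd : HasDerivAt (pairTheta τ b) (deriv (theta τ) (a - b) * theta τ (a + b)
      + theta τ (a - b) * deriv (theta τ) (a + b)) a :=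
    ((hθ (a - b)).hasDerivAt.comp_sub_const a b).fun_mul
      ((hθ (a + b)).hasDerivAt.comp_add_const a b)
  rw [hd.deriv]
  have hne : ¬ (theta τ (a - b) = 0 ∧ theta τ (a + b) = 0) := by
    rintro ⟨h1, h2⟩
    have := theta_sub_eq_zero hτ h2 h1
    rw [show a + b - (a - b) = 2 * b by ring] at this
    exact hb this
  rcases mul_eq_zero.mp ha with h | h
  · rw [h, zero_mul, add_zero]
    exact mul_ne_zero (hσ.deriv_lattice_ne_zero h) fun h2 => hne ⟨h, h2⟩
  · rw [h, mul_zero, zero_add]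
    exact mul_ne_zero (fun h1 => hne ⟨h1, h⟩) (hσ.deriv_lattice_ne_zero h)

theorem pairTheta_ne_zero_of_congr (hτ : 0 < τ.im) {b b' a : ℂ} (h : pairTheta τ b' b ≠ 0)
    (ha : pairTheta τ b a = 0) : pairTheta τ b' a ≠ 0 := by
  have hT := isTheta_pairTheta hτ b'
  have hk := pow_ne_zero 2 (kap_ne_zero τ)
  rcases mul_eq_zero.mp ha with h1 | h1
  · rwa [Ne, hT.eq_zero_congr hτ one_ne_zero hk h1]
  · rw [← sub_neg_eq_add] at h1
    rwa [Ne, hT.eq_zero_congr hτ one_ne_zero hk h1, pairTheta_neg]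

/-- If C = 0, then s² = 4Φ(z)Φ(z+w). At a simple zero x of Φ the left side vanishes doubly, so
Φ(x+w) = 0. The zeros would then propagate along x + kw, more than the degree allows. -/
theorem IsTrace.const_ne_zero (hτ : 0 < τ.im) (hw : ∀ k : ℤ, k ≠ 0 → theta τ (k * w) ≠ 0)
    (hm : 1 ≤ m) (hy : IsLameSeq τ w m ε y) {s : ℂ → ℂ} (hs : IsTrace τ w m ε y s)
    {K : ℂ} {a : Fin m → ℂ} (hK : K ≠ 0) (ha : ∀ i, theta τ (2 * a i) ≠ 0)
    (haa : ∀ i j, i ≠ j → pairTheta τ (a i) (a j) ≠ 0)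
    (hΦ : ∀ z, evenProd τ w m y z = K * ∏ i, pairTheta τ (a i) z) {C : ℂ}
    (hC : ∀ z, s z ^ 2 - 4 * (evenProd τ w m y z * evenProd τ w m y (z + w))
      = C ^ 2 * wronskD τ w m z ^ 2) : C ≠ 0 := by
  classical
  rintro rfl
  have hT := isTheta_evenProd (w := w) (m := m) (y := y) hτ
  have hd : ∀ x, evenProd τ w m y x = 0 → deriv (evenProd τ w m y) x ≠ 0 := by
    intro x hx
    rw [hΦ, mul_eq_zero, or_iff_right hK, Finset.prod_eq_zero_iff] at hx
    obtain ⟨i, -, hi⟩ := hx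
    have e : evenProd τ w m y = fun z => pairTheta τ (a i) z *
        (K * ∏ j ∈ Finset.univ.erase i, pairTheta τ (a j) z) := by
      funext z
      rw [hΦ, ← Finset.mul_prod_erase _ _ (Finset.mem_univ i)]
      ring
    have hd2 : Differentiable ℂ fun z => K * ∏ j ∈ Finset.univ.erase i, pairTheta τ (a j) z :=
      (Differentiable.fun_finsetProd fun j _ => (isTheta_pairTheta hτ (a j)).diff).const_mul K
    rw [e, (((isTheta_pairTheta hτ (a i)).diff x).hasDerivAt.fun_mul (hd2 x).hasDerivAt).deriv,
      hi, zero_mul, add_zero]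
    refine mul_ne_zero (deriv_pairTheta_ne_zero hτ (ha i) hi) (mul_ne_zero hK
      (Finset.prod_ne_zero_iff.mpr fun j hj => ?_))
    exact pairTheta_ne_zero_of_congr hτ (haa j i (Finset.ne_of_mem_erase hj)) hi
  have step : ∀ x, evenProd τ w m y x = 0 → evenProd τ w m y (x + w) = 0 := by
    intro x hx
    have e : ∀ z, s z * s z = 4 * (evenProd τ w m y z * evenProd τ w m y (z + w)) := by
      intro z
      linear_combination hC z
    have hsx : s x = 0 := by
      have := e x
      rw [hx] at this
      simpa using this
    have h1 := (hs.isTheta.diff x).hasDerivAt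
    have h2 := (((hT.diff x).hasDerivAt.fun_mul
      ((hT.diff (x + w)).hasDerivAt.comp_add_const x w)).const_mul 4).deriv
    have h3 := (h1.fun_mul h1).deriv
    rw [show (fun z => s z * s z) = fun z => 4 * (evenProd τ w m y z * evenProd τ w m y (z + w))
      from funext e, h2, hsx, hx] at h3
    simp only [zero_mul, mul_zero, add_zero, mul_eq_zero, OfNat.ofNat_ne_zero, false_or] at h3
    exact h3.resolve_left (hd x hx)
  have hzero : ∀ k : ℕ, evenProd τ w m y (a ⟨0, hm⟩ + k * w) = 0 := by
    intro k
    induction k with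
    | zero =>
      rw [hΦ, Finset.prod_eq_zero (Finset.mem_univ (⟨0, hm⟩ : Fin m)), mul_zero]
      simp [pairTheta, theta_zero]
    | succ k ih =>
      have := step _ ih
      rw [← this]
      congr 1
      push_cast
      ring
  refine exists_evenProd_ne_zero hw hy (hT.eq_zero_of_card_lt hτ (s := Finset.range (2 * m + 1))
    (a := fun k : ℕ => a ⟨0, hm⟩ + k * w) ?_ one_ne_zero (pow_ne_zero _ (kap_ne_zero τ))
    (fun k _ => hzero k) (by simp) 0)
  intro i _ j _ hij
  rw [add_sub_add_left_eq_sub, ← sub_mul]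
  exact theta_ne_zero_of_eq hw (i - j) (by omega) (by push_cast; ring)

/-- The entire form of the equation `L ψ = ε ψ` with step `w = 2η`. -/
def LameEq (τ w : ℂ) (m : ℕ) (ε : ℂ) (ψ : ℂ → ℂ) : Prop :=
  ∀ z, theta τ (z + m * w) * ψ (z - w) + theta τ (z - m * w) * ψ (z + w)
    = ε * theta τ z * ψ z

/-- The function `e^{cz} ∏ θ(z - a_i)`. -/
def expProd (τ : ℂ) {m : ℕ} (a : Fin m → ℂ) (c z : ℂ) : ℂ := cexp (c * z) * ∏ i, theta τ (z - a i)

/-- At a zero a of Φ the discriminant relation gives s(a) = ±C D(a). The trace equation at a,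
combined with the symmetry z ↦ -z - w, shows that -a carries the opposite sign. -/
theorem exists_sign_choice (hτ : 0 < τ.im) (hw : ∀ k : ℤ, k ≠ 0 → theta τ (k * w) ≠ 0)
    (hy : IsLameSeq τ w m ε y) {s : ℂ → ℂ} (hs : IsTrace τ w m ε y s) {C : ℂ}
    (hC : ∀ z, s z ^ 2 - 4 * (evenProd τ w m y z * evenProd τ w m y (z + w))
      = C ^ 2 * wronskD τ w m z ^ 2) {a : ℂ} (ha : evenProd τ w m y a = 0) :
    ∃ a', (a' = a ∨ a' = -a) ∧ s a' = -(C * wronskD τ w m a') ∧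
      s (-a') = C * wronskD τ w m (-a') := by
  have key : ∀ (a r : ℂ), evenProd τ w m y a = 0 → s a = r * wronskD τ w m a →
      s (-a) = -r * wronskD τ w m (-a) := by
    intro a r ha h
    have e1 : s (-a) = s (a - w) := by
      rw [← hs.symm (a - w)]; congr 1; ring
    have e2 : wronskD τ w m (-a) = wronskD τ w m (a - w) := by
      rw [← wronskD_symm (a - w)]; congr 1; ring
    have e3 := hs.eqn a
    rw [ha, h] at e3
    have e4 := wronskD_shift (τ := τ) (w := w) (m := m) a
    have h0 := theta_add_int_ne_zero hτ hw hy ha (k := m) (by omega) le_rfl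
    rw [Int.cast_natCast] at h0
    rw [e1, e2]
    apply mul_left_cancel₀ h0
    linear_combination e3 + r * e4
  have h1 := hC a
  rw [ha] at h1
  have h2 : (s a - C * wronskD τ w m a) * (s a + C * wronskD τ w m a) = 0 := by
    linear_combination h1
  rcases mul_eq_zero.mp h2 with h | h
  · refine ⟨-a, Or.inr rfl, ?_, ?_⟩
    · rw [key a C ha (sub_eq_zero.mp h)]
      ring
    · rw [neg_neg]
      exact sub_eq_zero.mp h
  · have h' : s a = -C * wronskD τ w m a := by linear_combination h
    refine ⟨a, Or.inl rfl, by rw [h']; ring, ?_⟩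
    rw [key a (-C) ha h', neg_neg]

/-- Existence of a solution of product form. -/
theorem exists_expProd_solution (hτ : 0 < τ.im) (hw : ∀ k : ℤ, k ≠ 0 → theta τ (k * w) ≠ 0)
    (hm : 1 ≤ m) (hy : IsLameSeq τ w m ε y)
    {K : ℂ} {a : Fin m → ℂ} (hK : K ≠ 0) (ha : ∀ i, theta τ (2 * a i) ≠ 0)
    (haa : ∀ i j, i ≠ j → pairTheta τ (a i) (a j) ≠ 0)
    (hΦ : ∀ z, evenProd τ w m y z = K * ∏ i, pairTheta τ (a i) z) :
    ∃ (a : Fin m → ℂ) (c C : ℂ), C ≠ 0 ∧ LameEq τ w m ε (expProd τ a c) ∧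
      (∀ i j, i ≠ j → theta τ (a i - a j) ≠ 0) ∧ (∀ i, evenProd τ w m y (a i) = 0) ∧
      (∀ i j, theta τ (a i - a j + w) ≠ 0) ∧
      ∀ z, expProd τ a c z * expProd τ a c (-z - w) - expProd τ a c (z + w) * expProd τ a c (-z)
        = C * wronskD τ w m z := by
  classical
  obtain ⟨s, hs⟩ := exists_isTrace hτ hw hy
  obtain ⟨C, hC⟩ := hs.exists_sq hτ hw hy
  have hC0 := hs.const_ne_zero hτ hw hm hy hK ha haa hΦ hC
  have ha0 : ∀ i, evenProd τ w m y (a i) = 0 := by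
    intro i
    rw [hΦ, Finset.prod_eq_zero (Finset.mem_univ i), mul_zero]
    simp [pairTheta, theta_zero]
  choose a' ha' hsa hsa' using fun i => exists_sign_choice hτ hw hy hs hC (ha0 i)
  have hpair : ∀ i, pairTheta τ (a' i) = pairTheta τ (a i) := by
    intro i
    funext z
    rcases ha' i with h | h
    · rw [h]
    · rw [h, pairTheta_symm, pairTheta_neg, ← pairTheta_symm]
  have hpa : ∀ i j, i ≠ j → pairTheta τ (a' i) (a' j) ≠ 0 := by
    intro i j hij
    rw [hpair]
    rcases ha' j with h | h
    · rw [h]; exact haa i j hij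
    · rw [h, pairTheta_neg]; exact haa i j hij
  have hΦ' : ∀ z, evenProd τ w m y z
      = K * ((∏ i, theta τ (z - a' i)) * ∏ i, theta τ (z + a' i)) := by
    intro z
    rw [hΦ, ← Finset.prod_mul_distrib]
    congr 1
    refine Finset.prod_congr rfl fun i _ => ?_
    rw [← hpair, pairTheta]
  have ha0' : ∀ i, evenProd τ w m y (a' i) = 0 := by
    intro i
    rw [hΦ', Finset.prod_eq_zero (Finset.mem_univ i) (by rw [sub_self, theta_zero]), zero_mul,
      mul_zero]
  have haa' : ∀ i j, i ≠ j → theta τ (a' i - a' j) ≠ 0 := fun i j hij h =>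
    hpa j i hij.symm (by rw [pairTheta, h, zero_mul])
  have hk := kap_ne_zero τ
  have hD := isTheta_wronskD (w := w) (m := m) hτ
  have hθ := theta_differentiable hτ
  -- u and v are candidates for ψ(z)ψ(-z-w) and ψ(z+w)ψ(-z), up to constants; the chosen signs make
  -- u vanish at a'_i and v at -a'_i.
  set u : ℂ → ℂ := fun z => (1 / 2) * (s z + C * wronskD τ w m z) with hu
  set v : ℂ → ℂ := fun z => (1 / 2) * (s z - C * wronskD τ w m z) with hv
  have huT : IsTheta τ (m + m) 1 (wronskMul τ w m) u := by
    rw [← two_mul]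
    exact (hs.isTheta.add (hD.const_mul C)).const_mul _
  have hvT : IsTheta τ (m + m) 1 (wronskMul τ w m) v := by
    rw [← two_mul]
    exact (hs.isTheta.sub (hD.const_mul C)).const_mul _
  have huv : ∀ z, u z * v z = evenProd τ w m y z * evenProd τ w m y (z + w) := by
    intro z
    simp only [hu, hv]
    linear_combination (1 / 4) * hC z
  have hdiff : ∀ z, u z - v z = C * wronskD τ w m z := by
    intro z
    simp only [hu, hv]
    ring
  have hvsymm : ∀ z, v (-z - w) = v z := by
    intro z
    simp only [hv]
    rw [hs.symm, wronskD_symm]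
  have hua : ∀ i, u (a' i) = 0 := by
    intro i
    simp only [hu]
    rw [hsa i]
    ring
  have hva : ∀ i, v (-a' i) = 0 := by
    intro i
    simp only [hv]
    rw [hsa' i]
    ring
  have hcard : (Finset.univ : Finset (Fin m)).card = m := by simp
  obtain ⟨h, α₁, β₁, -, -, hhT, huh⟩ := IsTheta.exists_prod_mul hτ Finset.univ a' (n := m)
    (fun i _ j _ hij => haa' i j hij) one_ne_zero wronskMul_ne_zero (by rwa [hcard])
    (fun i _ => hua i)
  obtain ⟨k, α₂, β₂, -, -, hkT, hvk⟩ := IsTheta.exists_prod_mul hτ Finset.univ (fun i => -a' i)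
    (n := m) (fun i _ j _ hij => by
      rw [show -a' i - -a' j = a' j - a' i by ring]
      exact haa' j i hij.symm) one_ne_zero wronskMul_ne_zero (by rwa [hcard])
    (fun i _ => hva i)
  simp only [sub_neg_eq_add] at hvk
  set ψ₀ : ℂ → ℂ := fun z => ∏ i, theta τ (z - a' i) with hψ₀
  set P : ℂ → ℂ := fun z => ∏ i, theta τ (z + a' i) with hP
  have hψ₀d : Differentiable ℂ ψ₀ := (IsTheta.prod_theta_sub hτ Finset.univ a').diff
  have hPd : Differentiable ℂ P := (IsTheta.prod_theta hτ Finset.univ a').diff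
  have hΦ'' : ∀ z, evenProd τ w m y z = K * (ψ₀ z * P z) := hΦ'
  have hΦ0 := exists_evenProd_ne_zero hw hy
  have hψ₀0 : ψ₀ 0 ≠ 0 := fun h0 => hΦ0 (by rw [hΦ'', h0, zero_mul, mul_zero])
  have hP0 : P 0 ≠ 0 := fun h0 => hΦ0 (by rw [hΦ'', h0, mul_zero, mul_zero])
  have hΦd : Differentiable ℂ (evenProd τ w m y) := (isTheta_evenProd hτ).diff
  have hhk : ∀ z, h z * k z = K * evenProd τ w m y (z + w) := by
    refine mul_left_cancel_entire (f := fun z => ψ₀ z * P z) (hψ₀d.fun_mul hPd)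
      (hhT.diff.fun_mul hkT.diff) ((hΦd.comp (differentiable_id.add_const w)).const_mul K)
      (z₀ := 0) (mul_ne_zero hψ₀0 hP0) fun z => ?_
    have e1 := huv z
    rw [huh, hvk, hΦ''] at e1
    change ψ₀ z * h z * (P z * k z) = _ at e1
    change ψ₀ z * P z * (h z * k z) = ψ₀ z * P z * (K * evenProd τ w m y (z + w))
    linear_combination e1
  have hnv : ∀ i, v (a' i) ≠ 0 := by
    intro i h0
    have := hdiff (a' i)
    rw [hua, h0, sub_zero] at this
    exact mul_ne_zero hC0 (wronskD_ne_zero_of_evenProd hτ hw hy (ha0' i)) this.symm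
  -- The product h k = KΦ(z+w) vanishes here. If k vanished, then v would vanish at -a'_i - w and by
  -- symmetry at a'_i, but there u = 0 and u - v = CD ≠ 0.
  have hh0 : ∀ i, h (-(w + a' i)) = 0 := by
    intro i
    by_contra hne
    have e1 := hhk (-(w + a' i))
    rw [show -(w + a' i) + w = -a' i by ring, evenProd_neg, ha0', mul_zero] at e1
    have e2 : k (-(w + a' i)) = 0 := (mul_eq_zero.mp e1).resolve_left hne
    have e3 := hvk (-(w + a' i))
    rw [e2, mul_zero, show -(w + a' i) = -a' i - w by ring, hvsymm] at e3
    exact hnv i e3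
  have hg := IsTheta.prod_theta hτ (Finset.univ : Finset (Fin m)) fun i => w + a' i
  have hψT := IsTheta.prod_theta_sub hτ (Finset.univ : Finset (Fin m)) a'
  rw [hcard] at hg hψT
  have hhT' : IsTheta τ m ((-1) ^ m)
      (kap τ ^ m * cexp (-(2 * Real.pi * I * ∑ i, (w + a' i)))) h := by
    refine hψT.of_mul (pow_ne_zero _ (by norm_num))
      (mul_ne_zero (pow_ne_zero _ hk) (exp_ne_zero _)) hψ₀0 hhT.diff ?_
    have e : (fun z => (∏ i, theta τ (z - a' i)) * h z) = u := funext fun z => (huh z).symm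
    rw [e]
    refine huT.congr (by rw [← mul_pow]; norm_num) ?_
    rw [wronskMul, Finset.sum_add_distrib, Finset.sum_const, hcard, nsmul_eq_mul]
    have : cexp (-(2 * Real.pi * I * (m * w))) = cexp (2 * Real.pi * I * ∑ i, a' i)
        * cexp (-(2 * Real.pi * I * (m * w + ∑ i, a' i))) := by
      rw [← Complex.exp_add]; congr 1; ring
    rw [this]
    ring
  obtain ⟨x, hx⟩ := exists_prod_ne_zero_entire (Finset.univ : Finset (Fin m))
    (f := fun i z => theta τ (z + (w + a' i)))
    (fun i _ => hθ.comp (differentiable_id.add_const _))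
    (fun i _ => by
      obtain ⟨z₁, hz₁⟩ := (isSigma_theta hτ).exists_ne_zero
      exact ⟨z₁ - (w + a' i), by simpa using hz₁⟩)
  obtain ⟨l, hl⟩ := hhT'.eq_const_mul_of_zeros hτ (s := Finset.univ)
    (a := fun i => -(w + a' i)) (fun i _ j _ hij => by
      rw [show -(w + a' i) - -(w + a' j) = a' j - a' i by ring]
      exact haa' j i hij.symm) (pow_ne_zero _ (by norm_num))
    (mul_ne_zero (pow_ne_zero _ hk) (exp_ne_zero _)) hg (fun i _ => hh0 i)
    (fun i _ => Finset.prod_eq_zero (Finset.mem_univ i) (by rw [neg_add_cancel, theta_zero]))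
    (by rw [hcard]) hx
  have hgP : ∀ z, ∏ i, theta τ (z + (w + a' i)) = P (z + w) := fun z =>
    Finset.prod_congr rfl fun i _ => by rw [add_assoc]
  simp only [hgP] at hl
  have hl0 : l ≠ 0 := by
    rintro rfl
    have := hhk (-w)
    rw [hl, zero_mul, zero_mul, neg_add_cancel] at this
    exact mul_ne_zero hK hΦ0 this.symm
  have hkl : ∀ z, l * k z = K ^ 2 * ψ₀ (z + w) := by
    refine mul_left_cancel_entire (f := fun z => P (z + w))
      (hPd.comp (differentiable_id.add_const w)) (hkT.diff.const_mul l)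
      ((hψ₀d.comp (differentiable_id.add_const w)).const_mul _) (z₀ := -w)
      (by simpa using hP0) fun z => ?_
    have e1 := hhk z
    rw [hl, hΦ''] at e1
    change P (z + w) * (l * k z) = P (z + w) * (K ^ 2 * ψ₀ (z + w))
    linear_combination e1
  have hu' : ∀ z, u z = l * ψ₀ z * P (z + w) := by
    intro z
    rw [huh, hl]
    ring
  have hv' : ∀ z, l * v z = K ^ 2 * ψ₀ (z + w) * P z := by
    intro z
    rw [hvk]
    linear_combination P z * hkl z
  -- Half the trace equation plus C/2 times the equation of D. Both terms on the left contain P(z),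
  -- and so does Φ; cancelling P leaves a three-term equation for ψ₀.
  have hlin : ∀ z, theta τ (z + m * w) * u (z - w) + theta τ (z - m * w) * v z
      = ε * theta τ z * evenProd τ w m y z := by
    intro z
    simp only [hu, hv]
    linear_combination (1 / 2) * hs.eqn z + (C / 2) * wronskD_shift (τ := τ) (w := w) (m := m) z
  have hmain : ∀ z, l ^ 2 * theta τ (z + m * w) * ψ₀ (z - w)
      + K ^ 2 * theta τ (z - m * w) * ψ₀ (z + w) = l * K * ε * theta τ z * ψ₀ z := by
    refine mul_left_cancel_entire (f := P) hPd (by fun_prop) (by fun_prop) hP0 fun z => ?_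
    have e1 := hlin z
    have e2 := hu' (z - w)
    rw [sub_add_cancel] at e2
    have e3 := hv' z
    have e4 := hΦ'' z
    linear_combination l * e1 - l * theta τ (z + m * w) * e2 - theta τ (z - m * w) * e3
      + l * ε * theta τ z * e4
  have hw0 : w ≠ 0 := by
    rintro rfl
    exact hw 1 one_ne_zero (by rw [mul_zero, theta_zero])
  -- The coefficients l² and K² of the two shifts are equalized by an exponential with e^{cw} = K/l.
  set c : ℂ := Complex.log (K / l) / w with hc
  have hcw : cexp (c * w) = K / l := by
    rw [hc, div_mul_cancel₀ _ hw0, Complex.exp_log (div_ne_zero hK hl0)]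
  have hcw' : cexp (-(c * w)) = l / K := by rw [Complex.exp_neg, hcw, inv_div]
  have hψneg : ∀ z, ψ₀ (-z) = (-1) ^ m * P z := by
    intro z
    have : ∀ i, theta τ (-z - a' i) = -theta τ (z + a' i) := fun i => by
      rw [← theta_neg]; congr 1; ring
    simp only [hψ₀, hP, this]
    rw [Finset.prod_neg, hcard]
  refine ⟨a', c, (-1) ^ m * C / K, ?_, fun z => ?_, haa', ha0', fun i j h0 => ?_, fun z => ?_⟩
  · exact div_ne_zero (mul_ne_zero (pow_ne_zero _ (by norm_num)) hC0) hK
  · change theta τ (z + m * w) * (cexp (c * (z - w)) * ψ₀ (z - w))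
      + theta τ (z - m * w) * (cexp (c * (z + w)) * ψ₀ (z + w))
      = ε * theta τ z * (cexp (c * z) * ψ₀ z)
    rw [show c * (z - w) = c * z + -(c * w) by ring, mul_add c z w, Complex.exp_add,
      Complex.exp_add, hcw, hcw']
    have := hmain z
    field_simp
    linear_combination this
  -- If a'_i + w were congruent to some a'_j, then ψ₀(z+w), and with it v, would vanish at a'_i.
  · have e1 := hv' (a' i)
    have e2 : ψ₀ (a' i + w) = 0 :=
      Finset.prod_eq_zero (Finset.mem_univ j) (by rw [← h0]; congr 1; ring)
    rw [e2, mul_zero, zero_mul] at e1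
    exact mul_ne_zero hl0 (hnv i) e1
  · change cexp (c * z) * ψ₀ z * (cexp (c * (-z - w)) * ψ₀ (-z - w))
      - cexp (c * (z + w)) * ψ₀ (z + w) * (cexp (c * -z) * ψ₀ (-z)) = _
    have x1 : cexp (c * z) * cexp (c * (-z - w)) = l / K := by
      rw [← hcw', ← Complex.exp_add]; congr 1; ring
    have x2 : cexp (c * (z + w)) * cexp (c * -z) = K / l := by
      rw [← hcw, ← Complex.exp_add]; congr 1; ring
    have e1 := hψneg (z + w)
    rw [show -(z + w) = -z - w by ring] at e1
    rw [e1, hψneg z]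
    have e2 := hu' z
    have e3 := hv' z
    have e4 := hdiff z
    have y1 : cexp (c * z) * ψ₀ z * (cexp (c * (-z - w)) * ((-1) ^ m * P (z + w)))
        = (-1) ^ m * u z / K := by
      rw [e2]
      linear_combination (ψ₀ z * (-1) ^ m * P (z + w)) * x1
    have y2 : cexp (c * (z + w)) * ψ₀ (z + w) * (cexp (c * -z) * ((-1) ^ m * P z))
        = (-1) ^ m * v z / K := by
      have : v z = K ^ 2 * ψ₀ (z + w) * P z / l := by
        rw [eq_div_iff hl0]
        linear_combination e3
      have e5 : (-1) ^ m * (K ^ 2 * ψ₀ (z + w) * P z / l) / K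
          = (-1) ^ m * ψ₀ (z + w) * P z * (K / l) := by field_simp
      rw [this, e5]
      linear_combination ((-1) ^ m * ψ₀ (z + w) * P z) * x2
    rw [y1, y2]
    field_simp
    linear_combination e4

end Setup

/-! ### Product solutions and their uniqueness up to reflection -/

section Setup

variable {τ w ε c d : ℂ} {m : ℕ} {y : ℕ → ℂ} {a b : Fin m → ℂ}

theorem isTheta_expProd (hτ : 0 < τ.im) (a : Fin m → ℂ) (c : ℂ) :
    IsTheta τ m (cexp c * (-1) ^ m)
      (cexp (c * τ) * (kap τ ^ m * cexp (2 * Real.pi * I * ∑ i, a i))) (expProd τ a c) := by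
  have h := (IsTheta.exp (τ := τ) c).mul (IsTheta.prod_theta_sub hτ Finset.univ a)
  rwa [Finset.card_univ, Fintype.card_fin, zero_add] at h

theorem expProd_eq_zero_iff {z : ℂ} : expProd τ a c z = 0 ↔ ∃ i, theta τ (z - a i) = 0 := by
  simp [expProd, Finset.prod_eq_zero_iff, Complex.exp_ne_zero]

theorem expProd_neg (z : ℂ) :
    expProd τ (fun i => -a i) (-c) z = (-1) ^ m * expProd τ a c (-z) := by
  have h : ∀ i, theta τ (-z - a i) = -theta τ (z - -a i) := fun i => by
    rw [← theta_neg]; congr 1; ring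
  simp only [expProd, h]
  rw [Finset.prod_neg, Finset.card_univ, Fintype.card_fin]
  have e : ((-1 : ℂ) ^ m) * (-1) ^ m = 1 := by rw [← mul_pow]; norm_num
  rw [show -c * z = c * -z by ring]
  linear_combination -(cexp (c * -z) * ∏ i, theta τ (z - -a i)) * e

theorem exists_expProd_ne_zero (hτ : 0 < τ.im) (a : Fin m → ℂ) (c : ℂ) :
    ∃ z, expProd τ a c z ≠ 0 := by
  obtain ⟨z, hz⟩ := exists_prod_ne_zero_entire (Finset.univ : Finset (Fin m))
    (f := fun i z => theta τ (z - a i))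
    (fun i _ => (theta_differentiable hτ).comp (differentiable_id.sub_const _))
    (fun i _ => by
      obtain ⟨z₁, hz₁⟩ := (isSigma_theta hτ).exists_ne_zero
      exact ⟨z₁ + a i, by simpa using hz₁⟩)
  exact ⟨z, mul_ne_zero (exp_ne_zero _) hz⟩

theorem LameEq.neg {ψ : ℂ → ℂ} (h : LameEq τ w m ε ψ) (C : ℂ) :
    LameEq τ w m ε fun z => C * ψ (-z) := by
  intro z
  have := h (-z)
  rw [show -z + m * w = -(z - m * w) by ring, show -z - m * w = -(z + m * w) by ring, theta_neg,
    theta_neg, theta_neg, show -z - w = -(z + w) by ring, show -z + w = -(z - w) by ring] at this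
  linear_combination -C * this

/-- The function `e^{cz} ∏ θ(z - a_i)` solves the Lamé equation, and its zeros are in general
position. -/
structure IsLameRoots (τ w : ℂ) (m : ℕ) (ε : ℂ) (a : Fin m → ℂ) (c : ℂ) : Prop where
  sep : ∀ i j, i ≠ j → theta τ (a i - a j) ≠ 0
  add_ne : ∀ i, theta τ (a i + m * w) ≠ 0
  sub_ne : ∀ i, theta τ (a i - m * w) ≠ 0
  step_ne : ∀ i j, theta τ (a i - a j + w) ≠ 0
  eqn : LameEq τ w m ε (expProd τ a c)

theorem IsLameRoots.neg (h : IsLameRoots τ w m ε a c) :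
    IsLameRoots τ w m ε (fun i => -a i) (-c) where
  sep i j hij := by
    rw [show -a i - -a j = a j - a i by ring]
    exact h.sep j i hij.symm
  add_ne i := by
    rw [show -a i + m * w = -(a i - m * w) by ring, theta_neg, neg_ne_zero]
    exact h.sub_ne i
  sub_ne i := by
    rw [show -a i - m * w = -(a i + m * w) by ring, theta_neg, neg_ne_zero]
    exact h.add_ne i
  step_ne i j := by
    rw [show -a i - -a j + w = a j - a i + w by ring]
    exact h.step_ne j i
  eqn := by
    have := h.eqn.neg ((-1) ^ m)
    rwa [← funext expProd_neg] at this

theorem IsLameRoots.expProd_ne_zero (h : IsLameRoots τ w m ε a c) : expProd τ a c (m * w) ≠ 0 := by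
  rw [Ne, expProd_eq_zero_iff]
  rintro ⟨i, hi⟩
  refine h.sub_ne i ?_
  rw [theta_sub_comm, hi, neg_zero]

/-! ### Values at the multiples of the step -/

/-- Downward induction from k = m: the recurrence at k + 1 determines the value at k, since
θ((k+1+m)w) ≠ 0, and at the top the unknown value at (m+1)w has coefficient zero. -/
theorem LameEq.natCast_mul (hw : ∀ k : ℤ, k ≠ 0 → theta τ (k * w) ≠ 0) (hy : IsLameSeq τ w m ε y)
    {ψ : ℂ → ℂ} (h : LameEq τ w m ε ψ) (j : ℕ) :
    ∀ k : ℕ, k + j = m → ψ (k * w) * y m = y k * ψ (m * w) := by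
  induction j using Nat.strong_induction_on with
  | _ j ih =>
    intro k hk
    rcases j with _ | j
    · obtain rfl : k = m := by omega
      ring
    · have i1 := ih j (by omega) (k + 1) (by omega)
      have i2 : theta τ (((k + 1 : ℕ) - m) * w) * (ψ (((k + 1 : ℕ) + 1) * w) * y m)
          = theta τ (((k + 1 : ℕ) - m) * w) * (y (k + 1 + 1) * ψ (m * w)) := by
        rcases j with _ | j
        · obtain rfl : k + 1 = m := by omega
          rw [sub_self, zero_mul, theta_zero, zero_mul, zero_mul]
        · have := ih j (by omega) (k + 1 + 1) (by omega)
          rw [← this]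
          push_cast
          rfl
      have e1 := hy.recurrence (k + 1) (by omega) (by omega)
      have e2 := h ((k + 1 : ℕ) * w)
      rw [← add_mul, ← sub_mul, show ((k + 1 : ℕ) : ℂ) * w - w = k * w by push_cast; ring,
        show ((k + 1 : ℕ) : ℂ) * w + w = ((k + 1 : ℕ) + 1) * w by ring] at e2
      rw [Nat.add_sub_cancel] at e1
      have h0 : theta τ (((k + 1 : ℕ) + m) * w) ≠ 0 :=
        theta_ne_zero_of_eq hw ((k + 1 : ℕ) + m) (by omega) (by push_cast; ring)
      apply mul_left_cancel₀ h0
      linear_combination y m * e2 - ψ (m * w) * e1 + ε * theta τ ((k + 1 : ℕ) * w) * i1 - i2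

/-- The reflected function ψ(-z) is a solution too. Both agree at 0, where y_0 ≠ 0, so ψ(-mw) =
ψ(mw) and the values at negative multiples follow. -/
theorem LameEq.exists_eq_evenExt (hw : ∀ k : ℤ, k ≠ 0 → theta τ (k * w) ≠ 0)
    (hy : IsLameSeq τ w m ε y) {ψ : ℂ → ℂ} (h : LameEq τ w m ε ψ) (h0 : ψ (m * w) ≠ 0) :
    ∃ g : ℂ, g ≠ 0 ∧ ∀ k : ℤ, -m ≤ k → k ≤ m → ψ (k * w) = evenExt y k * g := by
  have hym := hy.ne_zero m le_rfl
  have e1 := h.natCast_mul hw hy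
  have e2 := (h.neg 1).natCast_mul hw hy
  simp only [one_mul] at e2
  have e3 : ψ (-(m * w)) = ψ (m * w) := by
    have h1 := e1 m 0 (by omega)
    have h2 := e2 m 0 (by omega)
    rw [Nat.cast_zero, zero_mul] at h1 h2
    rw [neg_zero] at h2
    exact mul_left_cancel₀ (hy.ne_zero 0 (by omega)) (h2.symm.trans h1)
  refine ⟨ψ (m * w) / y m, div_ne_zero h0 hym, fun k h1 h2 => ?_⟩
  rw [mul_div_assoc', eq_div_iff hym]
  rcases le_total 0 k with hk | hk
  · obtain ⟨j, rfl⟩ : ∃ j : ℕ, k = (j : ℤ) := ⟨k.natAbs, by omega⟩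
    rw [evenExt_natCast, Int.cast_natCast]
    exact e1 (m - j) j (by omega)
  · obtain ⟨j, rfl⟩ : ∃ j : ℕ, k = -(j : ℤ) := ⟨k.natAbs, by omega⟩
    rw [evenExt_neg, evenExt_natCast, Int.cast_neg, Int.cast_natCast, neg_mul, ← e3]
    exact e2 (m - j) j (by omega)

/-- The first term `ψ(z) ψ₋(z + w)` of the Wronskian of `ψ` and its reflection `ψ₋`; the second
term belongs to the reflected data. -/
def crossProd (τ w : ℂ) {m : ℕ} (a : Fin m → ℂ) (c z : ℂ) : ℂ :=
  expProd τ a c z * expProd τ (fun i => -a i) (-c) (z + w)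

theorem crossProd_neg (z : ℂ) : crossProd τ w (fun i => -a i) (-c) z
    = expProd τ a c (z + w) * expProd τ (fun i => -a i) (-c) z := by
  simp only [crossProd, neg_neg]
  ring

theorem differentiable_crossProd (hτ : 0 < τ.im) (a : Fin m → ℂ) (c : ℂ) :
    Differentiable ℂ (crossProd τ w a c) :=
  (isTheta_expProd hτ a c).diff.mul
    ((isTheta_expProd hτ (fun i => -a i) (-c)).diff.comp (differentiable_id.add_const w))

theorem isTheta_expProd_mul_neg (hτ : 0 < τ.im) (a : Fin m → ℂ) (c : ℂ) :
    IsTheta τ (2 * m) 1 (kap τ ^ (2 * m))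
      fun z => expProd τ a c z * expProd τ (fun i => -a i) (-c) z := by
  have h := (isTheta_expProd hτ a c).mul (isTheta_expProd hτ (fun i => -a i) (-c))
  rw [← two_mul] at h
  have e1 : cexp c * cexp (-c) = 1 := exp_cancel (by ring)
  have e2 : cexp (c * τ) * cexp (-c * τ) = 1 := exp_cancel (by ring)
  have e3 : cexp (2 * Real.pi * I * ∑ i, a i) * cexp (2 * Real.pi * I * ∑ i, -a i) = 1 :=
    exp_cancel (by rw [Finset.sum_neg_distrib]; ring)
  have e4 : ((-1 : ℂ) ^ m) * (-1) ^ m = 1 := by rw [← mul_pow]; norm_num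
  refine h.congr ?_ ?_
  · linear_combination ((-1 : ℂ) ^ m) * (-1) ^ m * e1 + e4
  · rw [two_mul m, pow_add]
    linear_combination kap τ ^ m * kap τ ^ m * (cexp (2 * Real.pi * I * ∑ i, a i)
      * cexp (2 * Real.pi * I * ∑ i, -a i) * e2 + e3)

theorem isTheta_crossProd (hτ : 0 < τ.im) (a : Fin m → ℂ) (c : ℂ) :
    IsTheta τ (2 * m) 1 (wronskMul τ w m) (crossProd τ w a c) := by
  have h := (isTheta_expProd hτ a c).mul ((isTheta_expProd hτ (fun i => -a i) (-c)).shift w)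
  rw [← two_mul] at h
  have e1 : cexp c * cexp (-c) = 1 := exp_cancel (by ring)
  have e2 : cexp (c * τ) * cexp (-c * τ) = 1 := exp_cancel (by ring)
  have e3 : cexp (2 * Real.pi * I * ∑ i, a i) * cexp (2 * Real.pi * I * ∑ i, -a i) = 1 :=
    exp_cancel (by rw [Finset.sum_neg_distrib]; ring)
  have e4 : ((-1 : ℂ) ^ m) * (-1) ^ m = 1 := by rw [← mul_pow]; norm_num
  refine h.congr ?_ ?_
  · linear_combination ((-1 : ℂ) ^ m) * (-1) ^ m * e1 + e4
  · rw [wronskMul, two_mul m, pow_add, ← mul_assoc (2 * (Real.pi : ℂ) * I) (m : ℂ) w]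
    linear_combination kap τ ^ m * kap τ ^ m * cexp (-(2 * Real.pi * I * m * w)) *
      (cexp (2 * Real.pi * I * ∑ i, a i) * cexp (2 * Real.pi * I * ∑ i, -a i) * e2 + e3)

/-- The normalized symmetric functions of the two Wronskian terms depend only on the eigenvalue. -/
theorem IsLameRoots.exists_const (hτ : 0 < τ.im) (hw : ∀ k : ℤ, k ≠ 0 → theta τ (k * w) ≠ 0)
    (hy : IsLameSeq τ w m ε y) {s : ℂ → ℂ} (hs : IsTrace τ w m ε y s)
    (h : IsLameRoots τ w m ε a c) : ∃ G : ℂ, G ≠ 0 ∧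
      (∀ z, expProd τ a c z * expProd τ (fun i => -a i) (-c) z = G * evenProd τ w m y z) ∧
      ∀ z, crossProd τ w a c z + crossProd τ w (fun i => -a i) (-c) z = G * s z := by
  obtain ⟨g, hg, hgk⟩ := h.eqn.exists_eq_evenExt hw hy h.expProd_ne_zero
  have e : ((-1 : ℂ) ^ m) * (-1) ^ m = 1 := by rw [← mul_pow]; norm_num
  have he : ((-1 : ℂ) ^ m) ≠ 0 := pow_ne_zero _ (by norm_num)
  have hgk' : ∀ k : ℤ, -m ≤ k → k ≤ m →
      expProd τ (fun i => -a i) (-c) (k * w) = (-1) ^ m * (evenExt y k * g) := by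
    intro k h1 h2
    rw [expProd_neg, show -((k : ℂ) * w) = ((-k : ℤ) : ℂ) * w by push_cast; ring,
      hgk _ (by omega) (by omega), evenExt_neg]
  set G : ℂ := (-1) ^ m * g ^ 2 with hG
  have hG0 : G ≠ 0 := mul_ne_zero he (pow_ne_zero _ hg)
  have hΦ : ∀ z, G⁻¹ * (expProd τ a c z * expProd τ (fun i => -a i) (-c) z)
      = evenProd τ w m y z := by
    refine eq_evenProd hτ hw ((isTheta_expProd_mul_neg hτ a c).const_mul G⁻¹) fun k h1 h2 => ?_
    rw [hgk k h1 h2, hgk' k h1 h2, inv_mul_eq_iff_eq_mul₀ hG0, hG]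
    ring
  have hΦ' : ∀ z, expProd τ a c z * expProd τ (fun i => -a i) (-c) z
      = G * evenProd τ w m y z := fun z => by rw [← hΦ z, mul_inv_cancel_left₀ hG0]
  refine ⟨G, hG0, hΦ', fun z => ?_⟩
  rw [← inv_mul_eq_iff_eq_mul₀ hG0]
  -- The normalized sum of the Wronskian terms satisfies all conditions of a trace; its equation is
  -- the sum of the Lamé equations of ψ and its reflection, each multiplied by the other function.
  refine IsTrace.unique hτ hw (s := fun z => G⁻¹ * (crossProd τ w a c z
    + crossProd τ w (fun i => -a i) (-c) z)) ⟨?_, fun z => ?_, fun k h1 h2 => ?_, fun z => ?_⟩ hs z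
  · exact ((isTheta_crossProd hτ a c).add (isTheta_crossProd hτ _ _)).const_mul _
  · simp only [crossProd_neg]
    simp only [crossProd]
    rw [expProd_neg (-z - w), expProd_neg (-z - w + w), expProd_neg z, expProd_neg (z + w)]
    ring_nf
  · simp only [crossProd_neg]
    simp only [crossProd]
    have hk : ((k : ℂ) * w + w) = ((k + 1 : ℤ) : ℂ) * w := by push_cast; ring
    rw [hk, hgk k (by omega) (by omega), hgk' k (by omega) (by omega),
      hgk (k + 1) (by omega) (by omega), hgk' (k + 1) (by omega) (by omega),
      inv_mul_eq_iff_eq_mul₀ hG0, hG]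
    ring
  · simp only [crossProd_neg]
    simp only [crossProd, sub_add_cancel]
    have e1 := h.eqn z
    have e2 := h.neg.eqn z
    linear_combination G⁻¹ * expProd τ (fun i => -a i) (-c) z * e1 + G⁻¹ * expProd τ a c z * e2
      + 2 * ε * theta τ z * hΦ z

/-- After normalization by G and H, both pairs of Wronskian terms have sum s and product Φ(z)Φ(z+w),
so they are the roots of one quadratic. Which root occurs is independent of z, since a product of
entire functions vanishes only if a factor does. -/
theorem IsLameRoots.cross_eq_or (hτ : 0 < τ.im) (hw : ∀ k : ℤ, k ≠ 0 → theta τ (k * w) ≠ 0)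
    (hy : IsLameSeq τ w m ε y) {s : ℂ → ℂ} (hs : IsTrace τ w m ε y s)
    (ha : IsLameRoots τ w m ε a c) (hb : IsLameRoots τ w m ε b d) :
    ∃ r : ℂ, r ≠ 0 ∧ ((∀ z, crossProd τ w b d z = r * crossProd τ w a c z) ∨
      ∀ z, crossProd τ w b d z = r * crossProd τ w (fun i => -a i) (-c) z) := by
  obtain ⟨G, hG, h1, h2⟩ := ha.exists_const hτ hw hy hs
  obtain ⟨H, hH, h3, h4⟩ := hb.exists_const hτ hw hy hs
  refine ⟨H / G, div_ne_zero hH hG, ?_⟩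
  have hd := differentiable_crossProd (w := w) hτ a c
  have hd' := differentiable_crossProd (w := w) hτ (fun i => -a i) (-c)
  have hd2 := differentiable_crossProd (w := w) hτ b d
  have key : ∀ z, (crossProd τ w b d z - H / G * crossProd τ w a c z)
      * (crossProd τ w b d z - H / G * crossProd τ w (fun i => -a i) (-c) z) = 0 := by
    intro z
    have p1 : crossProd τ w a c z * crossProd τ w (fun i => -a i) (-c) z
        = G ^ 2 * (evenProd τ w m y z * evenProd τ w m y (z + w)) := by
      rw [crossProd_neg, crossProd]
      linear_combination (expProd τ a c (z + w) * expProd τ (fun i => -a i) (-c) (z + w)) * h1 z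
        + G * evenProd τ w m y z * h1 (z + w)
    have p2 : crossProd τ w b d z * crossProd τ w (fun i => -b i) (-d) z
        = H ^ 2 * (evenProd τ w m y z * evenProd τ w m y (z + w)) := by
      rw [crossProd_neg, crossProd]
      linear_combination (expProd τ b d (z + w) * expProd τ (fun i => -b i) (-d) (z + w)) * h3 z
        + H * evenProd τ w m y z * h3 (z + w)
    have q1 := h2 z
    have q2 := h4 z
    field_simp
    linear_combination H ^ 2 * p1 - G ^ 2 * p2 - G * H * crossProd τ w b d z * q1
      + G ^ 2 * crossProd τ w b d z * q2
  by_cases h0 : ∀ z, crossProd τ w b d z - H / G * crossProd τ w a c z = 0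
  · exact Or.inl fun z => sub_eq_zero.mp (h0 z)
  · push Not at h0
    obtain ⟨z₀, hz₀⟩ := h0
    exact Or.inr fun z => sub_eq_zero.mp (eq_zero_of_mul_eq_zero_entire
      (hd2.fun_sub (hd.const_mul _)) (hd2.fun_sub (hd'.const_mul _)) hz₀ key z)

/-! ### Comparison of two solutions -/

theorem exists_perm_of_zeros (hτ : 0 < τ.im) (hb : ∀ i j, i ≠ j → theta τ (b i - b j) ≠ 0)
    (h : ∀ i, expProd τ a c (b i) = 0) :
    ∃ (σ : Equiv.Perm (Fin m)) (k l : Fin m → ℤ), ∀ i, b i = a (σ i) + k i + l i * τ := by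
  choose f hf using fun i => expProd_eq_zero_iff.mp (h i)
  have hinj : Function.Injective f := by
    intro i j hij
    by_contra hne
    refine hb i j hne ?_
    rw [show b i - b j = (b i - a (f i)) - (b j - a (f j)) by rw [hij]; ring]
    exact theta_sub_eq_zero hτ (hf i) (hf j)
  choose k l hkl using fun i => (theta_eq_zero_iff hτ).mp (hf i)
  exact ⟨Equiv.ofBijective f (Finite.injective_iff_bijective.mp hinj), k, l, fun i => by
    rw [Equiv.ofBijective_apply]; linear_combination hkl i⟩

theorem exists_expProd_eq_mul (hτ : 0 < τ.im) (c d : ℂ) {σ : Equiv.Perm (Fin m)} {k l : Fin m → ℤ}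
    (h : ∀ i, b i = a (σ i) + k i + l i * τ) : ∃ C : ℂ, C ≠ 0 ∧ ∀ z, expProd τ b d z
      = C * cexp ((d - c + 2 * Real.pi * I * ((∑ i, l i : ℤ) : ℂ)) * z) * expProd τ a c z := by
  have hθ := IsTheta.of_theta hτ
  choose C hC hCz using fun i => hθ.add_lattice (by norm_num) (kap_ne_zero τ) (-k i) (-l i)
  refine ⟨∏ i, (C i * cexp (-(2 * Real.pi * I * l i * a (σ i)))), Finset.prod_ne_zero_iff.mpr
    fun i _ => mul_ne_zero (hC i) (exp_ne_zero _), fun z => ?_⟩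
  have e1 : ∀ i, theta τ (z - b i) = C i * cexp (-(2 * Real.pi * I * l i * a (σ i)))
      * cexp (2 * Real.pi * I * l i * z) * theta τ (z - a (σ i)) := by
    intro i
    have := hCz i (z - a (σ i))
    rw [h i, show z - (a (σ i) + k i + l i * τ)
      = z - a (σ i) + ((-k i : ℤ) : ℂ) + ((-l i : ℤ) : ℂ) * τ by push_cast; ring, this,
      mul_assoc (C i) (cexp _) (cexp _), ← Complex.exp_add]
    congr 3
    push_cast
    ring
  simp only [expProd, e1]
  rw [Finset.prod_mul_distrib, Finset.prod_mul_distrib, ← Complex.exp_sum,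
    Equiv.prod_comp σ fun i => theta τ (z - a i), ← Finset.sum_mul, ← Finset.mul_sum]
  have e2 : cexp ((d - c + 2 * Real.pi * I * ((∑ i, l i : ℤ) : ℂ)) * z) * cexp (c * z)
      = cexp (d * z) * cexp (2 * Real.pi * I * (∑ i, (l i : ℂ)) * z) := by
    rw [← Complex.exp_add, ← Complex.exp_add]
    congr 1
    push_cast
    ring
  linear_combination -(∏ i, (C i * cexp (-(2 * Real.pi * I * l i * a (σ i)))))
    * (∏ i, theta τ (z - a i)) * e2

/-- At z = mw the equation has only two terms and fixes the ratio of the values at (m-1)w and mw,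
which an additional factor e^{γz} multiplies by e^{-γw}. This uses ε ≠ 0. -/
theorem exp_eq_one_of_eq_mul (hw : ∀ k : ℤ, k ≠ 0 → theta τ (k * w) ≠ 0) (hm : 1 ≤ m) (hε : ε ≠ 0)
    (ha : IsLameRoots τ w m ε a c) (hb : IsLameRoots τ w m ε b d) {C γ : ℂ} (hC : C ≠ 0)
    (h : ∀ z, expProd τ b d z = C * cexp (γ * z) * expProd τ a c z) : cexp (-(γ * w)) = 1 := by
  have e1 := ha.eqn (m * w)
  have e2 := hb.eqn (m * w)
  rw [sub_self, theta_zero, zero_mul, add_zero] at e1 e2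
  rw [h, h, mul_sub, sub_eq_add_neg (γ * (m * w)), Complex.exp_add] at e2
  have h0 : C * cexp (γ * (m * w)) * (ε * theta τ (m * w) * expProd τ a c (m * w)) ≠ 0 :=
    mul_ne_zero (mul_ne_zero hC (exp_ne_zero _)) (mul_ne_zero (mul_ne_zero hε
      (theta_ne_zero_of_eq hw m (by omega) (by push_cast; ring))) ha.expProd_ne_zero)
  apply mul_left_cancel₀ h0
  linear_combination e2 - C * cexp (γ * (m * w)) * cexp (-(γ * w)) * e1

/-- Two solutions of product form with proportional Wronskian terms have the same zeros. -/
theorem IsLameRoots.exists_of_cross_eq (hτ : 0 < τ.im)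
    (hw : ∀ k : ℤ, k ≠ 0 → theta τ (k * w) ≠ 0) (hm : 1 ≤ m) (hε : ε ≠ 0)
    (hy : IsLameSeq τ w m ε y) {s : ℂ → ℂ} (hs : IsTrace τ w m ε y s)
    (ha : IsLameRoots τ w m ε a c) (hb : IsLameRoots τ w m ε b d)
    {r : ℂ} (hr : r ≠ 0) (hab : ∀ z, crossProd τ w b d z = r * crossProd τ w a c z)
    (hW : ∀ z, evenProd τ w m y z = 0 →
      crossProd τ w a c z ≠ crossProd τ w (fun i => -a i) (-c) z) :
    ∃ (σ : Equiv.Perm (Fin m)) (k l : Fin m → ℤ) (n : ℤ), (∀ i, b i = a (σ i) + k i + l i * τ) ∧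
      (d - c + 2 * Real.pi * I * ((∑ i, l i : ℤ) : ℂ)) * w = 2 * Real.pi * I * n := by
  obtain ⟨G, hG, h1, -⟩ := ha.exists_const hτ hw hy hs
  obtain ⟨H, hH, h3, -⟩ := hb.exists_const hτ hw hy hs
  have hz : ∀ i, expProd τ a c (b i) = 0 := by
    intro i
    have hbi : expProd τ b d (b i) = 0 :=
      expProd_eq_zero_iff.mpr ⟨i, by rw [sub_self, theta_zero]⟩
    have hΦ : evenProd τ w m y (b i) = 0 := by
      have := h3 (b i)
      rw [hbi, zero_mul] at this
      exact (mul_eq_zero.mp this.symm).resolve_left hH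
    have hu : crossProd τ w a c (b i) = 0 := by
      have := hab (b i)
      rw [crossProd, hbi, zero_mul] at this
      exact (mul_eq_zero.mp this.symm).resolve_left hr
    -- Otherwise the reflected function vanishes at b_i, because Φ does. Then both Wronskian terms
    -- vanish there, contrary to `hW`.
    by_contra hne
    have h0 := h1 (b i)
    rw [hΦ, mul_zero] at h0
    have h0' := (mul_eq_zero.mp h0).resolve_left hne
    exact hW _ hΦ (by rw [hu, crossProd_neg, h0', mul_zero])
  obtain ⟨σ, k, l, hσ⟩ := exists_perm_of_zeros hτ hb.sep hz
  obtain ⟨C, hC, hCz⟩ := exists_expProd_eq_mul hτ c d hσ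
  have e := exp_eq_one_of_eq_mul hw hm hε ha hb hC hCz
  obtain ⟨n, hn⟩ := Complex.exp_eq_one_iff.mp e
  refine ⟨σ, k, l, -n, hσ, ?_⟩
  push_cast at hn ⊢
  linear_combination -hn

/-- If the reflected function is a w-periodic multiple of ψ, their Wronskian vanishes. This is what
separates the two classes. -/
theorem crossProd_eq_of_eq_mul {C γ : ℂ} (hγ : cexp (γ * w) = 1)
    (h : ∀ z, expProd τ (fun i => -a i) (-c) z = C * cexp (γ * z) * expProd τ a c z) (z : ℂ) :
    crossProd τ w a c z = crossProd τ w (fun i => -a i) (-c) z := by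
  rw [crossProd_neg, crossProd, h, h, mul_add, Complex.exp_add, hγ]
  ring

end Setup

/-! ### The Bethe ansatz equations -/

section Bethe

variable {τ η w ε c : ℂ} {m : ℕ} {a : Fin m → ℂ} {p : Param m}

theorem betheFunction_eq (τ η : ℂ) (p : Param m) :
    betheFunction τ η m p = expProd τ (fun i => η - p.1 i) p.2 := by
  funext z
  simp only [betheFunction, expProd]
  congr 1
  exact Finset.prod_congr rfl fun i _ => by congr 1; ring

theorem betheFunction_reflect_eq (τ η : ℂ) (p : Param m) :
    betheFunction τ η m (reflect η p) = expProd τ (fun i => -(η - p.1 i)) (-p.2) := by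
  rw [betheFunction_eq]
  simp only [reflect]
  congr 1
  funext i
  ring

theorem betheEigenvalue_eq (τ η : ℂ) (p : Param m) : betheEigenvalue τ η m p
    = theta τ (2 * (m * (2 * η))) * expProd τ (fun i => η - p.1 i) p.2 (m * (2 * η) - 2 * η)
      / (theta τ (m * (2 * η)) * expProd τ (fun i => η - p.1 i) p.2 (m * (2 * η))) := by
  have e1 : cexp (p.2 * (m * (2 * η) - 2 * η))
      = cexp (-2 * η * p.2) * cexp (p.2 * (m * (2 * η))) := by
    rw [← Complex.exp_add]; congr 1; ring
  have e2 : ∀ i, theta τ (m * (2 * η) - 2 * η - (η - p.1 i))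
      = theta τ (p.1 i + (2 * m - 3) * η) := fun i => by congr 1; ring
  have e3 : ∀ i, theta τ (m * (2 * η) - (η - p.1 i))
      = theta τ (p.1 i + (2 * m - 1) * η) := fun i => by congr 1; ring
  simp only [betheEigenvalue, expProd, e2, e3]
  rw [Finset.prod_div_distrib, e1, show 4 * η * m = 2 * (m * (2 * η)) by ring,
    show 2 * η * m = m * (2 * η) by ring]
  have h0 := Complex.exp_ne_zero (p.2 * (m * (2 * η)))
  rw [show theta τ (2 * (m * (2 * η))) * (cexp (-2 * η * p.2) * cexp (p.2 * (m * (2 * η)))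
      * ∏ i, theta τ (p.1 i + (2 * m - 3) * η))
    = cexp (p.2 * (m * (2 * η))) * (cexp (-2 * η * p.2) * theta τ (2 * (m * (2 * η)))
      * ∏ i, theta τ (p.1 i + (2 * m - 3) * η)) by ring,
    show theta τ (m * (2 * η)) * (cexp (p.2 * (m * (2 * η)))
      * ∏ i, theta τ (p.1 i + (2 * m - 1) * η))
    = cexp (p.2 * (m * (2 * η))) * (theta τ (m * (2 * η))
      * ∏ i, theta τ (p.1 i + (2 * m - 1) * η)) by ring, mul_div_mul_left _ _ h0,
    mul_div_mul_comm, mul_div_assoc]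

/-- The eigenvalue formula is the Lamé equation at z = 2ηm, where the term with ψ(z + 2η) drops out.
-/
theorem LameEq.betheEigenvalue_eq (hw : ∀ k : ℤ, k ≠ 0 → theta τ (k * (2 * η)) ≠ 0) (hm : 1 ≤ m)
    (h : LameEq τ (2 * η) m ε (expProd τ (fun i => η - p.1 i) p.2))
    (h0 : expProd τ (fun i => η - p.1 i) p.2 (m * (2 * η)) ≠ 0) :
    betheEigenvalue τ η m p = ε := by
  have hθ : theta τ (m * (2 * η)) ≠ 0 :=
    theta_ne_zero_of_eq hw m (by omega) (by push_cast; ring)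
  rw [LameBethe.betheEigenvalue_eq, div_eq_iff (mul_ne_zero hθ h0)]
  have := h (m * (2 * η))
  rw [sub_self, theta_zero, ← two_mul] at this
  linear_combination this

/-- The Bethe equation at a zero is the Lamé equation at this zero. -/
theorem bethe_iff_lame_at_root (hw : ∀ k : ℤ, k ≠ 0 → theta τ (k * w) ≠ 0)
    (i : Fin m) (hA : theta τ (a i - m * w) ≠ 0) (hQ : ∀ j, theta τ (a i - a j + w) ≠ 0) :
    theta τ (-(a i + m * w)) / theta τ (-(a i - m * w)) * ∏ j ∈ Finset.univ.erase i,
        (theta τ (a i - a j - w) / theta τ (a i - a j + w)) = cexp (2 * w * c)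
      ↔ theta τ (a i + m * w) * expProd τ a c (a i - w)
        + theta τ (a i - m * w) * expProd τ a c (a i + w) = 0 := by
  have e1 : ∀ j, theta τ (a i - w - a j) = theta τ (a i - a j - w) := fun j => by congr 1; ring
  have e2 : ∀ j, theta τ (a i + w - a j) = theta τ (a i - a j + w) := fun j => by congr 1; ring
  have hQ' : ∏ j ∈ Finset.univ.erase i, theta τ (a i - a j + w) ≠ 0 :=
    Finset.prod_ne_zero_iff.mpr fun j _ => hQ j
  have hθ : theta τ w ≠ 0 := by simpa using hw 1 one_ne_zero
  simp only [expProd, e1, e2]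
  rw [← Finset.mul_prod_erase _ _ (Finset.mem_univ i),
    ← Finset.mul_prod_erase Finset.univ (fun j => theta τ (a i - a j + w)) (Finset.mem_univ i),
    sub_self, zero_sub, zero_add, theta_neg, theta_neg, theta_neg, neg_div_neg_eq,
    Finset.prod_div_distrib, div_mul_div_comm, div_eq_iff (mul_ne_zero hA hQ')]
  have e3 : cexp (c * (a i + w)) = cexp (c * (a i - w)) * cexp (2 * w * c) := by
    rw [← Complex.exp_add]; congr 1; ring
  rw [e3]
  have h0 : cexp (c * (a i - w)) * theta τ w ≠ 0 := mul_ne_zero (exp_ne_zero _) hθ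
  constructor
  · intro h
    linear_combination -(cexp (c * (a i - w)) * theta τ w) * h
  · intro h
    apply mul_left_cancel₀ h0
    linear_combination -h

/-- The left-hand side of the Lamé equation has degree m + 1 and vanishes at the m zeros of ψ. Its
quotient by ψ has degree one and the multipliers of θ, hence equals εθ for some constant ε. -/
theorem exists_lameEq_of_roots (hτ : 0 < τ.im) (hs : ∀ i j, i ≠ j → theta τ (a i - a j) ≠ 0)
    (h : ∀ i, theta τ (a i + m * w) * expProd τ a c (a i - w)
        + theta τ (a i - m * w) * expProd τ a c (a i + w) = 0) :
    ∃ ε, LameEq τ w m ε (expProd τ a c) := by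
  have hψ := isTheta_expProd hτ a c
  have hθ := IsTheta.of_theta hτ
  have hα : cexp c * (-1) ^ m ≠ 0 := mul_ne_zero (exp_ne_zero _) (pow_ne_zero _ (by norm_num))
  have hβ : cexp (c * τ) * (kap τ ^ m * cexp (2 * Real.pi * I * ∑ i, a i)) ≠ 0 :=
    mul_ne_zero (exp_ne_zero _) (mul_ne_zero (pow_ne_zero _ (kap_ne_zero τ)) (exp_ne_zero _))
  have hG : IsTheta τ (m + 1) (cexp c * (-1) ^ m * -1)
      (cexp (c * τ) * (kap τ ^ m * cexp (2 * Real.pi * I * ∑ i, a i)) * kap τ)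
      fun z => expProd τ a c (z - w) * theta τ (z + m * w)
        + expProd τ a c (z + w) * theta τ (z - m * w) := by
    have h1 := (hψ.shift (-w)).mul (hθ.shift (m * w))
    have h2 := (hψ.shift w).mul (hθ.shift (-(m * w)))
    simp only [← sub_eq_add_neg] at h1 h2
    refine (h1.congr rfl ?_).add (h2.congr rfl ?_)
    · have : cexp (-(2 * Real.pi * I * m * -w)) * cexp (-(2 * Real.pi * I * (1 : ℕ) * (m * w)))
          = 1 := exp_cancel (by push_cast; ring)
      linear_combination (cexp (c * τ) * (kap τ ^ m * cexp (2 * Real.pi * I * ∑ i, a i))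
        * kap τ) * this
    · have : cexp (-(2 * Real.pi * I * m * w)) * cexp (-(2 * Real.pi * I * (1 : ℕ) * -(m * w)))
          = 1 := exp_cancel (by push_cast; ring)
      linear_combination (cexp (c * τ) * (kap τ ^ m * cexp (2 * Real.pi * I * ∑ i, a i))
        * kap τ) * this
  have hcard : (Finset.univ : Finset (Fin m)).card = m := by simp
  obtain ⟨f, α₁, β₁, -, -, hfT, hf⟩ := IsTheta.exists_prod_mul hτ Finset.univ a (n := 1)
    (fun i _ j _ hij => hs i j hij) (mul_ne_zero hα (neg_ne_zero.mpr one_ne_zero))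
    (mul_ne_zero hβ (kap_ne_zero τ)) (by rwa [hcard, add_comm 1 m])
    (fun i _ => by linear_combination h i)
  have hf' : ∀ z, expProd τ a c (z - w) * theta τ (z + m * w)
      + expProd τ a c (z + w) * theta τ (z - m * w)
      = expProd τ a c z * (cexp (-(c * z)) * f z) := by
    intro z
    rw [hf, expProd]
    have : cexp (c * z) * cexp (-(c * z)) = 1 := exp_cancel (by ring)
    linear_combination -(∏ i, theta τ (z - a i)) * f z * this
  obtain ⟨z₀, hz₀⟩ := exists_expProd_ne_zero hτ a c
  have hfd := hfT.diff
  have hT : IsTheta τ 1 (-1) (kap τ) fun z => cexp (-(c * z)) * f z :=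
    hψ.of_mul hα hβ hz₀ (by fun_prop) (by rwa [← funext hf'])
  obtain ⟨ε, hε⟩ := (isSigma_theta hτ).eq_const_mul hτ hT
  refine ⟨ε, fun z => ?_⟩
  have e1 := hf' z
  rw [hε] at e1
  linear_combination e1

theorem isBetheSolution_iff (hτ : 0 < τ.im) (hw : ∀ k : ℤ, k ≠ 0 → theta τ (k * (2 * η)) ≠ 0)
    (hm : 1 ≤ m) : IsBetheSolution τ η m p ∧ betheEigenvalue τ η m p = ε
      ↔ IsLameRoots τ (2 * η) m ε (fun i => η - p.1 i) p.2 := by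
  have e1 : ∀ i, theta τ (p.1 i - η * (1 + 2 * m)) = theta τ (-(η - p.1 i + m * (2 * η))) :=
    fun i => by congr 1; ring
  have e2 : ∀ i, theta τ (p.1 i - η * (1 - 2 * m)) = theta τ (-(η - p.1 i - m * (2 * η))) :=
    fun i => by congr 1; ring
  have e3 : ∀ i j, theta τ (p.1 j - p.1 i - 2 * η) = theta τ (η - p.1 i - (η - p.1 j) - 2 * η) :=
    fun i j => by congr 1; ring
  have e4 : ∀ i j, theta τ (p.1 j - p.1 i + 2 * η) = theta τ (η - p.1 i - (η - p.1 j) + 2 * η) :=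
    fun i j => by congr 1; ring
  have e5 : 4 * η * p.2 = 2 * (2 * η) * p.2 := by ring
  simp only [IsBetheSolution, e1, e2, e3, e4, e5]
  have hsep : (∀ i j : Fin m, i ≠ j → ¬ ∃ k l : ℤ, p.1 i - p.1 j = k + l * τ)
      ↔ ∀ i j, i ≠ j → theta τ (η - p.1 i - (η - p.1 j)) ≠ 0 := by
    constructor
    · intro h i j hij
      rw [Ne, theta_eq_zero_iff hτ, show η - p.1 i - (η - p.1 j) = p.1 j - p.1 i by ring]
      exact h j i hij.symm
    · intro h i j hij
      rw [← theta_eq_zero_iff hτ, show p.1 i - p.1 j = η - p.1 j - (η - p.1 i) by ring]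
      exact h j i hij.symm
  rw [hsep]
  constructor
  · rintro ⟨⟨hs, hB⟩, hε⟩
    -- A vanishing numerator or denominator would make the left side 0, by the convention x/0 = 0,
    -- while the right side is an exponential.
    have hne := fun i => (hB i).trans_ne (Complex.exp_ne_zero _)
    have n1 : ∀ i, theta τ (η - p.1 i + m * (2 * η)) ≠ 0 := fun i h0 => hne i (by
      rw [theta_neg, h0, neg_zero, zero_div, zero_mul])
    have n2 : ∀ i, theta τ (η - p.1 i - m * (2 * η)) ≠ 0 := fun i h0 => hne i (by
      rw [theta_neg τ (η - p.1 i - m * (2 * η)), h0, neg_zero, div_zero, zero_mul])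
    have n3 : ∀ i j, theta τ (η - p.1 i - (η - p.1 j) + 2 * η) ≠ 0 := by
      intro i j h0
      -- The diagonal factor θ(2η) does not occur in the Bethe equations; it is nonzero by the
      -- choice of η.
      by_cases hij : j = i
      · subst hij
        rw [sub_self, zero_add] at h0
        exact hw 1 one_ne_zero (by rwa [Int.cast_one, one_mul])
      · refine hne i ?_
        rw [Finset.prod_eq_zero (Finset.mem_erase.mpr ⟨hij, Finset.mem_univ j⟩)
          (by rw [h0, div_zero]), mul_zero]
    obtain ⟨ε', hε'⟩ := exists_lameEq_of_roots (a := fun i => η - p.1 i) (w := 2 * η) (c := p.2)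
      hτ hs fun i => (bethe_iff_lame_at_root (a := fun i => η - p.1 i) hw i (n2 i) (n3 i)).mp (hB i)
    have hroots : IsLameRoots τ (2 * η) m ε' (fun i => η - p.1 i) p.2 := ⟨hs, n1, n2, n3, hε'⟩
    rwa [← hε, hε'.betheEigenvalue_eq hw hm hroots.expProd_ne_zero]
  · intro h
    refine ⟨⟨h.sep, fun i => ?_⟩, h.eqn.betheEigenvalue_eq hw hm h.expProd_ne_zero⟩
    refine (bethe_iff_lame_at_root (a := fun i => η - p.1 i) hw i (h.sub_ne i)
      (h.step_ne i)).mpr ?_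
    have h0 : expProd τ (fun i => η - p.1 i) p.2 (η - p.1 i) = 0 :=
      expProd_eq_zero_iff.mpr ⟨i, by rw [sub_self, theta_zero]⟩
    rw [h.eqn, h0, mul_zero]

/-- The zeros of the Bethe function are η - t_i, so the lattice translations change sign. In this
form the relation matches the output of the comparison of two solutions. -/
theorem related_iff (hη : η ≠ 0) {p q : Param m} : Related τ η p q ↔
    ∃ (σ : Equiv.Perm (Fin m)) (k l : Fin m → ℤ) (n : ℤ),
      (∀ i, η - q.1 i = η - p.1 (σ i) + k i + l i * τ) ∧
      (q.2 - p.2 + 2 * Real.pi * I * ((∑ i, l i : ℤ) : ℂ)) * (2 * η) = 2 * Real.pi * I * n := by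
  constructor
  · rintro ⟨σ, k, l, n, h1, h2⟩
    refine ⟨σ, fun i => -k i, fun i => -l i, n, fun i => ?_, ?_⟩
    · rw [h1]
      push_cast
      ring
    · rw [h2]
      push_cast
      rw [Finset.sum_neg_distrib]
      field_simp
      ring
  · rintro ⟨σ, k, l, n, h1, h2⟩
    refine ⟨σ, fun i => -k i, fun i => -l i, n, fun i => ?_, ?_⟩
    · have := h1 i
      push_cast
      linear_combination -this
    · have h3 : Real.pi * I / η * n
          = q.2 - p.2 + 2 * Real.pi * I * ((∑ i, l i : ℤ) : ℂ) := by
        field_simp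
        linear_combination -h2 / 2
      rw [h3]
      push_cast
      rw [Finset.sum_neg_distrib]
      ring

end Bethe

/-! ### Meromorphic solutions -/

section Meromorphic

variable {τ η ε : ℂ} {m : ℕ} {f g : ℂ → ℂ}

theorem eventually_codiscrete_iff {P : ℂ → Prop} :
    (∀ᶠ x in codiscrete ℂ, P x) ↔ ∀ x, ∀ᶠ y in nhdsWithin x {x}ᶜ, P y := by
  rw [Filter.Eventually, mem_codiscrete]
  simp only [disjoint_principal_right, compl_compl]
  rfl

theorem eventually_codiscrete_add {P : ℂ → Prop} (h : ∀ᶠ x in codiscrete ℂ, P x) (b : ℂ) :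
    ∀ᶠ x in codiscrete ℂ, P (x + b) := by
  rw [eventually_codiscrete_iff] at *
  intro x
  refine Tendsto.eventually ?_ (h (x + b))
  refine tendsto_nhdsWithin_iff.mpr ⟨?_, ?_⟩
  · exact ((continuous_id.add continuous_const).tendsto x).mono_left nhdsWithin_le_nhds
  · filter_upwards [self_mem_nhdsWithin] with y hy
    simpa using hy

theorem eventually_codiscrete_ne_zero (hf : Differentiable ℂ f) {z₀ : ℂ} (h0 : f z₀ ≠ 0) :
    ∀ᶠ x in codiscrete ℂ, f x ≠ 0 := by
  rw [eventually_codiscrete_iff]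
  intro x
  have hf' : AnalyticOnNhd ℂ f Set.univ := fun x _ => hf.analyticAt x
  refine ((hf.analyticAt x).eventually_eq_zero_or_eventually_ne_zero).resolve_left fun h => h0 ?_
  exact hf'.eqOn_zero_of_preconnected_of_eventuallyEq_zero isPreconnected_univ (Set.mem_univ x) h
    (Set.mem_univ z₀)

theorem meromorphic_of_differentiable (hf : Differentiable ℂ f) : Meromorphic f :=
  fun x => (hf.analyticAt x).meromorphicAt

theorem eventually_codiscrete_theta_ne_zero (hτ : 0 < τ.im) :
    ∀ᶠ x in codiscrete ℂ, theta τ x ≠ 0 := by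
  obtain ⟨z, hz⟩ := (isSigma_theta hτ).exists_ne_zero
  exact eventually_codiscrete_ne_zero (theta_differentiable hτ) hz

theorem lameOp_eq_iff {x : ℂ} (hx : theta τ x ≠ 0) : lameOp τ η m f x = ε * f x ↔
    theta τ (x + m * (2 * η)) * f (x - 2 * η) + theta τ (x - m * (2 * η)) * f (x + 2 * η)
      = ε * theta τ x * f x := by
  rw [lameOp, show x + 2 * η * m = x + m * (2 * η) by ring,
    show x - 2 * η * m = x - m * (2 * η) by ring, div_mul_eq_mul_div, div_mul_eq_mul_div,
    ← add_div, div_eq_iff hx, mul_right_comm ε]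

theorem LameEq.isLameSolution (hτ : 0 < τ.im) (h : LameEq τ (2 * η) m ε f)
    (hf : Differentiable ℂ f) : IsLameSolution τ η m ε f := by
  refine ⟨meromorphic_of_differentiable hf, ?_⟩
  filter_upwards [eventually_codiscrete_theta_ne_zero hτ] with x hx
  exact (lameOp_eq_iff hx).mpr (h x)

/-- The difference Wronskian of `f` and `g` with step `2η`. -/
def wronskian (η : ℂ) (f g : ℂ → ℂ) (x : ℂ) : ℂ := f x * g (x + 2 * η) - f (x + 2 * η) * g x

theorem meromorphic_wronskian (hf : Meromorphic f) (hg : Meromorphic g) :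
    Meromorphic (wronskian η f g) :=
  (hf.mul (Meromorphic.meromorphic_fun_comp_add_const_iff_meromorphic.mpr hg)).sub
    ((Meromorphic.meromorphic_fun_comp_add_const_iff_meromorphic.mpr hf).mul hg)

/-- Eliminating ε between the two equations at x + 2η leaves a first-order equation independent of
the solutions; hence ratios of Wronskians lie in K. -/
theorem IsLameSolution.wronskian_shift (hτ : 0 < τ.im) (hf : IsLameSolution τ η m ε f)
    (hg : IsLameSolution τ η m ε g) : ∀ᶠ x in codiscrete ℂ,
      theta τ (x + 2 * η + m * (2 * η)) * wronskian η f g x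
        = theta τ (x + 2 * η - m * (2 * η)) * wronskian η f g (x + 2 * η) := by
  filter_upwards [eventually_codiscrete_add (eventually_codiscrete_theta_ne_zero hτ) (2 * η),
    eventually_codiscrete_add hf.2 (2 * η), eventually_codiscrete_add hg.2 (2 * η)] with x hx h1 h2
  rw [lameOp_eq_iff hx, add_sub_cancel_right] at h1 h2
  simp only [wronskian]
  linear_combination g (x + 2 * η) * h1 - f (x + 2 * η) * h2

/-- The quotient of two Wronskians of solutions is periodic. -/
theorem isPeriodicMeromorphic_wronskian_div (hτ : 0 < τ.im) {f' g' : ℂ → ℂ}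
    (hf : IsLameSolution τ η m ε f) (hg : IsLameSolution τ η m ε g)
    (hf' : IsLameSolution τ η m ε f') (hg' : IsLameSolution τ η m ε g')
    (hW : ∀ᶠ x in codiscrete ℂ, wronskian η f g x ≠ 0) :
    IsPeriodicMeromorphic η fun x => wronskian η f' g' x / wronskian η f g x := by
  refine ⟨(meromorphic_wronskian hf'.1 hg'.1).div (meromorphic_wronskian hf.1 hg.1), ?_⟩
  filter_upwards [hf.wronskian_shift hτ hg, hf'.wronskian_shift hτ hg', hW,
    eventually_codiscrete_add hW (2 * η),
    eventually_codiscrete_add (eventually_codiscrete_theta_ne_zero hτ) (2 * η + m * (2 * η))]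
    with x h1 h2 hx1 hx2 hx3
  rw [← add_assoc] at hx3
  rw [div_eq_div_iff hx2 hx1]
  apply mul_left_cancel₀ hx3
  linear_combination wronskian η f' g' (x + 2 * η) * h1 - wronskian η f g (x + 2 * η) * h2

theorem linIndepOverPeriodic_of_wronskian (hW : ∀ᶠ x in codiscrete ℂ, wronskian η f g x ≠ 0) :
    LinIndepOverPeriodic η f g := by
  intro A B hA hB h
  have key : ∀ᶠ x in codiscrete ℂ, A x = 0 ∧ B x = 0 := by
    filter_upwards [h, eventually_codiscrete_add h (2 * η), hA.2, hB.2, hW] with x h1 h2 h3 h4 h5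
    rw [h3, h4] at h2
    refine ⟨(mul_eq_zero.mp ?_).resolve_right h5, (mul_eq_zero.mp ?_).resolve_right h5⟩
    · rw [wronskian]
      linear_combination g (x + 2 * η) * h1 - g x * h2
    · rw [wronskian]
      linear_combination f x * h2 - f (x + 2 * η) * h1
  exact ⟨key.mono fun _ h => h.1, key.mono fun _ h => h.2⟩

/-- Cramer's rule: the coefficients are W(F,g)/W(f,g) and W(f,F)/W(f,g). -/
theorem isCombOverPeriodic_of_wronskian (hτ : 0 < τ.im) (hf : IsLameSolution τ η m ε f)
    (hg : IsLameSolution τ η m ε g) (hW : ∀ᶠ x in codiscrete ℂ, wronskian η f g x ≠ 0)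
    {F : ℂ → ℂ} (hF : IsLameSolution τ η m ε F) : IsCombOverPeriodic η f g F := by
  refine ⟨_, _, isPeriodicMeromorphic_wronskian_div hτ hf hg hF hg hW,
    isPeriodicMeromorphic_wronskian_div hτ hf hg hf hF hW, ?_⟩
  filter_upwards [hW] with x hx
  field_simp
  simp only [wronskian]
  ring

end Meromorphic

/-! ### Exceptional parameters and comparison of classes -/

section Main

variable {τ η ε : ℂ} {m : ℕ} {y : ℕ → ℂ} {p q : Param m}

/-- The exceptional values of `η`, where a nonzero multiple of `2η` is a zero of `θ`. -/
def exceptionalSet (τ : ℂ) : Set ℂ := {η | ∃ k : ℤ, k ≠ 0 ∧ theta τ (k * (2 * η)) = 0}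

theorem countable_exceptionalSet (hτ : 0 < τ.im) : (exceptionalSet τ).Countable := by
  refine (Set.countable_range fun x : ℤ × ℤ × ℤ =>
    ((x.2.1 : ℂ) + x.2.2 * τ) / (x.1 * 2)).mono ?_
  rintro η ⟨k, hk, h⟩
  obtain ⟨a, b, hab⟩ := (theta_eq_zero_iff hτ).mp h
  refine ⟨(k, a, b), ?_⟩
  have hk' : (k : ℂ) ≠ 0 := Int.cast_ne_zero.mpr hk
  simp only
  rw [← hab]
  field_simp

theorem related_of_cross_eq (hτ : 0 < τ.im) (hw : ∀ k : ℤ, k ≠ 0 → theta τ (k * (2 * η)) ≠ 0)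
    (hm : 1 ≤ m) (hε : ε ≠ 0) (hη : η ≠ 0) (hy : IsLameSeq τ (2 * η) m ε y) {s : ℂ → ℂ}
    (hs : IsTrace τ (2 * η) m ε y s)
    (hp : IsLameRoots τ (2 * η) m ε (fun i => η - p.1 i) p.2)
    (hq : IsLameRoots τ (2 * η) m ε (fun i => η - q.1 i) q.2) {r : ℂ} (hr : r ≠ 0)
    (hpq : ∀ z, crossProd τ (2 * η) (fun i => η - q.1 i) q.2 z
      = r * crossProd τ (2 * η) (fun i => η - p.1 i) p.2 z)
    (hW : ∀ z, evenProd τ (2 * η) m y z = 0 → crossProd τ (2 * η) (fun i => η - p.1 i) p.2 z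
      ≠ crossProd τ (2 * η) (fun i => -(η - p.1 i)) (-p.2) z) : Related τ η p q :=
  (related_iff hη).mpr (hp.exists_of_cross_eq hτ hw hm hε hy hs hq hr hpq hW)

theorem reflect_roots (η : ℂ) (p : Param m) :
    (fun i => η - (reflect η p).1 i) = fun i => -(η - p.1 i) := by
  funext i
  simp only [reflect]
  ring

/-- Related parameters have Bethe functions that differ by a factor C e^{γz} with e^{2ηγ} = 1, which
would make the Wronskian of ψ₊ and ψ₋ vanish identically. -/
theorem not_related_reflect (hτ : 0 < τ.im) (hη : η ≠ 0) {z : ℂ} (hz : crossProd τ (2 * η) (fun i => η - p.1 i) p.2 z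
      ≠ crossProd τ (2 * η) (fun i => -(η - p.1 i)) (-p.2) z) : ¬ Related τ η p (reflect η p) := by
  intro h
  obtain ⟨σ, k, l, n, h1, h2⟩ := (related_iff hη).mp h
  have h1' : ∀ i, -(η - p.1 i) = η - p.1 (σ i) + k i + l i * τ := fun i => by
    rw [← h1]; exact (congrFun (reflect_roots η p) i).symm
  obtain ⟨C, -, hC⟩ := exists_expProd_eq_mul (a := fun i => η - p.1 i) hτ p.2 (-p.2) h1'
  refine hz (crossProd_eq_of_eq_mul ?_ hC z)
  rw [Complex.exp_eq_one_iff]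
  refine ⟨n, ?_⟩
  change (-p.2 - p.2 + 2 * Real.pi * I * ((∑ i, l i : ℤ) : ℂ)) * (2 * η) = _ at h2
  linear_combination h2

theorem IsLameRoots.reflect (hp : IsLameRoots τ (2 * η) m ε (fun i => η - p.1 i) p.2) :
    IsLameRoots τ (2 * η) m ε (fun i => η - (reflect η p).1 i) (reflect η p).2 := by
  rw [reflect_roots]
  exact hp.neg

end Main

end LameBethe

end

theorem mainTheorem7 (m : ℕ) (hm : 1 ≤ m) (τ : ℂ) (hτ : 0 < τ.im) :
    ∃ N : Set ℂ, N.Countable ∧ ∀ η : ℂ, η ∉ N →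
      ∃ F : Set ℂ, F.Finite ∧ ∀ ε : ℂ, ε ∉ F →
        ∃ p : LameBethe.Param m,
          (LameBethe.IsBetheSolution τ η m p ∧ LameBethe.betheEigenvalue τ η m p = ε) ∧
          (LameBethe.IsBetheSolution τ η m (LameBethe.reflect η p) ∧
            LameBethe.betheEigenvalue τ η m (LameBethe.reflect η p) = ε) ∧
          LameBethe.toClass τ η p ≠ LameBethe.toClass τ η (LameBethe.reflect η p) ∧
          LameBethe.solutionClasses τ η m ε =
            {LameBethe.toClass τ η p, LameBethe.toClass τ η (LameBethe.reflect η p)} ∧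
          LameBethe.IsLameSolution τ η m ε (LameBethe.betheFunction τ η m p) ∧
          LameBethe.IsLameSolution τ η m ε
            (LameBethe.betheFunction τ η m (LameBethe.reflect η p)) ∧
          LameBethe.LinIndepOverPeriodic η (LameBethe.betheFunction τ η m p)
            (LameBethe.betheFunction τ η m (LameBethe.reflect η p)) ∧
          ∀ f : ℂ → ℂ, LameBethe.IsLameSolution τ η m ε f →
            LameBethe.IsCombOverPeriodic η (LameBethe.betheFunction τ η m p)
              (LameBethe.betheFunction τ η m (LameBethe.reflect η p)) f := by
  open LameBethe in
  refine ⟨exceptionalSet τ, countable_exceptionalSet hτ, fun η hηN => ?_⟩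
  have hw : ∀ k : ℤ, k ≠ 0 → theta τ (k * (2 * η)) ≠ 0 := fun k hk h => hηN ⟨k, hk, h⟩
  have hη : η ≠ 0 := by
    rintro rfl
    exact hw 1 one_ne_zero (by rw [mul_zero, mul_zero, theta_zero])
  obtain ⟨F, hF, hFε⟩ := exists_lameSeq hτ hw hm
  refine ⟨F, hF, fun ε hε => ?_⟩
  obtain ⟨hε0, y, hy, K, a₀, hK, ha₀, haa₀, hΦ⟩ := hFε ε hε
  obtain ⟨s, hs⟩ := exists_isTrace hτ hw hy
  obtain ⟨a, c, C, hC, heq, hsep, hroot, hstep, hwr⟩ :=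
    exists_expProd_solution hτ hw hm hy hK ha₀ haa₀ hΦ
  set p : Param m := (fun i => η - a i, c) with hp
  have hpa : (fun i => η - p.1 i) = a := funext fun i => sub_sub_cancel η (a i)
  have hpr : IsLameRoots τ (2 * η) m ε (fun i => η - p.1 i) p.2 := by
    rw [hpa]
    refine ⟨hsep, fun i => ?_, fun i => ?_, hstep, heq⟩
    · have := theta_add_int_ne_zero hτ hw hy (hroot i) (k := m) (by omega) le_rfl
      rwa [Int.cast_natCast] at this
    · have := theta_add_int_ne_zero hτ hw hy (hroot i) (k := -m) le_rfl (by omega)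
      rwa [Int.cast_neg, Int.cast_natCast, neg_mul, ← sub_eq_add_neg] at this
  -- The left side is the Wronskian of ψ₊ and ψ₋. As a nonzero multiple of D it vanishes neither
  -- identically nor at the zeros of Φ; the latter is what the uniqueness argument requires.
  have hcross : ∀ z, crossProd τ (2 * η) (fun i => η - p.1 i) p.2 z
      - crossProd τ (2 * η) (fun i => -(η - p.1 i)) (-p.2) z
      = (-1) ^ m * C * wronskD τ (2 * η) m z := by
    intro z
    rw [crossProd_neg, crossProd, expProd_neg, expProd_neg, hpa, neg_add', mul_assoc _ C, ← hwr z]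
    ring
  have hC' : (-1) ^ m * C ≠ 0 := mul_ne_zero (pow_ne_zero _ (by norm_num)) hC
  have hne : ∀ z, wronskD τ (2 * η) m z ≠ 0 → crossProd τ (2 * η) (fun i => η - p.1 i) p.2 z
      ≠ crossProd τ (2 * η) (fun i => -(η - p.1 i)) (-p.2) z := by
    intro z hz h
    have := hcross z
    rw [h, sub_self] at this
    exact mul_ne_zero hC' hz this.symm
  have hWne : ∀ z, evenProd τ (2 * η) m y z = 0 →
      crossProd τ (2 * η) (fun i => η - p.1 i) p.2 z
        ≠ crossProd τ (2 * η) (fun i => -(η - p.1 i)) (-p.2) z := fun z hz =>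
    hne z (wronskD_ne_zero_of_evenProd hτ hw hy hz)
  have hpr' := hpr.reflect
  have hpB := (isBetheSolution_iff hτ hw hm).mpr hpr
  have hpB' := (isBetheSolution_iff hτ hw hm).mpr hpr'
  obtain ⟨z₁, hz₁⟩ := exists_wronskD_ne_zero (w := 2 * η) (m := m) hτ
  have hsol : IsLameSolution τ η m ε (betheFunction τ η m p) := by
    rw [betheFunction_eq]
    exact hpr.eqn.isLameSolution hτ (isTheta_expProd hτ _ _).diff
  have hsol' : IsLameSolution τ η m ε (betheFunction τ η m (reflect η p)) := by
    rw [betheFunction_eq]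
    exact hpr'.eqn.isLameSolution hτ (isTheta_expProd hτ _ _).diff
  have hW : ∀ᶠ x in codiscrete ℂ,
      wronskian η (betheFunction τ η m p) (betheFunction τ η m (reflect η p)) x ≠ 0 := by
    filter_upwards [eventually_codiscrete_ne_zero (isTheta_wronskD hτ).diff hz₁] with x hx h
    refine hne x hx (sub_eq_zero.mp ?_)
    rw [crossProd_neg, crossProd, ← betheFunction_eq, ← betheFunction_reflect_eq]
    exact h
  refine ⟨p, hpB, hpB', fun h => not_related_reflect hτ hη (hne z₁ hz₁) (Quotient.exact h), ?_,
    hsol, hsol', linIndepOverPeriodic_of_wronskian hW,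
    fun f hf => isCombOverPeriodic_of_wronskian hτ hsol hsol' hW hf⟩
  refine Set.Subset.antisymm ?_ ?_
  · rintro _ ⟨q, hq, rfl⟩
    have hqr := (isBetheSolution_iff hτ hw hm).mp hq
    obtain ⟨r, hr, h | h⟩ := hpr.cross_eq_or hτ hw hy hs hqr
    · exact Or.inl (Quotient.sound
        (related_of_cross_eq hτ hw hm hε0 hη hy hs hpr hqr hr h hWne).symm)
    -- The second root of the quadratic belongs to the reflected parameters, so the same comparison
    -- applies with the reflection of p in place of p.
    · refine Or.inr (Quotient.sound
        (related_of_cross_eq hτ hw hm hε0 hη hy hs hpr' hqr hr ?_ ?_).symm)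
      · rwa [reflect_roots]
      · rw [reflect_roots]
        intro z hz
        have e1 : (fun i => -(η - (LameBethe.reflect η p).1 i)) = fun i => η - p.1 i := by
          funext i
          simp only [LameBethe.reflect]
          ring
        rw [e1, show -(LameBethe.reflect η p).2 = p.2 from neg_neg _]
        exact (hWne z hz).symm
  · rintro _ (rfl | rfl)
    · exact ⟨p, hpB, rfl⟩
    · exact ⟨reflect η p, hpB', rfl⟩
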